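/- Let $(M^m,g)$ be a smooth Riemannian manifold, $f\in C^\infty(M)$, and let $\Sigma^n$ be an immersed submanifold of $M$ (without boundary, of any codimension), given by a smooth immersion $\iota:\Sigma\to M$. For an immersion $F:\Sigma\to M$ and $T\subset\Sigma$ let $\mathcal A_f(F,T)=\int_T e^{-f\circ F}\,dA_F$, where $dA_F$ is the Riemannian volume of $F^*g$. A compactly supported variation of $\Sigma$ is a smooth family of immersions $F_t:\Sigma\to M$, $-\epsilon<t<\epsilon$, with $F_0=\iota$ and $F_t=\iota$ outside a compact set $K\subset\Sigma$ for all $t$. Suppose that $\Sigma$ is $f$-minimal, i.e. $\frac{d}{dt}\big|_{t=0}\mathcal A_f(F_t,K)=0$ for every compactly supported variation. Let $\nabla$ and $R(X,Y)Z=\nabla_X\nabla_YZ-\nabla_Y\nabla_XZ-\nabla_{[X,Y]}Z$ be the Levi-Civita connection and the curvature of $M$; below, $e_1,\dots,e_n$ is a smooth local orthonormal frame of $T\Sigma$, and $\perp$ and $T$ denote the parts normal and tangential to $\Sigma$. (1) In every local orthonormal frame, $H=\nabla^\perp f$, where $H=-\sum_{i=1}^n\nabla^\perp_{e_i}e_i$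 is the mean curvature vector. (2) Let $F_t$ be a compactly supported variation as above whose variational field $\partial_tF_t$ is normal to $\Sigma_t=F_t(\Sigma)$ for every $t\in(-\epsilon,\epsilon)$, and let $\nu=\partial_tF_t|_{t=0}$. Then there is a function $Q$ on $\Sigma$ which in every local orthonormal frame is $$Q=-\sum_{i=1}^n R_{i\nu\nu i}-\tfrac12\Delta_\Sigma(|\nu|^2)+|\nabla_\Sigma\nu|^2-2|A^\nu|^2-f_{\nu\nu}+\tfrac12\langle\nabla^Tf,\nabla^T(|\nu|^2)\rangle ,$$ where $R_{i\nu\nu i}=\langle R(e_i,\nu)\nu,e_i\rangle$, $\Delta_\Sigma$ is the Laplacian (trace of the Hessian) of the induced metric, $|\nabla_\Sigma\nu|^2=\sum_i|\nabla_{e_i}\nu|^2$, $A^\nu_{ij}=-\langle\nabla_{e_i}e_j,\nu\rangle$, $|A^\nu|^2=\sum_{i,j}(A^\nu_{ij})^2$ and $f_{\nu\nu}=\nabla^2f(\nu,\nu)$. The function $e^{-f}Q$ is integrable on $\Sigma$, and for every measurable $T\supset K$ with $\mathcal A_f(\iota,T)<\infty$ (for instance $T=K$, or $T=\Sigma$ if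 $\Sigma$ has finite weighted area) the function $t\mapsto\mathcal A_f(F_t,T)$ is differentiable on $(-\epsilon,\epsilon)$ and twice differentiable at $0$, with $$\frac{d^2}{dt^2}\Big|_{t=0}\mathcal A_f(F_t,T)=\int_\Sigma e^{-f}Q .$$ -/

import Mathlib

open scoped Manifold ContDiff Topology Bundle

noncomputable section

namespace WeightedMinimal

/-! ## Riemannian geometry in charts

Manifolds are modelled on `EuclideanSpace ℝ (Fin k)`. Mathlib's tangent space at `q` is the model
space, read through the preferred chart `extChartAt (𝓡 k) q`, whose derivative at `q` is therefore
the identity. -/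

section Intrinsic

variable {k : ℕ} {N : Type*} [TopologicalSpace N]
  [ChartedSpace (EuclideanSpace ℝ (Fin k)) N]

/-- The `i`-th standard basis vector of the model space. -/
def stdVec {k : ℕ} (i : Fin k) : EuclideanSpace ℝ (Fin k) := EuclideanSpace.single i 1

/-- Mathlib's identification of the model space with the tangent space at `q`. -/
def toTangent (q : N) (v : EuclideanSpace ℝ (Fin k)) : TangentSpace (𝓡 k) q := v

/-- Mathlib's identification of the tangent space at `q` with the model space. -/
def ofTangent {q : N} (v : TangentSpace (𝓡 k) q) : EuclideanSpace ℝ (Fin k) := v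

/-- The coefficients of a metric `h` in the preferred chart at `q`, as a function of the point `u`
of the model space: `chartGram h q u i j = h (∂ᵢ, ∂ⱼ)`. -/
def chartGram (h : (x : N) → TangentSpace (𝓡 k) x → TangentSpace (𝓡 k) x → ℝ) (q : N)
    (u : EuclideanSpace ℝ (Fin k)) : Matrix (Fin k) (Fin k) ℝ :=
  Matrix.of fun i j =>
    h ((extChartAt (𝓡 k) q).symm u)
      (mfderiv (𝓡 k) (𝓡 k) (extChartAt (𝓡 k) q).symm u (toTangent u (stdVec i)))
      (mfderiv (𝓡 k) (𝓡 k) (extChartAt (𝓡 k) q).symm u (toTangent u (stdVec j)))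

/-- The partial derivative `∂_l h_{ij}` in the preferred chart at `q`. -/
def chartGramDeriv (h : (x : N) → TangentSpace (𝓡 k) x → TangentSpace (𝓡 k) x → ℝ) (q : N)
    (u : EuclideanSpace ℝ (Fin k)) (l i j : Fin k) : ℝ :=
  fderiv ℝ (fun u' => chartGram h q u' i j) u (stdVec l)

/-- The Christoffel symbol
`Γ^l_{ij} = 1/2 ∑ₐ h^{la} (∂ᵢ h_{ja} + ∂ⱼ h_{ia} - ∂ₐ h_{ij})` of the Levi-Civita connection. -/
def christoffelSymbol (h : (x : N) → TangentSpace (𝓡 k) x → TangentSpace (𝓡 k) x → ℝ) (q : N)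
    (u : EuclideanSpace ℝ (Fin k)) (l i j : Fin k) : ℝ :=
  (1 / 2 : ℝ) * ∑ a : Fin k, (chartGram h q u)⁻¹ l a *
    (chartGramDeriv h q u i j a + chartGramDeriv h q u j i a - chartGramDeriv h q u a i j)

/-- The Christoffel bilinear map `Γ(v, w) = (∑_{ij} Γ^l_{ij} vⁱ wʲ)_l` in the preferred chart
at `q`. -/
def christoffel (h : (x : N) → TangentSpace (𝓡 k) x → TangentSpace (𝓡 k) x → ℝ) (q : N)
    (u v w : EuclideanSpace ℝ (Fin k)) : EuclideanSpace ℝ (Fin k) :=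
  WithLp.toLp 2 fun l => ∑ i : Fin k, ∑ j : Fin k, christoffelSymbol h q u l i j * v i * w j

/-- The Riemann curvature tensor `R(x, y) z = ∇_x ∇_y z - ∇_y ∇_x z - ∇_[x,y] z` at `q`, computed
with vector fields that are constant in the preferred chart at `q`. -/
def curvature (h : (x : N) → TangentSpace (𝓡 k) x → TangentSpace (𝓡 k) x → ℝ) (q : N)
    (x y z : TangentSpace (𝓡 k) q) : TangentSpace (𝓡 k) q :=
  let u : EuclideanSpace ℝ (Fin k) := extChartAt (𝓡 k) q q
  let Γ : EuclideanSpace ℝ (Fin k) → EuclideanSpace ℝ (Fin k) → EuclideanSpace ℝ (Fin k) →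
      EuclideanSpace ℝ (Fin k) := christoffel h q
  let x' : EuclideanSpace ℝ (Fin k) := ofTangent x
  let y' : EuclideanSpace ℝ (Fin k) := ofTangent y
  let z' : EuclideanSpace ℝ (Fin k) := ofTangent z
  toTangent q (fderiv ℝ (fun u' => Γ u' y' z') u x' - fderiv ℝ (fun u' => Γ u' x' z') u y'
    + Γ u x' (Γ u y' z') - Γ u y' (Γ u x' z'))

/-- The gradient of `φ` at `q`: its components are `∑ⱼ h^{ij} ∂ⱼ φ`. -/
def gradient (h : (x : N) → TangentSpace (𝓡 k) x → TangentSpace (𝓡 k) x → ℝ) (φ : N → ℝ)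
    (q : N) : TangentSpace (𝓡 k) q :=
  let u : EuclideanSpace ℝ (Fin k) := extChartAt (𝓡 k) q q
  toTangent q (WithLp.toLp 2 fun i => ∑ j : Fin k,
    (chartGram h q u)⁻¹ i j * fderiv ℝ (φ ∘ (extChartAt (𝓡 k) q).symm) u (stdVec j))

/-- The Hessian `∇²φ (v, w)` at `q`: in coordinates, `∂ᵢ∂ⱼφ - Γ^l_{ij} ∂_lφ`. -/
def hessian (h : (x : N) → TangentSpace (𝓡 k) x → TangentSpace (𝓡 k) x → ℝ) (φ : N → ℝ)
    (q : N) (v w : TangentSpace (𝓡 k) q) : ℝ :=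
  let u : EuclideanSpace ℝ (Fin k) := extChartAt (𝓡 k) q q
  let φ' : EuclideanSpace ℝ (Fin k) → ℝ := φ ∘ (extChartAt (𝓡 k) q).symm
  fderiv ℝ (fun u' => fderiv ℝ φ' u' (ofTangent w)) u (ofTangent v)
    - fderiv ℝ φ' u (christoffel h q u (ofTangent v) (ofTangent w))

/-- The Laplace-Beltrami operator `Δφ = ∑_{ij} h^{ij} ∇²φ (∂ᵢ, ∂ⱼ)` (the trace of the Hessian). -/
def laplacian (h : (x : N) → TangentSpace (𝓡 k) x → TangentSpace (𝓡 k) x → ℝ) (φ : N → ℝ)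
    (q : N) : ℝ :=
  ∑ i : Fin k, ∑ j : Fin k, (chartGram h q (extChartAt (𝓡 k) q q))⁻¹ i j *
    hessian h φ q (toTangent q (stdVec i)) (toTangent q (stdVec j))

/-- The Riemannian volume measure of the metric `h`. In the preferred chart at `p` it is
`√(det h_{ij}) du`. The measures carried in this way by the various chart domains agree on
overlaps, and the volume measure is their supremum. -/
def riemannianVolume [MeasurableSpace N]
    (h : (x : N) → TangentSpace (𝓡 k) x → TangentSpace (𝓡 k) x → ℝ) :
    MeasureTheory.Measure N :=
  ⨆ p : N, MeasureTheory.Measure.map (extChartAt (𝓡 k) p).symm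
    ((MeasureTheory.volume.restrict (extChartAt (𝓡 k) p).target).withDensity
      fun u => ENNReal.ofReal (Real.sqrt (chartGram h p u).det))

end Intrinsic

/-! ## Immersed submanifolds -/

section Submanifold

variable {m n : ℕ} {M : Type*} [TopologicalSpace M]
  [ChartedSpace (EuclideanSpace ℝ (Fin m)) M] [IsManifold (𝓡 m) ∞ M]
  {S : Type*} [TopologicalSpace S] [ChartedSpace (EuclideanSpace ℝ (Fin n)) S]
  [IsManifold (𝓡 n) ∞ S]

/-- The inner product `⟨v, w⟩` of a Riemannian metric on `M`, as a plain function. -/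
def metricFn
    (g : Bundle.ContMDiffRiemannianMetric (𝓡 m) ∞ (EuclideanSpace ℝ (Fin m))
      (fun x : M => TangentSpace (𝓡 m) x)) :
    (x : M) → TangentSpace (𝓡 m) x → TangentSpace (𝓡 m) x → ℝ :=
  fun x v w => g.inner x v w

/-- The metric induced on `S` by a map `F : S → M`. -/
def inducedMetric
    (g : Bundle.ContMDiffRiemannianMetric (𝓡 m) ∞ (EuclideanSpace ℝ (Fin m))
      (fun x : M => TangentSpace (𝓡 m) x)) (F : S → M) :
    (x : S) → TangentSpace (𝓡 n) x → TangentSpace (𝓡 n) x → ℝ :=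
  fun x v w => g.inner (F x) (mfderiv (𝓡 n) (𝓡 m) F x v) (mfderiv (𝓡 n) (𝓡 m) F x w)

/-- Smooth immersions. -/
def IsSmoothImmersion (F : S → M) : Prop :=
  ContMDiff (𝓡 n) (𝓡 m) ∞ F ∧ ∀ x, Function.Injective (mfderiv (𝓡 n) (𝓡 m) F x)

/-- A vector of `T_{F x} M` is normal if it is orthogonal to the image of `T_x S`. -/
def IsNormalVec
    (g : Bundle.ContMDiffRiemannianMetric (𝓡 m) ∞ (EuclideanSpace ℝ (Fin m))
      (fun x : M => TangentSpace (𝓡 m) x)) (F : S → M) (x : S)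
    (w : TangentSpace (𝓡 m) (F x)) : Prop :=
  ∀ v : TangentSpace (𝓡 n) x, g.inner (F x) w (mfderiv (𝓡 n) (𝓡 m) F x v) = 0

/-- The normal part `w - ∑_{ij} G^{ij} ⟨w, dF ∂ᵢ⟩ dF ∂ⱼ` of a vector `w` of `T_{F x} M`, where
`(G^{ij})` is the inverse of the Gram matrix `⟨dF ∂ᵢ, dF ∂ⱼ⟩`. -/
def normalPart
    (g : Bundle.ContMDiffRiemannianMetric (𝓡 m) ∞ (EuclideanSpace ℝ (Fin m))
      (fun x : M => TangentSpace (𝓡 m) x)) (F : S → M) (x : S)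
    (w : TangentSpace (𝓡 m) (F x)) : TangentSpace (𝓡 m) (F x) :=
  let b : Fin n → TangentSpace (𝓡 m) (F x) := fun i =>
    mfderiv (𝓡 n) (𝓡 m) F x (toTangent x (stdVec i))
  let G : Matrix (Fin n) (Fin n) ℝ := Matrix.of fun i j => g.inner (F x) (b i) (b j)
  w - ∑ i : Fin n, ∑ j : Fin n, (G⁻¹ i j * g.inner (F x) w (b i)) • b j

/-- The covariant derivative `∇_v V` at `x`, for the Levi-Civita connection of `M`, of a vector
field `V` along `F : S → M` in the direction `v : T_x S`. In the preferred chart at `F x`, it is the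
derivative of the components of `V` plus `Γ(dF v, V)`. -/
def covDerivAlong
    (g : Bundle.ContMDiffRiemannianMetric (𝓡 m) ∞ (EuclideanSpace ℝ (Fin m))
      (fun x : M => TangentSpace (𝓡 m) x)) (F : S → M)
    (V : (y : S) → TangentSpace (𝓡 m) (F y)) (x : S) (v : TangentSpace (𝓡 n) x) :
    TangentSpace (𝓡 m) (F x) :=
  let q : M := F x
  let comp : S → EuclideanSpace ℝ (Fin m) := fun y =>
    ofTangent (mfderiv (𝓡 m) (𝓡 m) (extChartAt (𝓡 m) q) (F y) (V y))
  toTangent q (ofTangent (mfderiv (𝓡 n) (𝓡 m) comp x v)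
    + christoffel (metricFn g) q (extChartAt (𝓡 m) q q)
        (ofTangent (mfderiv (𝓡 n) (𝓡 m) F x v)) (ofTangent (V x)))

/-- `e` is a smooth orthonormal frame of `T S`, for the metric induced by `F`, on the set `U`. -/
def IsOrthonormalFrameOn
    (g : Bundle.ContMDiffRiemannianMetric (𝓡 m) ∞ (EuclideanSpace ℝ (Fin m))
      (fun x : M => TangentSpace (𝓡 m) x)) (F : S → M) (U : Set S)
    (e : Fin n → (x : S) → TangentSpace (𝓡 n) x) : Prop :=
  (∀ i, ContMDiffOn (𝓡 n) (𝓡 n).tangent ∞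
      (fun x => (⟨x, e i x⟩ : TangentBundle (𝓡 n) S)) U) ∧
  ∀ x ∈ U, ∀ i j, inducedMetric (n := n) g F x (e i x) (e j x) = if i = j then 1 else 0

/-- The vector `∇_{eᵢ} eⱼ` of `T_{F x} M` for a frame `e` of the submanifold. -/
def frameDeriv
    (g : Bundle.ContMDiffRiemannianMetric (𝓡 m) ∞ (EuclideanSpace ℝ (Fin m))
      (fun x : M => TangentSpace (𝓡 m) x)) (F : S → M)
    (e : Fin n → (x : S) → TangentSpace (𝓡 n) x) (x : S) (i j : Fin n) :
    TangentSpace (𝓡 m) (F x) :=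
  covDerivAlong (n := n) g F (fun y => mfderiv (𝓡 n) (𝓡 m) F y (e j y)) x (e i x)

/-- The mean curvature vector `H = - ∑ᵢ ∇^⊥_{eᵢ} eᵢ` in an orthonormal frame `e`. -/
def meanCurvature
    (g : Bundle.ContMDiffRiemannianMetric (𝓡 m) ∞ (EuclideanSpace ℝ (Fin m))
      (fun x : M => TangentSpace (𝓡 m) x)) (F : S → M)
    (e : Fin n → (x : S) → TangentSpace (𝓡 n) x) (x : S) : TangentSpace (𝓡 m) (F x) :=
  -∑ i : Fin n, normalPart (n := n) g F x (frameDeriv (n := n) g F e x i i)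

/-- `A^ν_{ij} = - ⟨∇_{eᵢ} eⱼ, ν⟩` in a frame `e`. -/
def secondFundCoeff
    (g : Bundle.ContMDiffRiemannianMetric (𝓡 m) ∞ (EuclideanSpace ℝ (Fin m))
      (fun x : M => TangentSpace (𝓡 m) x)) (F : S → M)
    (ν : (x : S) → TangentSpace (𝓡 m) (F x))
    (e : Fin n → (x : S) → TangentSpace (𝓡 n) x) (x : S) (i j : Fin n) : ℝ :=
  -g.inner (F x) (frameDeriv (n := n) g F e x i j) (ν x)

/-- The function `|ν|²` on `S`. -/
def normSq
    (g : Bundle.ContMDiffRiemannianMetric (𝓡 m) ∞ (EuclideanSpace ℝ (Fin m))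
      (fun x : M => TangentSpace (𝓡 m) x)) (F : S → M)
    (ν : (x : S) → TangentSpace (𝓡 m) (F x)) : S → ℝ :=
  fun x => g.inner (F x) (ν x) (ν x)

/-- The expression
`-∑ᵢ R_{iννi} - ½ Δ_S |ν|² + |∇_S ν|² - 2 |A^ν|² - f_{νν} + ½ ⟨∇ᵀf, ∇ᵀ|ν|²⟩`
in an orthonormal frame `e`; here `R_{iννi} = ⟨R(eᵢ, ν) ν, eᵢ⟩`, `|∇_S ν|² = ∑ᵢ |∇_{eᵢ} ν|²` and
`∇ᵀ` is the gradient on `S` for the induced metric. -/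
def secondVariationExpr
    (g : Bundle.ContMDiffRiemannianMetric (𝓡 m) ∞ (EuclideanSpace ℝ (Fin m))
      (fun x : M => TangentSpace (𝓡 m) x)) (f : M → ℝ) (F : S → M)
    (ν : (x : S) → TangentSpace (𝓡 m) (F x))
    (e : Fin n → (x : S) → TangentSpace (𝓡 n) x) (x : S) : ℝ :=
  -(∑ i : Fin n, g.inner (F x)
      (curvature (metricFn g) (F x) (mfderiv (𝓡 n) (𝓡 m) F x (e i x)) (ν x) (ν x))
      (mfderiv (𝓡 n) (𝓡 m) F x (e i x)))
    - (1 / 2 : ℝ) * laplacian (inducedMetric (n := n) g F) (normSq g F ν) x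
    + ∑ i : Fin n, g.inner (F x) (covDerivAlong (n := n) g F ν x (e i x)) (covDerivAlong (n := n) g F ν x (e i x))
    - 2 * ∑ i : Fin n, ∑ j : Fin n, secondFundCoeff (n := n) g F ν e x i j ^ 2
    - hessian (metricFn g) f (F x) (ν x) (ν x)
    + (1 / 2 : ℝ) * inducedMetric (n := n) g F x (gradient (inducedMetric (n := n) g F) (f ∘ F) x)
        (gradient (inducedMetric (n := n) g F) (normSq g F ν) x)

/-- The weighted area `∫_T e^{-f} dA` of the part `F(T)` of an immersed submanifold `F : S → M`;
`dA` is the Riemannian volume of the induced metric. -/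
def weightedArea [MeasurableSpace S]
    (g : Bundle.ContMDiffRiemannianMetric (𝓡 m) ∞ (EuclideanSpace ℝ (Fin m))
      (fun x : M => TangentSpace (𝓡 m) x)) (f : M → ℝ) (F : S → M) (T : Set S) : ℝ :=
  ∫ x in T, Real.exp (-f (F x)) ∂(riemannianVolume (inducedMetric (n := n) g F))

/-- `F t`, `-ε < t < ε`, is a smooth family of immersions that starts at `ι` and is constant in `t`
outside the compact set `K`. -/
structure IsVariation (ι : S → M) (ε : ℝ) (F : ℝ → S → M) (K : Set S) : Prop where
  pos : 0 < ε
  smooth : ContMDiffOn (𝓘(ℝ, ℝ).prod (𝓡 n)) (𝓡 m) ∞ (fun p : ℝ × S => F p.1 p.2)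
    (Set.Ioo (-ε) ε ×ˢ Set.univ)
  immersion : ∀ t ∈ Set.Ioo (-ε) ε, ∀ x, Function.Injective (mfderiv (𝓡 n) (𝓡 m) (F t) x)
  start : F 0 = ι
  isCompact : IsCompact K
  const : ∀ t ∈ Set.Ioo (-ε) ε, ∀ x ∉ K, F t x = ι x

/-- The variational vector field `∂F/∂t` of a family at time `t`. -/
def velocity (F : ℝ → S → M) (t : ℝ) (x : S) : TangentSpace (𝓡 m) (F t x) :=
  mfderiv 𝓘(ℝ, ℝ) (𝓡 m) (fun s : ℝ => F s x) t (1 : ℝ)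

/-- `ι` is `f`-minimal: the first variation of the weighted area vanishes for every compactly
supported variation. -/
def IsFMinimal [MeasurableSpace S]
    (g : Bundle.ContMDiffRiemannianMetric (𝓡 m) ∞ (EuclideanSpace ℝ (Fin m))
      (fun x : M => TangentSpace (𝓡 m) x)) (f : M → ℝ) (ι : S → M) : Prop :=
  ∀ (ε : ℝ) (F : ℝ → S → M) (K : Set S), IsVariation (m := m) (n := n) ι ε F K →
    HasDerivAt (fun t => weightedArea (n := n) g f (F t) K) 0 0

end Submanifold

end WeightedMinimal

end

set_option linter.unusedSectionVars false

noncomputable section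

namespace WeightedMinimal

/-! ## Derivatives of determinants -/

section Determinant

variable {ι : Type*} [Fintype ι] [DecidableEq ι]

/-! Measured against the fixed volume of `F 0`, the weighted area of `F t` over `T` is the integral
over `T` of a density ρ_t, the product of exp(-f ∘ F_t) and the ratio √det(Gram of F_t) / √det(Gram
of F_0), which does not depend on the chart (`IsSmoothFamily.weightedArea_eq`). Off the compact set
`K` this density is constant in t, so both time derivatives pass under the integral
(`IsLocallySmooth.hasDerivAt_integral`), and what remains is pointwise. In charts the family is a
smooth map from an open subset of ℝ × ℝⁿ to ℝᵐ with a metric G and its Levi-Civita map Γ, and all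
the geometry follows from three facts about derivatives along this map: compatibility with G, the
symmetry ∇_a ∂_b F = ∇_b ∂_a F, and the fact that ∇_a and ∇_b commute up to curvature.

First variation. If the velocity V is normal along the initial slice, then ρ' = -e^{-f} (df(V) + ∑
g^{ij} ⟨V, ∇_i ∂_j F⟩) at t = 0. The bracket is linear in V. If it were negative at some point for
some normal vector, a cutoff of a normal extension of that vector would generate a variation with ρ'
≥ 0, not identically zero, contradicting `f`-minimality. Replacing the vector by its opposite shows
that the bracket vanishes on all normal vectors (`IsFMinimal.isCriticalAt`). Hence ∑ ∇_{e_i} e_i +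
∇f is orthogonal to every normal vector, which is (1).

Second variation. Write ρ = e^a √det A with a = -f ∘ F and A the Gram matrix of vectors that are
orthonormal at t = 0. Criticality says that the logarithmic derivative of ρ vanishes at 0, so ρ'' =
e^a (a'' + ½ tr A'' - ½ tr A'²). Here tr A'² = 4|A^ν|², while tr A'' yields the curvature term,
|∇ν|² and ∑ ⟨∇_i W, ∂_i F⟩, where W = ∇_t V is the acceleration; a'' contributes -∇²f(V, V) - df(W).
The acceleration is not prescribed by ν, but it drops out. Differentiating ⟨V, ∂_i F⟩ = 0 in time
shows that W + ½ ∇|V|² is normal, and the critical equation applied to this vector trades the terms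
in W for terms in ∇|V|². With the Gauss formula (`metric_chartConn_induced`) these become -½ Δ|V|²
and ½ ⟨∇f, ∇|V|²⟩. The computation is `IsLeviCivitaOn.hasDerivAt_deriv_density`, and
`IsSmoothFamily.hasDerivAt_deriv_weightDensity` translates it back to the manifold. Taking Q = e^f
ρ'' makes independence of the frame automatic. -/

theorem _root_.Matrix.sum_det_updateRow (A B : Matrix ι ι ℝ) :
    ∑ i, (A.updateRow i (B i)).det = (A.adjugate * B).trace := by
  rw [Matrix.trace_mul_comm]
  simp only [Matrix.trace, Matrix.diag, Matrix.mul_apply, ← Matrix.cramer_transpose_apply,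
    Matrix.cramer_eq_adjugate_mulVec, Matrix.mulVec, dotProduct, ← Matrix.adjugate_transpose,
    Matrix.transpose_apply]
  exact Finset.sum_congr rfl fun i _ => Finset.sum_congr rfl fun j _ => mul_comm _ _

/-- Jacobi's formula: the determinant is multilinear in the rows, so its derivative replaces one row
at a time. Using the adjugate avoids any assumption of invertibility. -/
theorem hasDerivAt_det {A : ℝ → Matrix ι ι ℝ} {A' : Matrix ι ι ℝ} {t : ℝ}
    (hA : ∀ i j, HasDerivAt (fun s => A s i j) (A' i j) t) :
    HasDerivAt (fun s => (A s).det) ((A t).adjugate * A').trace t := by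
  have h1 : HasDerivAt (fun s => (fun i => A s i : ι → ι → ℝ)) (fun i => A' i) t :=
    hasDerivAt_pi.2 fun i => hasDerivAt_pi.2 fun j => hA i j
  let D : ContinuousMultilinearMap ℝ (fun _ : ι => ι → ℝ) ℝ :=
    { toMultilinearMap := (Matrix.detRowAlternating (R := ℝ) (n := ι)).toMultilinearMap
      cont := by
        change Continuous fun x : ι → ι → ℝ => Matrix.det x
        exact Continuous.matrix_det continuous_id }
  have h2 := (D.hasFDerivAt (fun i => A t i)).comp_hasDerivAt t h1
  rw [← Matrix.sum_det_updateRow]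
  have e : D.linearDeriv (fun i => A t i) (fun i => A' i)
      = ∑ i, ((A t).updateRow i (A' i)).det := by
    rw [ContinuousMultilinearMap.linearDeriv_apply]
    rfl
  rw [← e]
  exact h2

theorem adjugate_eq_det_smul_inv {A : Matrix ι ι ℝ} (h : A.det ≠ 0) :
    A.adjugate = A.det • A⁻¹ := by
  rw [Matrix.inv_def, smul_smul, Ring.mul_inverse_cancel _ (isUnit_iff_ne_zero.2 h), one_smul]

theorem contDiffAt_det {P : Type*} [NormedAddCommGroup P] [NormedSpace ℝ P] {k : WithTop ℕ∞}
    {A : P → Matrix ι ι ℝ} {p : P} (hA : ∀ i j, ContDiffAt ℝ k (fun s => A s i j) p) :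
    ContDiffAt ℝ k (fun s => (A s).det) p := by
  simp only [Matrix.det_apply]
  refine ContDiffAt.sum fun σ _ => ?_
  exact (contDiffAt_prod fun i _ => hA _ _).const_smul _

theorem contDiffAt_inv_apply {P : Type*} [NormedAddCommGroup P] [NormedSpace ℝ P] {k : WithTop ℕ∞}
    {A : P → Matrix ι ι ℝ} {p : P} (hA : ∀ i j, ContDiffAt ℝ k (fun s => A s i j) p)
    (h0 : (A p).det ≠ 0) (i j : ι) : ContDiffAt ℝ k (fun s => (A s)⁻¹ i j) p := by
  have e : (fun s => (A s)⁻¹ i j) = fun s => ((A s).det)⁻¹ * (A s).adjugate i j := by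
    funext s
    rw [Matrix.inv_def, Matrix.smul_apply, Ring.inverse_eq_inv', smul_eq_mul]
  rw [e]
  refine ((contDiffAt_det hA).inv h0).mul ?_
  simp only [Matrix.adjugate_apply]
  refine contDiffAt_det fun a b => ?_
  by_cases hab : a = j
  · subst hab
    simp only [Matrix.updateRow_self]
    exact contDiffAt_const
  · simp only [Matrix.updateRow_ne hab]
    exact hA a b

/-- Differentiate A⁻¹ A = 1, an identity that persists near `t` because the determinant stays
nonzero. Where A is the identity the two factors drop out. -/
theorem hasDerivAt_inv_apply_of_eq_one {A : ℝ → Matrix ι ι ℝ} {A' : Matrix ι ι ℝ} {t : ℝ}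
    (hA : ∀ i j, ContDiffAt ℝ 1 (fun s => A s i j) t)
    (hA' : ∀ i j, HasDerivAt (fun s => A s i j) (A' i j) t) (h1 : A t = 1) (i j : ι) :
    HasDerivAt (fun s => (A s)⁻¹ i j) (-A' i j) t := by
  have h0 : (A t).det ≠ 0 := by simp [h1]
  have hd : ∀ a b, HasDerivAt (fun s => (A s)⁻¹ a b) (deriv (fun s => (A s)⁻¹ a b) t) t :=
    fun a b => ((contDiffAt_inv_apply hA h0 a b).differentiableAt (by simp)).hasDerivAt
  have hmul := HasDerivAt.fun_sum (u := Finset.univ)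
    fun a (_ : a ∈ Finset.univ) => (hd i a).mul (hA' a j)
  have hne : ∀ᶠ s in 𝓝 t, (A s).det ≠ 0 :=
    (contDiffAt_det hA).continuousAt.eventually_ne h0
  have hconst : HasDerivAt (fun s => ∑ a, (A s)⁻¹ i a * A s a j) 0 t := by
    refine (hasDerivAt_const t ((1 : Matrix ι ι ℝ) i j)).congr_of_eventuallyEq ?_
    filter_upwards [hne] with s hs
    rw [← Matrix.mul_apply, Matrix.nonsing_inv_mul _ (isUnit_iff_ne_zero.2 hs)]
  have := hmul.unique hconst
  simp only [h1, inv_one, Finset.sum_add_distrib, Matrix.one_apply, mul_ite, mul_one, mul_zero,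
    ite_mul, one_mul, zero_mul, Finset.sum_ite_eq, Finset.sum_ite_eq', Finset.mem_univ,
    if_true] at this
  have e : -A' i j = deriv (fun s => (A s)⁻¹ i j) t := by linarith
  rw [e]
  exact hd i j

/-- Jacobi's formula with adj A = det A · A⁻¹ gives half the trace of A⁻¹A' as the logarithmic
derivative of √det A. -/
theorem hasDerivAt_exp_mul_sqrt_det {A : ℝ → Matrix ι ι ℝ} {A' : Matrix ι ι ℝ} {a : ℝ → ℝ}
    {a' t : ℝ} (ha : HasDerivAt a a' t) (hA : ∀ i j, HasDerivAt (fun s => A s i j) (A' i j) t)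
    (hpos : 0 < (A t).det) :
    HasDerivAt (fun s => Real.exp (a s) * √(A s).det)
      (Real.exp (a t) * √(A t).det * (a' + 1 / 2 * ((A t)⁻¹ * A').trace)) t := by
  have h := ha.exp.mul ((hasDerivAt_det hA).sqrt hpos.ne')
  refine h.congr_deriv ?_
  rw [adjugate_eq_det_smul_inv hpos.ne', Matrix.smul_mul, Matrix.trace_smul, smul_eq_mul]
  have hs : √(A t).det * √(A t).det = (A t).det := Real.mul_self_sqrt hpos.le
  have hs0 : √(A t).det ≠ 0 := (Real.sqrt_pos.2 hpos).ne'
  field_simp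
  linear_combination (-((A t)⁻¹ * A').trace) * hs

/-- The first derivative is the density times its logarithmic derivative. The latter vanishes at `t`
by `hcrit`, so the product rule leaves only the derivative of the second factor, and the derivative
-A' of A⁻¹ produces -tr A'². -/
theorem hasDerivAt_deriv_exp_mul_sqrt_det {A A' : ℝ → Matrix ι ι ℝ} {A'' : Matrix ι ι ℝ}
    {a a' : ℝ → ℝ} {a'' t : ℝ} (ha : ∀ᶠ s in 𝓝 t, HasDerivAt a (a' s) s)
    (ha' : HasDerivAt a' a'' t) (hA1 : ∀ i j, ContDiffAt ℝ 1 (fun s => A s i j) t)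
    (hA : ∀ᶠ s in 𝓝 t, ∀ i j, HasDerivAt (fun r => A r i j) (A' s i j) s)
    (hA' : ∀ i j, HasDerivAt (fun s => A' s i j) (A'' i j) t)
    (h1 : A t = 1) (hcrit : a' t + 1 / 2 * (A' t).trace = 0) :
    HasDerivAt (deriv fun s => Real.exp (a s) * √(A s).det)
      (Real.exp (a t) * (a'' + 1 / 2 * (A''.trace - (A' t * A' t).trace))) t := by
  have h0 : 0 < (A t).det := by simp [h1]
  have hpos : ∀ᶠ s in 𝓝 t, 0 < (A s).det :=
    (contDiffAt_det hA1).continuousAt.eventually_const_lt h0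
  have hfirst : ∀ᶠ s in 𝓝 t, HasDerivAt (fun s => Real.exp (a s) * √(A s).det)
      (Real.exp (a s) * √(A s).det * (a' s + 1 / 2 * ((A s)⁻¹ * A' s).trace)) s := by
    filter_upwards [hpos, ha, hA] with s h1 h2 h3
    exact hasDerivAt_exp_mul_sqrt_det h2 h3 h1
  have htr : HasDerivAt (fun s => ((A s)⁻¹ * A' s).trace) (A''.trace - (A' t * A' t).trace) t := by
    have := HasDerivAt.fun_sum (u := Finset.univ) fun i (_ : i ∈ Finset.univ) =>
      HasDerivAt.fun_sum (u := Finset.univ) fun j (_ : j ∈ Finset.univ) =>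
        (hasDerivAt_inv_apply_of_eq_one hA1 hA.self_of_nhds h1 i j).mul (hA' j i)
    refine this.congr_deriv ?_
    simp only [Matrix.trace, Matrix.diag, Matrix.mul_apply, h1, inv_one, Finset.sum_add_distrib,
      Matrix.one_apply, ite_mul, one_mul, zero_mul, Finset.sum_ite_eq, Finset.mem_univ, if_true,
      neg_mul, Finset.sum_neg_distrib]
    ring
  have hcr : a' t + 1 / 2 * ((A t)⁻¹ * A' t).trace = 0 := by simpa [h1] using hcrit
  have hB := (hfirst.self_of_nhds).mul (ha'.add (htr.const_mul (1 / 2 : ℝ)))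
  refine (hB.congr_of_eventuallyEq ?_).congr_deriv ?_
  · filter_upwards [hfirst] with s hs
    exact hs.deriv
  · simp only [Pi.add_apply]
    rw [hcr]
    simp [h1]

end Determinant

/-! ## Covariant derivatives along maps between vector spaces -/

section Covariant

variable {P E : Type*} [NormedAddCommGroup P] [NormedSpace ℝ P] [NormedAddCommGroup E]
  [NormedSpace ℝ E]

/-- `Γ` is a symmetric connection compatible with the metric `G` on the open set `O`. -/
structure IsLeviCivitaOn (O : Set E) (G : E → E →L[ℝ] E →L[ℝ] ℝ)
    (Γ : E → E →L[ℝ] E →L[ℝ] E) : Prop where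
  isOpen : IsOpen O
  contDiffOn_metric : ContDiffOn ℝ ∞ G O
  contDiffOn_conn : ContDiffOn ℝ ∞ Γ O
  metric_symm : ∀ y ∈ O, ∀ v w, G y v w = G y w v
  conn_symm : ∀ y ∈ O, ∀ v w, Γ y v w = Γ y w v
  compat : ∀ y ∈ O, ∀ v x z, fderiv ℝ G y v x z = G y (Γ y v x) z + G y x (Γ y v z)

/-- The covariant derivative in the direction `a` of a vector field `X` along the map `F`. -/
def covD (Γ : E → E →L[ℝ] E →L[ℝ] E) (F X : P → E) (p a : P) : E :=
  fderiv ℝ X p a + Γ (F p) (fderiv ℝ F p a) (X p)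

/-- The curvature of the connection `Γ`. -/
def connCurvature (Γ : E → E →L[ℝ] E →L[ℝ] E) (y v w z : E) : E :=
  fderiv ℝ Γ y v w z - fderiv ℝ Γ y w v z + Γ y v (Γ y w z) - Γ y w (Γ y v z)

set_option synthInstance.maxHeartbeats 200000

variable {O : Set E} {G : E → E →L[ℝ] E →L[ℝ] ℝ} {Γ : E → E →L[ℝ] E →L[ℝ] E} {F X Y : P → E}
  {p : P}

/-- Metric compatibility pulled back along `F`: the chain rule turns the derivative of G into the
Γ-terms completing the two covariant derivatives. -/
theorem IsLeviCivitaOn.fderiv_metric (h : IsLeviCivitaOn O G Γ) (hp : F p ∈ O)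
    (hF : DifferentiableAt ℝ F p) (hX : DifferentiableAt ℝ X p) (hY : DifferentiableAt ℝ Y p)
    (a : P) :
    fderiv ℝ (fun p => G (F p) (X p) (Y p)) p a
      = G (F p) (covD Γ F X p a) (Y p) + G (F p) (X p) (covD Γ F Y p a) := by
  have hG : DifferentiableAt ℝ G (F p) :=
    (h.contDiffOn_metric.contDiffAt (h.isOpen.mem_nhds hp)).differentiableAt (by simp)
  have hGF : HasFDerivAt (fun p => G (F p)) ((fderiv ℝ G (F p)).comp (fderiv ℝ F p)) p :=
    HasFDerivAt.comp (g := G) p hG.hasFDerivAt hF.hasFDerivAt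
  have hGX := hGF.clm_apply hX.hasFDerivAt
  rw [(hGX.clm_apply hY.hasFDerivAt).fderiv]
  simp only [add_apply, ContinuousLinearMap.comp_apply,
    ContinuousLinearMap.flip_apply, h.compat _ hp, covD, map_add]
  ring

/-- Torsion-freeness along `F`: second derivatives are symmetric and so is Γ. -/
theorem IsLeviCivitaOn.covD_fderiv_comm (h : IsLeviCivitaOn O G Γ) (hp : F p ∈ O)
    (hF : ContDiffAt ℝ 2 F p) (a b : P) :
    covD Γ F (fun p => fderiv ℝ F p b) p a = covD Γ F (fun p => fderiv ℝ F p a) p b := by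
  have hd : DifferentiableAt ℝ (fderiv ℝ F) p :=
    (hF.fderiv_right (m := 1) (by norm_num)).differentiableAt (by simp)
  have hs : IsSymmSndFDerivAt ℝ F p := hF.isSymmSndFDerivAt (by simp)
  simp only [covD]
  rw [fderiv_clm_apply hd (by fun_prop), fderiv_clm_apply hd (by fun_prop), h.conn_symm _ hp]
  simp [hs a b]

/-- The directions `a` and `b` are constant, so there is no bracket term. The terms with second
derivatives of `F` and `X` are symmetric in `a` and `b`; antisymmetrising the rest leaves the
curvature. -/
theorem IsLeviCivitaOn.covD_covD_comm (h : IsLeviCivitaOn O G Γ) (hp : F p ∈ O)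
    (hF : ContDiffAt ℝ 2 F p) (hX : ContDiffAt ℝ 2 X p) (a b : P) :
    covD Γ F (fun p => covD Γ F X p b) p a = covD Γ F (fun p => covD Γ F X p a) p b
      + connCurvature Γ (F p) (fderiv ℝ F p a) (fderiv ℝ F p b) (X p) := by
  have hG : DifferentiableAt ℝ Γ (F p) :=
    (h.contDiffOn_conn.contDiffAt (h.isOpen.mem_nhds hp)).differentiableAt (by simp)
  have hF1 : DifferentiableAt ℝ F p := hF.differentiableAt (by simp)
  have hX1 : DifferentiableAt ℝ X p := hX.differentiableAt (by simp)
  have hdF : DifferentiableAt ℝ (fderiv ℝ F) p :=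
    (hF.fderiv_right (m := 1) (by norm_num)).differentiableAt (by simp)
  have hdX : DifferentiableAt ℝ (fderiv ℝ X) p :=
    (hX.fderiv_right (m := 1) (by norm_num)).differentiableAt (by simp)
  have key : ∀ a b : P, fderiv ℝ (fun p => covD Γ F X p b) p a
      = fderiv ℝ (fderiv ℝ X) p a b
        + (fderiv ℝ Γ (F p) (fderiv ℝ F p a) (fderiv ℝ F p b) (X p)
          + Γ (F p) (fderiv ℝ (fderiv ℝ F) p a b) (X p)
          + Γ (F p) (fderiv ℝ F p b) (fderiv ℝ X p a)) := by
    intro a b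
    have hGF : HasFDerivAt (fun p => Γ (F p)) ((fderiv ℝ Γ (F p)).comp (fderiv ℝ F p)) p :=
      HasFDerivAt.comp (g := Γ) p hG.hasFDerivAt hF1.hasFDerivAt
    have hFb := hdF.hasFDerivAt.clm_apply (hasFDerivAt_const b p)
    have hXb := hdX.hasFDerivAt.clm_apply (hasFDerivAt_const b p)
    have hGFb := hGF.clm_apply hFb
    have h1 := hXb.fun_add (hGFb.clm_apply hX1.hasFDerivAt)
    simp only [covD]
    rw [h1.fderiv]
    simp only [add_apply, ContinuousLinearMap.comp_apply,
      ContinuousLinearMap.flip_apply, zero_apply,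
      map_zero, zero_add]
    abel
  have hsF : IsSymmSndFDerivAt ℝ F p := hF.isSymmSndFDerivAt (by simp)
  have hsX : IsSymmSndFDerivAt ℝ X p := hX.isSymmSndFDerivAt (by simp)
  have e1 : ∀ a b, covD Γ F (fun p => covD Γ F X p b) p a
      = fderiv ℝ (fun p => covD Γ F X p b) p a
        + Γ (F p) (fderiv ℝ F p a) (fderiv ℝ X p b + Γ (F p) (fderiv ℝ F p b) (X p)) :=
    fun a b => rfl
  rw [e1, e1, key, key, hsF a b, hsX a b]
  simp only [connCurvature, map_add]
  abel

end Covariant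

end WeightedMinimal

namespace WeightedMinimal

/-! ### First and second variation of the density for maps between vector spaces -/

section LocalVariation

variable {P E : Type*} [NormedAddCommGroup P] [NormedSpace ℝ P] [NormedAddCommGroup E]
  [NormedSpace ℝ E]

set_option synthInstance.maxHeartbeats 200000

variable {O : Set E} {G : E → E →L[ℝ] E →L[ℝ] ℝ} {Γ : E → E →L[ℝ] E →L[ℝ] E} {F X Y : P → E}
  {p : P}

theorem contDiffAt_fderiv_apply {H : Type*} [NormedAddCommGroup H] [NormedSpace ℝ H] {φ : P → H}
    (hF : ContDiffAt ℝ ∞ φ p) (a : P) :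
    ContDiffAt ℝ ∞ (fun p => fderiv ℝ φ p a) p :=
  (hF.fderiv_right (m := ∞) (by simp)).clm_apply contDiffAt_const

theorem IsLeviCivitaOn.contDiffAt_metric (h : IsLeviCivitaOn O G Γ) (hp : F p ∈ O)
    (hF : ContDiffAt ℝ ∞ F p) (hX : ContDiffAt ℝ ∞ X p) (hY : ContDiffAt ℝ ∞ Y p) :
    ContDiffAt ℝ ∞ (fun p => G (F p) (X p) (Y p)) p := by
  have hG : ContDiffAt ℝ ∞ G (F p) := h.contDiffOn_metric.contDiffAt (h.isOpen.mem_nhds hp)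
  have hGF : ContDiffAt ℝ ∞ (fun p => G (F p)) p := ContDiffAt.comp (g := G) p hG hF
  exact (hGF.clm_apply hX).clm_apply hY

theorem IsLeviCivitaOn.contDiffAt_covD (h : IsLeviCivitaOn O G Γ) (hp : F p ∈ O)
    (hF : ContDiffAt ℝ ∞ F p) (hX : ContDiffAt ℝ ∞ X p) (a : P) :
    ContDiffAt ℝ ∞ (fun p => covD Γ F X p a) p := by
  have hG : ContDiffAt ℝ ∞ Γ (F p) := h.contDiffOn_conn.contDiffAt (h.isOpen.mem_nhds hp)
  have hGF : ContDiffAt ℝ ∞ (fun p => Γ (F p)) p := ContDiffAt.comp (g := Γ) p hG hF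
  exact (contDiffAt_fderiv_apply hX a).add
    ((hGF.clm_apply (contDiffAt_fderiv_apply hF a)).clm_apply hX)

/-- The Gram matrix of the vectors `∂_{bᵢ} F`. -/
def gramAlong {ι : Type*} (G : E → E →L[ℝ] E →L[ℝ] ℝ) (F : P → E) (b : ι → P) (p : P) :
    Matrix ι ι ℝ :=
  Matrix.of fun i j => G (F p) (fderiv ℝ F p (b i)) (fderiv ℝ F p (b j))

theorem hasDerivAt_comp_line {H : Type*} [NormedAddCommGroup H] [NormedSpace ℝ H] {φ : P → H}
    {p a : P} {t : ℝ} (hφ : DifferentiableAt ℝ φ (p + t • a)) :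
    HasDerivAt (fun s : ℝ => φ (p + s • a)) (fderiv ℝ φ (p + t • a) a) t := by
  have h1 : HasDerivAt (fun s : ℝ => p + s • a) a t := by
    simpa using ((hasDerivAt_id t).smul_const a).const_add p
  exact hφ.hasFDerivAt.comp_hasDerivAt t h1

theorem continuous_line (p a : P) : Continuous fun s : ℝ => p + s • a := by fun_prop

theorem IsLeviCivitaOn.contDiffAt_gramAlong {ι : Type*} (h : IsLeviCivitaOn O G Γ) (hp : F p ∈ O)
    (hF : ContDiffAt ℝ ∞ F p) (b : ι → P) (i j : ι) :
    ContDiffAt ℝ ∞ (fun p => gramAlong G F b p i j) p :=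
  h.contDiffAt_metric hp hF (contDiffAt_fderiv_apply hF _) (contDiffAt_fderiv_apply hF _)

/-- After metric compatibility, the symmetry ∇_T ∂_a F = ∇_a ∂_T F expresses the derivative of the
Gram matrix through the velocity field. -/
theorem IsLeviCivitaOn.fderiv_metric_fderiv (h : IsLeviCivitaOn O G Γ) (hp : F p ∈ O)
    (hF : ContDiffAt ℝ ∞ F p) (a b T : P) :
    fderiv ℝ (fun p => G (F p) (fderiv ℝ F p a) (fderiv ℝ F p b)) p T
      = G (F p) (covD Γ F (fun p => fderiv ℝ F p T) p a) (fderiv ℝ F p b)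
        + G (F p) (fderiv ℝ F p a) (covD Γ F (fun p => fderiv ℝ F p T) p b) := by
  have hF2 : ContDiffAt ℝ 2 F p := hF.of_le ENat.LEInfty.out
  rw [h.fderiv_metric hp (hF.differentiableAt (by simp))
    ((contDiffAt_fderiv_apply hF a).differentiableAt (by simp))
    ((contDiffAt_fderiv_apply hF b).differentiableAt (by simp)),
    h.covD_fderiv_comm hp hF2 T a, h.covD_fderiv_comm hp hF2 T b]

/-- The product rule for ⟨∂_T F, ∂_b F⟩. Only its derivative in the one direction `a` has to vanish,
so the lemma applies both to fields normal on the initial slice alone (spatial `a`) and to fields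
normal at all times (`a = T`). -/
theorem IsLeviCivitaOn.metric_covD_of_normal (h : IsLeviCivitaOn O G Γ) (hp : F p ∈ O)
    (hF : ContDiffAt ℝ ∞ F p) (a b T : P)
    (hn : fderiv ℝ (fun p => G (F p) (fderiv ℝ F p T) (fderiv ℝ F p b)) p a = 0) :
    G (F p) (covD Γ F (fun p => fderiv ℝ F p T) p a) (fderiv ℝ F p b)
      = -G (F p) (fderiv ℝ F p T) (covD Γ F (fun p => fderiv ℝ F p b) p a) := by
  rw [h.fderiv_metric hp (hF.differentiableAt (by simp))
    ((contDiffAt_fderiv_apply hF T).differentiableAt (by simp))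
    ((contDiffAt_fderiv_apply hF b).differentiableAt (by simp))] at hn
  linarith

/-- The first variation of the weighted volume density, for a variation that is normal at the
initial time. -/
theorem IsLeviCivitaOn.hasDerivAt_density {ι : Type*} [Fintype ι] [DecidableEq ι]
    (h : IsLeviCivitaOn O G Γ) (hp : F p ∈ O) (hF : ContDiffAt ℝ ∞ F p) {f : E → ℝ}
    (hf : DifferentiableAt ℝ f (F p)) (T : P) (b : ι → P)
    (hn : ∀ i j, fderiv ℝ (fun p => G (F p) (fderiv ℝ F p T) (fderiv ℝ F p (b j))) p (b i) = 0)
    (hpos : 0 < (gramAlong G F b p).det) :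
    HasDerivAt (fun t : ℝ => Real.exp (-f (F (p + t • T))) * √(gramAlong G F b (p + t • T)).det)
      (-(Real.exp (-f (F p)) * √(gramAlong G F b p).det * (fderiv ℝ f (F p) (fderiv ℝ F p T)
        + ∑ i, ∑ j, (gramAlong G F b p)⁻¹ i j *
          G (F p) (fderiv ℝ F p T) (covD Γ F (fun p => fderiv ℝ F p (b j)) p (b i))))) 0 := by
  have hF2 : ContDiffAt ℝ 2 F p := hF.of_le ENat.LEInfty.out
  have hp0 : p + (0 : ℝ) • T = p := by simp
  have ha : HasDerivAt (fun t : ℝ => -f (F (p + t • T)))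
      (-(fderiv ℝ f (F p) (fderiv ℝ F p T))) 0 := by
    have hd : HasFDerivAt (fun p => f (F p)) ((fderiv ℝ f (F p)).comp (fderiv ℝ F p)) p :=
      hf.hasFDerivAt.comp p (hF.differentiableAt (by simp)).hasFDerivAt
    have h1 := hasDerivAt_comp_line (φ := fun p => f (F p)) (p := p) (a := T) (t := 0)
      (by rw [hp0]; exact hd.differentiableAt)
    rw [hp0, hd.fderiv] at h1
    exact h1.fun_neg
  -- Normality moves both spatial derivatives off the velocity, so that the Gram matrix varies by -2
  -- times the second fundamental form.
  have hA : ∀ i j, HasDerivAt (fun t : ℝ => gramAlong G F b (p + t • T) i j)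
      ((Matrix.of fun i j => -2 * G (F p) (fderiv ℝ F p T)
        (covD Γ F (fun p => fderiv ℝ F p (b j)) p (b i))) i j) 0 := by
    intro i j
    have h1 := hasDerivAt_comp_line (φ := fun p => gramAlong G F b p i j) (p := p) (a := T)
      (t := 0) (by
        rw [hp0]; exact (h.contDiffAt_gramAlong hp hF b i j).differentiableAt (by simp))
    rw [hp0] at h1
    refine h1.congr_deriv ?_
    simp only [gramAlong, Matrix.of_apply]
    rw [h.fderiv_metric_fderiv hp hF, h.metric_covD_of_normal hp hF _ _ _ (hn i j),
      h.metric_symm _ hp (fderiv ℝ F p (b i)), h.metric_covD_of_normal hp hF _ _ _ (hn j i),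
      h.covD_fderiv_comm hp hF2 (b j) (b i)]
    ring
  have h1 := hasDerivAt_exp_mul_sqrt_det (A := fun t : ℝ => gramAlong G F b (p + t • T))
    ha hA (by simpa using hpos)
  refine h1.congr_deriv ?_
  rw [hp0]
  have hs : ∀ i j, covD Γ F (fun p => fderiv ℝ F p (b j)) p (b i)
    = covD Γ F (fun p => fderiv ℝ F p (b i)) p (b j) := fun i j => h.covD_fderiv_comm hp hF2 _ _
  have e : ((gramAlong G F b p)⁻¹ * (Matrix.of fun i j => -2 * G (F p) (fderiv ℝ F p T)
        (covD Γ F (fun p => fderiv ℝ F p (b j)) p (b i)))).trace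
      = -2 * ∑ i, ∑ j, (gramAlong G F b p)⁻¹ i j *
          G (F p) (fderiv ℝ F p T) (covD Γ F (fun p => fderiv ℝ F p (b j)) p (b i)) := by
    simp only [Matrix.trace, Matrix.diag, Matrix.mul_apply, Matrix.of_apply, Finset.mul_sum]
    refine Finset.sum_congr rfl fun i _ => Finset.sum_congr rfl fun j _ => ?_
    rw [hs i j]
    ring
  rw [e]
  ring

/-- Differentiate the first-order formula once more. Moving ∇_T past ∇_a isolates the acceleration
∇_T ∂_T F and creates the curvature; the mixed products of first derivatives give the last term. -/
theorem IsLeviCivitaOn.fderiv_fderiv_metric_fderiv (h : IsLeviCivitaOn O G Γ) {Ω : Set P}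
    (hΩ : IsOpen Ω) (hF : ContDiffOn ℝ ∞ F Ω) (hFO : Set.MapsTo F Ω O) (hp : p ∈ Ω)
    (a b T : P) :
    fderiv ℝ (fun p => fderiv ℝ (fun p => G (F p) (fderiv ℝ F p a) (fderiv ℝ F p b)) p T) p T
      = G (F p) (covD Γ F (fun p => covD Γ F (fun p => fderiv ℝ F p T) p T) p a
          + connCurvature Γ (F p) (fderiv ℝ F p T) (fderiv ℝ F p a) (fderiv ℝ F p T))
          (fderiv ℝ F p b)
        + G (F p) (fderiv ℝ F p a) (covD Γ F (fun p => covD Γ F (fun p => fderiv ℝ F p T) p T) p b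
          + connCurvature Γ (F p) (fderiv ℝ F p T) (fderiv ℝ F p b) (fderiv ℝ F p T))
        + 2 * G (F p) (covD Γ F (fun p => fderiv ℝ F p T) p a)
          (covD Γ F (fun p => fderiv ℝ F p T) p b) := by
  have hFat : ∀ q ∈ Ω, ContDiffAt ℝ ∞ F q := fun q hq => hF.contDiffAt (hΩ.mem_nhds hq)
  have hFp := hFat p hp
  have hF2 : ContDiffAt ℝ 2 F p := hFp.of_le ENat.LEInfty.out
  have hT := contDiffAt_fderiv_apply hFp T
  have hev : (fun p => fderiv ℝ (fun p => G (F p) (fderiv ℝ F p a) (fderiv ℝ F p b)) p T) =ᶠ[𝓝 p]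
      fun p => G (F p) (covD Γ F (fun p => fderiv ℝ F p T) p a) (fderiv ℝ F p b)
        + G (F p) (fderiv ℝ F p a) (covD Γ F (fun p => fderiv ℝ F p T) p b) := by
    filter_upwards [hΩ.mem_nhds hp] with q hq
    exact h.fderiv_metric_fderiv (hFO hq) (hFat q hq) a b T
  have hD : ∀ c, DifferentiableAt ℝ (fun p => covD Γ F (fun p => fderiv ℝ F p T) p c) p :=
    fun c => (h.contDiffAt_covD (hFO hp) hFp hT c).differentiableAt (by simp)
  have hd : ∀ c, DifferentiableAt ℝ (fun p => fderiv ℝ F p c) p :=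
    fun c => (contDiffAt_fderiv_apply hFp c).differentiableAt (by simp)
  have hm : ∀ {X Y : P → E}, ContDiffAt ℝ ∞ X p → ContDiffAt ℝ ∞ Y p →
      DifferentiableAt ℝ (fun p => G (F p) (X p) (Y p)) p := fun hX hY =>
    (h.contDiffAt_metric (hFO hp) hFp hX hY).differentiableAt (by simp)
  rw [hev.fderiv_eq, fderiv_fun_add
    (hm (h.contDiffAt_covD (hFO hp) hFp hT a) (contDiffAt_fderiv_apply hFp b))
    (hm (contDiffAt_fderiv_apply hFp a) (h.contDiffAt_covD (hFO hp) hFp hT b)),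
    add_apply, h.fderiv_metric (hFO hp) (hFp.differentiableAt (by simp)) (hD a) (hd b),
    h.fderiv_metric (hFO hp) (hFp.differentiableAt (by simp)) (hd a) (hD b),
    h.covD_covD_comm (hFO hp) hF2 (hT.of_le ENat.LEInfty.out) T a,
    h.covD_covD_comm (hFO hp) hF2 (hT.of_le ENat.LEInfty.out) T b,
    h.covD_fderiv_comm (hFO hp) hF2 T a, h.covD_fderiv_comm (hFO hp) hF2 T b]
  ring

/-- For a normal variation, `⟨∇_a ∇_T ∂_T F, ∂_a F⟩` in terms of the second derivative of
`|∂_T F|²`. -/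
theorem IsLeviCivitaOn.metric_covD_acceleration (h : IsLeviCivitaOn O G Γ) {Ω : Set P}
    (hΩ : IsOpen Ω) (hF : ContDiffOn ℝ ∞ F Ω) (hFO : Set.MapsTo F Ω O) (hp : p ∈ Ω) (a T : P)
    (hn : ∀ p ∈ Ω, G (F p) (fderiv ℝ F p T) (fderiv ℝ F p a) = 0) :
    G (F p) (covD Γ F (fun p => fderiv ℝ F p T) p T) (fderiv ℝ F p a)
      = -(1 / 2) * fderiv ℝ (fun p => G (F p) (fderiv ℝ F p T) (fderiv ℝ F p T)) p a ∧
    G (F p) (covD Γ F (fun p => covD Γ F (fun p => fderiv ℝ F p T) p T) p a) (fderiv ℝ F p a)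
      = -(1 / 2) * fderiv ℝ (fun p => fderiv ℝ
          (fun p => G (F p) (fderiv ℝ F p T) (fderiv ℝ F p T)) p a) p a
        - G (F p) (covD Γ F (fun p => fderiv ℝ F p T) p T)
            (covD Γ F (fun p => fderiv ℝ F p a) p a) := by
  have hFat : ∀ q ∈ Ω, ContDiffAt ℝ ∞ F q := fun q hq => hF.contDiffAt (hΩ.mem_nhds hq)
  have hone : ∀ p ∈ Ω, G (F p) (covD Γ F (fun p => fderiv ℝ F p T) p T) (fderiv ℝ F p a)
      = -(1 / 2) * fderiv ℝ (fun p => G (F p) (fderiv ℝ F p T) (fderiv ℝ F p T)) p a := by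
    intro q hq
    have hFq := hFat q hq
    have hF2 : ContDiffAt ℝ 2 F q := hFq.of_le ENat.LEInfty.out
    have hd : ∀ c, DifferentiableAt ℝ (fun p => fderiv ℝ F p c) q :=
      fun c => (contDiffAt_fderiv_apply hFq c).differentiableAt (by simp)
    -- This uses normality at all times: the relation is differentiated in the time direction.
    have h0 : fderiv ℝ (fun p => G (F p) (fderiv ℝ F p T) (fderiv ℝ F p a)) q T = 0 := by
      have : (fun p => G (F p) (fderiv ℝ F p T) (fderiv ℝ F p a)) =ᶠ[𝓝 q] fun _ => 0 := by
        filter_upwards [hΩ.mem_nhds hq] with r hr using hn r hr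
      rw [this.fderiv_eq]
      simp
    rw [h.metric_covD_of_normal (hFO hq) hFq T a T h0,
      h.fderiv_metric (hFO hq) (hFq.differentiableAt (by simp)) (hd T) (hd T),
      h.covD_fderiv_comm (hFO hq) hF2 T a,
      h.metric_symm _ (hFO hq) (covD Γ F (fun p => fderiv ℝ F p T) q a)]
    ring
  refine ⟨hone p hp, ?_⟩
  have hFp := hFat p hp
  have hT := contDiffAt_fderiv_apply hFp T
  have hev : (fun p => G (F p) (covD Γ F (fun p => fderiv ℝ F p T) p T) (fderiv ℝ F p a))
      =ᶠ[𝓝 p] fun p => -(1 / 2) *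
        fderiv ℝ (fun p => G (F p) (fderiv ℝ F p T) (fderiv ℝ F p T)) p a := by
    filter_upwards [hΩ.mem_nhds hp] with q hq using hone q hq
  -- The first identity holds on all of `Ω`, hence may itself be differentiated in the direction
  -- `a`.
  have h1 := DFunLike.congr_fun (hev.fderiv_eq (𝕜 := ℝ)) a
  have hφ := contDiffAt_fderiv_apply (h.contDiffAt_metric (hFO hp) hFp hT hT) a
  rw [h.fderiv_metric (hFO hp) (hFp.differentiableAt (by simp))
    ((h.contDiffAt_covD (hFO hp) hFp hT T).differentiableAt (by simp))
    ((contDiffAt_fderiv_apply hFp a).differentiableAt (by simp)),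
    fderiv_const_mul (hφ.differentiableAt (by simp))] at h1
  simp only [smul_apply, smul_eq_mul] at h1
  linarith

/-- The second variation of the weighted volume density, for a normal variation that starts at a
critical point. -/
theorem IsLeviCivitaOn.hasDerivAt_deriv_density {ι : Type*} [Fintype ι] [DecidableEq ι]
    (h : IsLeviCivitaOn O G Γ) {Ω : Set P} (hΩ : IsOpen Ω) (hF : ContDiffOn ℝ ∞ F Ω)
    (hFO : Set.MapsTo F Ω O) (hp : p ∈ Ω) {f : E → ℝ} (hf : ContDiffOn ℝ ∞ f O) (T c : P)
    (b : ι → P)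
    (hn : ∀ p ∈ Ω, ∀ i, G (F p) (fderiv ℝ F p T) (fderiv ℝ F p (b i)) = 0)
    (horth : gramAlong G F b p = 1)
    (hcrit : ∀ w, (∀ i, G (F p) w (fderiv ℝ F p (b i)) = 0) → fderiv ℝ f (F p) w
      + ∑ i, G (F p) w (covD Γ F (fun p => fderiv ℝ F p (b i)) p (b i)) = 0)
    (hc : ∀ i, G (F p) (fderiv ℝ F p c) (fderiv ℝ F p (b i))
      = fderiv ℝ (fun p => G (F p) (fderiv ℝ F p T) (fderiv ℝ F p T)) p (b i)) :
    HasDerivAt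
      (deriv fun t : ℝ => Real.exp (-f (F (p + t • T))) * √(gramAlong G F b (p + t • T)).det)
      (Real.exp (-f (F p)) *
        (∑ i, G (F p) (connCurvature Γ (F p) (fderiv ℝ F p T) (fderiv ℝ F p (b i))
            (fderiv ℝ F p T)) (fderiv ℝ F p (b i))
        - 1 / 2 * ∑ i, (fderiv ℝ (fun p => fderiv ℝ
            (fun p => G (F p) (fderiv ℝ F p T) (fderiv ℝ F p T)) p (b i)) p (b i)
            - G (F p) (fderiv ℝ F p c) (covD Γ F (fun p => fderiv ℝ F p (b i)) p (b i)))
        + ∑ i, G (F p) (covD Γ F (fun p => fderiv ℝ F p T) p (b i))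
            (covD Γ F (fun p => fderiv ℝ F p T) p (b i))
        - 2 * ∑ i, ∑ j, G (F p) (covD Γ F (fun p => fderiv ℝ F p (b j)) p (b i))
            (fderiv ℝ F p T) ^ 2
        - (fderiv ℝ (fun y => fderiv ℝ f y (fderiv ℝ F p T)) (F p) (fderiv ℝ F p T)
            - fderiv ℝ f (F p) (Γ (F p) (fderiv ℝ F p T) (fderiv ℝ F p T)))
        + 1 / 2 * fderiv ℝ f (F p) (fderiv ℝ F p c))) 0 := by
  have hFat : ∀ q ∈ Ω, ContDiffAt ℝ ∞ F q := fun q hq => hF.contDiffAt (hΩ.mem_nhds hq)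
  have hfat : ∀ y ∈ O, ContDiffAt ℝ ∞ f y := fun y hy => hf.contDiffAt (h.isOpen.mem_nhds hy)
  have hFp := hFat p hp
  have hF2 : ContDiffAt ℝ 2 F p := hFp.of_le ENat.LEInfty.out
  have hO := hFO hp
  have hp0 : p + (0 : ℝ) • T = p := by simp
  have hline : ∀ᶠ s : ℝ in 𝓝 0, p + s • T ∈ Ω := by
    refine (continuous_line p T).continuousAt.eventually_mem (hΩ.mem_nhds ?_)
    simpa using hp
  have hfF : ∀ q ∈ Ω, ContDiffAt ℝ ∞ (fun p => -f (F p)) q := fun q hq =>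
    ((hfat _ (hFO hq)).comp q (hFat q hq)).neg
  have hg : ∀ q ∈ Ω, ∀ i j, ContDiffAt ℝ ∞ (fun p => gramAlong G F b p i j) q := fun q hq i j =>
    h.contDiffAt_gramAlong (hFO hq) (hFat q hq) b i j
  have hn0 : ∀ q ∈ Ω, ∀ i a, fderiv ℝ (fun p => G (F p) (fderiv ℝ F p T) (fderiv ℝ F p (b i))) q a
      = 0 := by
    intro q hq i a
    have : (fun p => G (F p) (fderiv ℝ F p T) (fderiv ℝ F p (b i))) =ᶠ[𝓝 q] fun _ => 0 := by
      filter_upwards [hΩ.mem_nhds hq] with r hr using hn r hr i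
    rw [this.fderiv_eq]
    simp
  have hA1 : ∀ i j, fderiv ℝ (fun p => gramAlong G F b p i j) p T
      = -2 * G (F p) (covD Γ F (fun p => fderiv ℝ F p (b j)) p (b i)) (fderiv ℝ F p T) := by
    intro i j
    simp only [gramAlong, Matrix.of_apply]
    rw [h.fderiv_metric_fderiv hO hFp, h.metric_covD_of_normal hO hFp _ _ _ (hn0 p hp j _),
      h.metric_symm _ hO (fderiv ℝ F p (b i)), h.metric_covD_of_normal hO hFp _ _ _ (hn0 p hp i _),
      h.covD_fderiv_comm hO hF2 (b j) (b i), h.metric_symm _ hO (fderiv ℝ F p T)]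
    ring
  have hV : ∀ i, G (F p) (fderiv ℝ F p T) (fderiv ℝ F p (b i)) = 0 := hn p hp
  have hfV : fderiv ℝ (fun p => -f (F p)) p T = -fderiv ℝ f (F p) (fderiv ℝ F p T) := by
    have hd : HasFDerivAt (fun p => f (F p)) ((fderiv ℝ f (F p)).comp (fderiv ℝ F p)) p :=
      ((hfat _ hO).differentiableAt (by simp)).hasFDerivAt.comp p
        (hFp.differentiableAt (by simp)).hasFDerivAt
    rw [hd.fun_neg.fderiv]
    simp
  have h1 := hasDerivAt_deriv_exp_mul_sqrt_det (t := 0)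
    (A := fun t : ℝ => gramAlong G F b (p + t • T))
    (A' := fun t => Matrix.of fun i j => fderiv ℝ (fun p => gramAlong G F b p i j) (p + t • T) T)
    (A'' := Matrix.of fun i j =>
      fderiv ℝ (fun p => fderiv ℝ (fun p => gramAlong G F b p i j) p T) p T)
    (a := fun t => -f (F (p + t • T)))
    (a' := fun t => fderiv ℝ (fun p => -f (F p)) (p + t • T) T)
    (a'' := fderiv ℝ (fun p => fderiv ℝ (fun p => -f (F p)) p T) p T)
    (by
      filter_upwards [hline] with s hs
      exact hasDerivAt_comp_line (φ := fun p => -f (F p)) ((hfF _ hs).differentiableAt (by simp)))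
    (by
      have := hasDerivAt_comp_line (φ := fun p => fderiv ℝ (fun p => -f (F p)) p T) (p := p)
        (a := T) (t := 0) (by
          rw [hp0]
          exact (contDiffAt_fderiv_apply (hfF p hp) T).differentiableAt (by simp))
      rwa [hp0] at this)
    (by
      intro i j
      have h2 : ContDiffAt ℝ ∞ (fun p => gramAlong G F b p i j) (p + (0 : ℝ) • T) := by
        rw [hp0]; exact hg p hp i j
      exact (h2.comp (0 : ℝ) (f := fun s : ℝ => p + s • T) (by fun_prop)).of_le
        ENat.LEInfty.out)
    (by
      filter_upwards [hline] with s hs i j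
      exact hasDerivAt_comp_line (φ := fun p => gramAlong G F b p i j)
        ((hg _ hs i j).differentiableAt (by simp)))
    (by
      intro i j
      have := hasDerivAt_comp_line
        (φ := fun p => fderiv ℝ (fun p => gramAlong G F b p i j) p T) (p := p)
        (a := T) (t := 0) (by
          rw [hp0]
          exact (contDiffAt_fderiv_apply (hg p hp i j) T).differentiableAt (by simp))
      rwa [hp0] at this)
    (by rw [hp0, horth])
    -- The velocity is normal, so the critical equation says exactly that the logarithmic derivative
    -- of the density vanishes at time 0.
    (by
      rw [hp0, hfV]
      simp only [Matrix.trace, Matrix.diag, Matrix.of_apply, hA1]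
      rw [← Finset.mul_sum]
      have := hcrit _ hV
      simp only [h.metric_symm _ hO (fderiv ℝ F p T)] at this
      linarith)
  refine h1.congr_deriv ?_
  rw [hp0]
  congr 1
  set V := fderiv ℝ F p T with hVdef
  set W := covD Γ F (fun p => fderiv ℝ F p T) p T with hWdef
  -- the second derivative of the weight
  have hf2 : fderiv ℝ (fun p => fderiv ℝ (fun p => -f (F p)) p T) p T
      = -(fderiv ℝ (fun y => fderiv ℝ f y V) (F p) V - fderiv ℝ f (F p) (Γ (F p) V V))
        - fderiv ℝ f (F p) W := by
    have hev : (fun p => fderiv ℝ (fun p => -f (F p)) p T) =ᶠ[𝓝 p]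
        fun p => -(fderiv ℝ f (F p) (fderiv ℝ F p T)) := by
      filter_upwards [hΩ.mem_nhds hp] with q hq
      have hd : HasFDerivAt (fun p => f (F p)) ((fderiv ℝ f (F q)).comp (fderiv ℝ F q)) q :=
        ((hfat _ (hFO hq)).differentiableAt (by simp)).hasFDerivAt.comp q
          ((hFat q hq).differentiableAt (by simp)).hasFDerivAt
      rw [hd.fun_neg.fderiv]
      simp
    rw [hev.fderiv_eq]
    have hdf : DifferentiableAt ℝ (fderiv ℝ f) (F p) :=
      ((hfat _ hO).fderiv_right (m := ∞) (by simp)).differentiableAt (by simp)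
    have hdfF : HasFDerivAt (fun p => fderiv ℝ f (F p))
        ((fderiv ℝ (fderiv ℝ f) (F p)).comp (fderiv ℝ F p)) p :=
      HasFDerivAt.comp (g := fderiv ℝ f) p hdf.hasFDerivAt
        (hFp.differentiableAt (by simp)).hasFDerivAt
    have hT : DifferentiableAt ℝ (fun p => fderiv ℝ F p T) p :=
      (contDiffAt_fderiv_apply hFp T).differentiableAt (by simp)
    rw [(hdfF.clm_apply hT.hasFDerivAt).fun_neg.fderiv, fderiv_clm_apply hdf (by fun_prop)]
    simp only [hWdef, covD, neg_apply, add_apply, ContinuousLinearMap.comp_apply,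
      ContinuousLinearMap.flip_apply, map_add, fderiv_fun_const, Pi.zero_apply,
      ContinuousLinearMap.comp_zero, zero_add, ← hVdef]
    ring
  have hacc := fun i => h.metric_covD_acceleration hΩ hF hFO hp (b i) T (fun q hq => hn q hq i)
  -- the normal part of the acceleration
  have hN := hcrit (W + (1 / 2 : ℝ) • fderiv ℝ F p c) (by
    intro i
    rw [map_add, map_smul, add_apply, smul_apply, hc i, (hacc i).1, smul_eq_mul]
    ring)
  simp only [map_add, map_smul, add_apply, smul_apply, smul_eq_mul, Finset.sum_add_distrib,
    ← Finset.mul_sum] at hN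
  have htr : (Matrix.of fun i j =>
      fderiv ℝ (fun p => fderiv ℝ (fun p => gramAlong G F b p i j) p T) p T).trace
      = 2 * ∑ i, G (F p) (covD Γ F (fun p => covD Γ F (fun p => fderiv ℝ F p T) p T) p (b i))
          (fderiv ℝ F p (b i))
        + 2 * ∑ i, G (F p) (connCurvature Γ (F p) V (fderiv ℝ F p (b i)) V) (fderiv ℝ F p (b i))
        + 2 * ∑ i, G (F p) (covD Γ F (fun p => fderiv ℝ F p T) p (b i))
            (covD Γ F (fun p => fderiv ℝ F p T) p (b i)) := by
    simp only [Matrix.trace, Matrix.diag, Matrix.of_apply, gramAlong, Finset.mul_sum,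
      ← Finset.sum_add_distrib]
    refine Finset.sum_congr rfl fun i _ => ?_
    rw [h.fderiv_fderiv_metric_fderiv hΩ hF hFO hp, h.metric_symm _ hO (fderiv ℝ F p (b i))]
    simp only [map_add, add_apply]
    ring
  -- Each entry of A' is -2 times a coefficient of the second fundamental form, whence the 4; the
  -- symmetry ∇_i ∂_j F = ∇_j ∂_i F turns the trace of the square into a sum of squares.
  have htr2 : ((Matrix.of fun i j => fderiv ℝ (fun p => gramAlong G F b p i j) p T)
      * (Matrix.of fun i j => fderiv ℝ (fun p => gramAlong G F b p i j) p T)).trace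
      = 4 * ∑ i, ∑ j, G (F p) (covD Γ F (fun p => fderiv ℝ F p (b j)) p (b i)) V ^ 2 := by
    simp only [Matrix.trace, Matrix.diag, Matrix.mul_apply, Matrix.of_apply, hA1, Finset.mul_sum]
    refine Finset.sum_congr rfl fun i _ => Finset.sum_congr rfl fun j _ => ?_
    rw [h.covD_fderiv_comm hO hF2 (b j) (b i)]
    ring
  rw [hf2, htr, htr2]
  have hsum : ∑ i, G (F p) (covD Γ F (fun p => covD Γ F (fun p => fderiv ℝ F p T) p T) p (b i))
      (fderiv ℝ F p (b i))
      = -(1 / 2) * ∑ i, fderiv ℝ (fun p => fderiv ℝ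
          (fun p => G (F p) (fderiv ℝ F p T) (fderiv ℝ F p T)) p (b i)) p (b i)
        - ∑ i, G (F p) W (covD Γ F (fun p => fderiv ℝ F p (b i)) p (b i)) := by
    rw [Finset.mul_sum, ← Finset.sum_sub_distrib]
    exact Finset.sum_congr rfl fun i _ => (hacc i).2
  rw [hsum]
  simp only [Finset.sum_sub_distrib]
  -- What is left of the acceleration is -df(W) - ∑ ⟨W, ∇_i ∂_i F⟩. By `hN` it equals half of df + ∑
  -- ⟨·, ∇_i ∂_i F⟩ evaluated at the vector `fderiv ℝ F p c`.
  linarith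

end LocalVariation

end WeightedMinimal

namespace WeightedMinimal

/-! ### Derivatives of the preferred charts -/

section Charts

variable {k : ℕ} {N : Type*} [TopologicalSpace N]
  [ChartedSpace (EuclideanSpace ℝ (Fin k)) N] [IsManifold (𝓡 k) ∞ N]

theorem isManifold_one : IsManifold (𝓡 k) 1 N := IsManifold.of_le (n := ∞) ENat.LEInfty.out

theorem extChartAt_symm_contMDiffAt {q : N} {u : EuclideanSpace ℝ (Fin k)}
    (hu : u ∈ (extChartAt (𝓡 k) q).target) :
    ContMDiffAt (𝓡 k) (𝓡 k) ∞ (extChartAt (𝓡 k) q).symm u :=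
  (contMDiffOn_extChartAt_symm q).contMDiffAt ((isOpen_extChartAt_target q).mem_nhds hu)

theorem extChartAt_contMDiffAt {q y : N} (hy : y ∈ (extChartAt (𝓡 k) q).source) :
    ContMDiffAt (𝓡 k) (𝓡 k) ∞ (extChartAt (𝓡 k) q) y :=
  contMDiffAt_extChartAt' (by rwa [← extChartAt_source (𝓡 k)])

/-- The derivative of the inverse of the preferred chart at `q`, as a map of the model space. -/
def chartSymmDeriv (q : N) (u : EuclideanSpace ℝ (Fin k)) :
    EuclideanSpace ℝ (Fin k) →L[ℝ] EuclideanSpace ℝ (Fin k) :=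
  mfderiv (𝓡 k) (𝓡 k) (extChartAt (𝓡 k) q).symm u

/-- The derivative of the preferred chart at `q`, as a map of the model space. -/
def chartDeriv (q y : N) : EuclideanSpace ℝ (Fin k) →L[ℝ] EuclideanSpace ℝ (Fin k) :=
  mfderiv (𝓡 k) (𝓡 k) (extChartAt (𝓡 k) q) y

theorem chartDeriv_comp_chartSymmDeriv {q : N} {u : EuclideanSpace ℝ (Fin k)}
    (hu : u ∈ (extChartAt (𝓡 k) q).target) :
    (chartDeriv q ((extChartAt (𝓡 k) q).symm u)).comp (chartSymmDeriv q u)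
      = ContinuousLinearMap.id ℝ _ := by
  have : IsManifold (𝓡 k) 1 N := isManifold_one
  have h := mfderiv_extChartAt_comp_mfderivWithin_extChartAt_symm (I := 𝓡 k) hu
  simp only [ModelWithCorners.range_eq_univ, mfderivWithin_univ] at h
  exact h

theorem chartSymmDeriv_comp_chartDeriv {q y : N} (hy : y ∈ (extChartAt (𝓡 k) q).source) :
    (chartSymmDeriv q (extChartAt (𝓡 k) q y)).comp (chartDeriv q y)
      = ContinuousLinearMap.id ℝ _ := by
  have : IsManifold (𝓡 k) 1 N := isManifold_one
  have h := mfderivWithin_extChartAt_symm_comp_mfderiv_extChartAt' (I := 𝓡 k) hy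
  simp only [ModelWithCorners.range_eq_univ, mfderivWithin_univ] at h
  exact h

theorem chartDeriv_chartSymmDeriv {q : N} {u : EuclideanSpace ℝ (Fin k)}
    (hu : u ∈ (extChartAt (𝓡 k) q).target) (v : EuclideanSpace ℝ (Fin k)) :
    chartDeriv q ((extChartAt (𝓡 k) q).symm u) (chartSymmDeriv q u v) = v :=
  DFunLike.congr_fun (chartDeriv_comp_chartSymmDeriv hu) v

theorem chartSymmDeriv_chartDeriv {q y : N} (hy : y ∈ (extChartAt (𝓡 k) q).source)
    (v : EuclideanSpace ℝ (Fin k)) :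
    chartSymmDeriv q (extChartAt (𝓡 k) q y) (chartDeriv q y v) = v :=
  DFunLike.congr_fun (chartSymmDeriv_comp_chartDeriv hy) v

/-- Tangent vectors at `q` are by convention read in the preferred chart at `q`. This is what lets
curvature, Hessian and covariant derivatives, all evaluated at the centre of a chart, be compared
with chart computations without a change of basis. -/
theorem chartSymmDeriv_self (q : N) :
    chartSymmDeriv q (extChartAt (𝓡 k) q q) = ContinuousLinearMap.id ℝ _ := by
  have : IsManifold (𝓡 k) 1 N := isManifold_one
  have hd : MDifferentiableAt (𝓡 k) (𝓡 k) (extChartAt (𝓡 k) q).symm (extChartAt (𝓡 k) q q) :=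
    (extChartAt_symm_contMDiffAt (mem_extChartAt_target q)).mdifferentiableAt (by simp)
  rw [chartSymmDeriv, hd.mfderiv]
  have : (writtenInExtChartAt (𝓡 k) (𝓡 k) (extChartAt (𝓡 k) q q) (extChartAt (𝓡 k) q).symm)
      =ᶠ[𝓝 (extChartAt (𝓡 k) q q)] id := by
    filter_upwards [extChartAt_target_mem_nhds (I := 𝓡 k) q] with u hu
    simp only [writtenInExtChartAt, Function.comp_apply, extChartAt_model_space_eq_id,
      PartialEquiv.refl_symm, PartialEquiv.refl_coe, id_eq, extChartAt_to_inv]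
    exact (extChartAt (𝓡 k) q).right_inv hu
  simp only [ModelWithCorners.range_eq_univ, fderivWithin_univ]
  have h2 := this.fderiv_eq (𝕜 := ℝ)
  rw [fderiv_id] at h2
  exact h2

theorem chartDeriv_self (q : N) : chartDeriv (k := k) q q = ContinuousLinearMap.id ℝ _ := by
  have h := chartSymmDeriv_comp_chartDeriv (mem_extChartAt_source (I := 𝓡 k) q)
  rwa [chartSymmDeriv_self, ContinuousLinearMap.id_comp] at h

/-- The coordinate fields are smooth as sections: the tangent map of the inverse chart is applied to
a constant section. This is needed to feed them into the bundle metric. -/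
theorem contMDiffOn_chartSymmDeriv (q : N) (v : EuclideanSpace ℝ (Fin k)) :
    ContMDiffOn (𝓡 k) (𝓡 k).tangent ∞ (fun u => Bundle.TotalSpace.mk' (EuclideanSpace ℝ (Fin k))
      (E := fun x : N => TangentSpace (𝓡 k) x) ((extChartAt (𝓡 k) q).symm u)
      (chartSymmDeriv q u v)) (extChartAt (𝓡 k) q).target := by
  have h1 : ContMDiffOn (𝓡 k).tangent (𝓡 k).tangent ∞
      (tangentMapWithin (𝓡 k) (𝓡 k) (extChartAt (𝓡 k) q).symm (extChartAt (𝓡 k) q).target)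
      (Bundle.TotalSpace.proj ⁻¹' (extChartAt (𝓡 k) q).target) :=
    (contMDiffOn_extChartAt_symm q).contMDiffOn_tangentMapWithin (n := ∞) (by simp)
      (isOpen_extChartAt_target q).uniqueMDiffOn
  have h2 : ContMDiff (𝓡 k) (𝓡 k).tangent ∞ (fun u : EuclideanSpace ℝ (Fin k) =>
      (⟨u, toTangent u v⟩ : TangentBundle (𝓡 k) (EuclideanSpace ℝ (Fin k)))) := by
    intro u
    refine Bundle.contMDiffAt_totalSpace.2 ⟨contMDiffAt_id, ?_⟩
    refine (contMDiffAt_const (c := v)).congr_of_eventuallyEq (Filter.Eventually.of_forall ?_)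
    intro u'
    exact congrArg Prod.snd (trivializationAt_model_space_apply (I := 𝓡 k)
      (⟨u', toTangent u' v⟩ : TangentBundle (𝓡 k) (EuclideanSpace ℝ (Fin k))) u)
  refine (h1.comp h2.contMDiffOn fun u hu => hu).congr fun u hu => ?_
  simp only [Function.comp_apply, tangentMapWithin]
  rw [mfderivWithin_of_isOpen (isOpen_extChartAt_target q) hu]
  rfl

end Charts

/-! ### The Riemannian metric in a chart -/

section AmbientMetric

variable {m : ℕ} {M : Type*} [TopologicalSpace M]
  [ChartedSpace (EuclideanSpace ℝ (Fin m)) M] [IsManifold (𝓡 m) ∞ M]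
  (g : Bundle.ContMDiffRiemannianMetric (𝓡 m) ∞ (EuclideanSpace ℝ (Fin m))
      (fun x : M => TangentSpace (𝓡 m) x))

/-- The metric at `y` as a bilinear form on the model space. -/
def innerModel (y : M) :
    EuclideanSpace ℝ (Fin m) →L[ℝ] EuclideanSpace ℝ (Fin m) →L[ℝ] ℝ := g.inner y

/-- The metric in the preferred chart at `q`. -/
def chartMetric (q : M) (u : EuclideanSpace ℝ (Fin m)) :
    EuclideanSpace ℝ (Fin m) →L[ℝ] EuclideanSpace ℝ (Fin m) →L[ℝ] ℝ :=
  (innerModel g ((extChartAt (𝓡 m) q).symm u)).bilinearComp (chartSymmDeriv q u)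
    (chartSymmDeriv q u)

theorem chartMetric_apply (q : M) (u v w : EuclideanSpace ℝ (Fin m)) :
    chartMetric g q u v w = innerModel g ((extChartAt (𝓡 m) q).symm u) (chartSymmDeriv q u v)
      (chartSymmDeriv q u w) := rfl

theorem chartGram_metricFn (q : M) (u : EuclideanSpace ℝ (Fin m)) (i j : Fin m) :
    chartGram (metricFn g) q u i j = chartMetric g q u (stdVec i) (stdVec j) := rfl

theorem chartMetric_symm (q : M) (u v w : EuclideanSpace ℝ (Fin m)) :
    chartMetric g q u v w = chartMetric g q u w v := g.symm _ _ _

theorem chartMetric_pos {q : M} {u v : EuclideanSpace ℝ (Fin m)}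
    (hu : u ∈ (extChartAt (𝓡 m) q).target) (hv : v ≠ 0) : 0 < chartMetric g q u v v := by
  refine g.pos _ _ fun h0 => hv ?_
  have h := chartDeriv_chartSymmDeriv hu v
  have h1 : chartSymmDeriv q u v = 0 := h0
  rw [h1, map_zero] at h
  exact h.symm

theorem chartMetric_chartDeriv {q y : M} (hy : y ∈ (extChartAt (𝓡 m) q).source)
    (v w : EuclideanSpace ℝ (Fin m)) :
    chartMetric g q (extChartAt (𝓡 m) q y) (chartDeriv q y v) (chartDeriv q y w)
      = innerModel g y v w := by
  rw [chartMetric_apply, (extChartAt (𝓡 m) q).left_inv hy, chartSymmDeriv_chartDeriv hy,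
    chartSymmDeriv_chartDeriv hy]

/-- It suffices to test on pairs of constant vectors, where the value is the smooth bundle metric
evaluated on two smooth coordinate fields. -/
theorem contDiffOn_chartMetric (q : M) :
    ContDiffOn ℝ ∞ (chartMetric g q) (extChartAt (𝓡 m) q).target := by
  refine contDiffOn_clm_apply.2 fun v => contDiffOn_clm_apply.2 fun w => ?_
  rw [← contMDiffOn_iff_contDiffOn]
  have h1 := (g.contMDiff.contMDiffOn (s := Set.univ)).comp (contMDiffOn_extChartAt_symm q)
    (fun u _ => Set.mem_univ _)
  have h2 := ContMDiffOn.clm_bundle_apply₂ (F₁ := EuclideanSpace ℝ (Fin m))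
    (F₂ := EuclideanSpace ℝ (Fin m)) (F₃ := ℝ) (E₃ := fun _ : M => ℝ)
    h1 (contMDiffOn_chartSymmDeriv q v) (contMDiffOn_chartSymmDeriv q w)
  intro u hu
  have h3 := h2 u hu
  rw [Bundle.contMDiffWithinAt_totalSpace] at h3
  exact h3.2

end AmbientMetric

end WeightedMinimal

namespace WeightedMinimal

/-! ### Linear algebra in the standard basis -/

section StdVec

variable {k : ℕ}

theorem stdVec_apply (i j : Fin k) :
    (stdVec i : EuclideanSpace ℝ (Fin k)) j = if j = i then 1 else 0 := by
  simp [stdVec]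

theorem sum_smul_stdVec (v : EuclideanSpace ℝ (Fin k)) : ∑ i, v i • stdVec i = v := by
  ext j
  simp [stdVec_apply]

theorem clm_ext_stdVec {W : Type*} [NormedAddCommGroup W] [NormedSpace ℝ W]
    {A B : EuclideanSpace ℝ (Fin k) →L[ℝ] W} (h : ∀ i, A (stdVec i) = B (stdVec i)) : A = B := by
  ext v
  rw [← sum_smul_stdVec v]
  simp [h]

theorem clm_apply_eq_sum (A : EuclideanSpace ℝ (Fin k) →L[ℝ] ℝ) (v : EuclideanSpace ℝ (Fin k)) :
    A v = ∑ i, v i * A (stdVec i) := by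
  conv_lhs => rw [← sum_smul_stdVec v]
  simp

theorem clm_apply_apply_eq_sum
    (B : EuclideanSpace ℝ (Fin k) →L[ℝ] EuclideanSpace ℝ (Fin k) →L[ℝ] ℝ)
    (v w : EuclideanSpace ℝ (Fin k)) :
    B v w = ∑ i, ∑ j, v i * w j * B (stdVec i) (stdVec j) := by
  have h : ∀ j, B v (stdVec j) = ∑ i, v i * B (stdVec i) (stdVec j) := fun j =>
    clm_apply_eq_sum (B.flip (stdVec j)) v
  rw [clm_apply_eq_sum (B v), Finset.sum_comm]
  refine Finset.sum_congr rfl fun j _ => ?_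
  rw [h j, Finset.mul_sum]
  exact Finset.sum_congr rfl fun i _ => by ring

/-- The quadratic form of the Gram matrix is `B` evaluated on the diagonal, so the matrix is
positive definite. -/
theorem gram_det_pos {B : EuclideanSpace ℝ (Fin k) →L[ℝ] EuclideanSpace ℝ (Fin k) →L[ℝ] ℝ}
    (hs : ∀ v w, B v w = B w v) (hp : ∀ v, v ≠ 0 → 0 < B v v) {A : Matrix (Fin k) (Fin k) ℝ}
    (hA : ∀ i j, A i j = B (stdVec i) (stdVec j)) : 0 < A.det := by
  have : A.PosDef := by
    refine Matrix.PosDef.of_dotProduct_mulVec_pos ?_ fun x hx => ?_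
    · ext i j
      simp [Matrix.conjTranspose_apply, hA, hs (stdVec j)]
    · have h1 := hp (WithLp.toLp 2 x) (by simpa using hx)
      rw [clm_apply_apply_eq_sum] at h1
      refine h1.trans_eq ?_
      simp only [dotProduct, Matrix.mulVec, hA, Finset.mul_sum, star_trivial]
      exact Finset.sum_congr rfl fun i _ => Finset.sum_congr rfl fun j _ => by ring
  exact this.det_pos

/-- The trace of a bilinear form may be computed in a basis or in an orthonormal family. -/
theorem sum_inv_gram_eq_sum_orthonormal
    {B C : EuclideanSpace ℝ (Fin k) →L[ℝ] EuclideanSpace ℝ (Fin k) →L[ℝ] ℝ}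
    {A : Matrix (Fin k) (Fin k) ℝ} (hA : ∀ i j, A i j = B (stdVec i) (stdVec j))
    {e : Fin k → EuclideanSpace ℝ (Fin k)} (he : ∀ i j, B (e i) (e j) = if i = j then 1 else 0) :
    ∑ i, ∑ j, A⁻¹ i j * C (stdVec i) (stdVec j) = ∑ i, C (e i) (e i) := by
  set Q : Matrix (Fin k) (Fin k) ℝ := Matrix.of fun i a => e i a with hQ
  have h1 : Q * (A * Q.transpose) = 1 := by
    ext i j
    rw [Matrix.one_apply, ← he, clm_apply_apply_eq_sum]
    simp only [Matrix.mul_apply, hQ, Matrix.of_apply, Matrix.transpose_apply, hA, Finset.mul_sum]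
    exact Finset.sum_congr rfl fun a _ => Finset.sum_congr rfl fun b _ => by ring
  -- Orthonormality is Q A Qᵀ = 1. For square matrices a one-sided inverse is two-sided, so A⁻¹ = Qᵀ
  -- Q.
  have h2 : A * (Q.transpose * Q) = 1 := by
    rw [← Matrix.mul_assoc]
    exact mul_eq_one_comm.1 h1
  rw [Matrix.inv_eq_right_inv h2]
  simp only [Matrix.mul_apply, Matrix.transpose_apply, hQ, Matrix.of_apply, Finset.sum_mul]
  rw [show ∑ i, C (e i) (e i) = ∑ i, ∑ a, ∑ b, e i a * e i b * C (stdVec a) (stdVec b) from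
    Finset.sum_congr rfl fun i _ => clm_apply_apply_eq_sum C _ _]
  rw [Finset.sum_comm' (t' := Finset.univ) (s' := fun _ => Finset.univ) (by simp)]
  conv_rhs => rw [Finset.sum_comm]
  rw [Finset.sum_comm]
  refine Finset.sum_congr rfl fun a _ => ?_
  rw [Finset.sum_comm]

end StdVec

/-! ### Christoffel symbols, gradient and Laplacian -/

section Christoffel

variable {k : ℕ} {N : Type*} [TopologicalSpace N]
  [ChartedSpace (EuclideanSpace ℝ (Fin k)) N]
  {h : (x : N) → TangentSpace (𝓡 k) x → TangentSpace (𝓡 k) x → ℝ} {q : N}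
  {u : EuclideanSpace ℝ (Fin k)}

theorem christoffelSymbol_symm
    (hs : ∀ u i j, chartGram h q u i j = chartGram h q u j i) (l i j : Fin k) :
    christoffelSymbol h q u l i j = christoffelSymbol h q u l j i := by
  simp only [christoffelSymbol, chartGramDeriv]
  simp only [hs _ i j]
  congr 1
  exact Finset.sum_congr rfl fun a _ => by ring

/-- The metric cancels the inverse metric in the definition of the symbols, which leaves the Koszul
expression. -/
theorem sum_christoffelSymbol_mul_chartGram
    (hs : ∀ u i j, chartGram h q u i j = chartGram h q u j i)
    (hd : (chartGram h q u).det ≠ 0) (i j l : Fin k) :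
    ∑ a, christoffelSymbol h q u a i j * chartGram h q u a l
      = 1 / 2 * (chartGramDeriv h q u i j l + chartGramDeriv h q u j i l
        - chartGramDeriv h q u l i j) := by
  have hinv := Matrix.mul_nonsing_inv _ (isUnit_iff_ne_zero.2 hd)
  simp only [christoffelSymbol, Finset.mul_sum, Finset.sum_mul]
  rw [Finset.sum_comm]
  have : ∀ b, ∑ a, 1 / 2 * ((chartGram h q u)⁻¹ a b * (chartGramDeriv h q u i j b
      + chartGramDeriv h q u j i b - chartGramDeriv h q u b i j)) * chartGram h q u a l
      = 1 / 2 * (chartGramDeriv h q u i j b + chartGramDeriv h q u j i b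
        - chartGramDeriv h q u b i j) * (1 : Matrix (Fin k) (Fin k) ℝ) l b := by
    intro b
    rw [← hinv, Matrix.mul_apply, Finset.mul_sum]
    refine Finset.sum_congr rfl fun a _ => ?_
    rw [hs u a l]
    ring
  simp only [this, Matrix.one_apply, mul_ite, mul_one, mul_zero, Finset.sum_ite_eq,
    Finset.mem_univ, if_true]

/-- The Christoffel bilinear map as a continuous bilinear map. -/
def chartConn (h : (x : N) → TangentSpace (𝓡 k) x → TangentSpace (𝓡 k) x → ℝ) (q : N)
    (u : EuclideanSpace ℝ (Fin k)) :
    EuclideanSpace ℝ (Fin k) →L[ℝ] EuclideanSpace ℝ (Fin k) →L[ℝ] EuclideanSpace ℝ (Fin k) :=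
  ∑ l, ∑ i, ∑ j, christoffelSymbol h q u l i j •
    (EuclideanSpace.proj i : EuclideanSpace ℝ (Fin k) →L[ℝ] ℝ).smulRight
      ((EuclideanSpace.proj j : EuclideanSpace ℝ (Fin k) →L[ℝ] ℝ).smulRight (stdVec l))

theorem chartConn_apply (v w : EuclideanSpace ℝ (Fin k)) :
    chartConn h q u v w = christoffel h q u v w := by
  rw [← sum_smul_stdVec (christoffel h q u v w)]
  simp only [chartConn, sum_apply, smul_apply, ContinuousLinearMap.smulRight_apply,
    christoffel, Finset.sum_smul, smul_smul, mul_assoc]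
  rfl

theorem chartConn_stdVec (i j : Fin k) :
    chartConn h q u (stdVec i) (stdVec j) = ∑ l, christoffelSymbol h q u l i j • stdVec l := by
  rw [chartConn_apply, ← sum_smul_stdVec (christoffel h q u _ _)]
  refine Finset.sum_congr rfl fun l _ => ?_
  simp [christoffel, stdVec_apply]

theorem chartConn_symm (hs : ∀ u i j, chartGram h q u i j = chartGram h q u j i)
    (v w : EuclideanSpace ℝ (Fin k)) : chartConn h q u v w = chartConn h q u w v := by
  have : chartConn h q u = (chartConn h q u).flip := by
    refine clm_ext_stdVec fun i => clm_ext_stdVec fun j => ?_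
    rw [ContinuousLinearMap.flip_apply, chartConn_stdVec, chartConn_stdVec]
    simp only [christoffelSymbol_symm hs _ i j]
  conv_lhs => rw [this]
  rfl

theorem contDiffAt_christoffelSymbol (hc : ∀ i j, ContDiffAt ℝ ∞ (fun u => chartGram h q u i j) u)
    (hd : (chartGram h q u).det ≠ 0) (l i j : Fin k) :
    ContDiffAt ℝ ∞ (fun u => christoffelSymbol h q u l i j) u := by
  simp only [christoffelSymbol, chartGramDeriv]
  refine contDiffAt_const.mul (ContDiffAt.sum fun a _ => ?_)
  exact (contDiffAt_inv_apply hc hd l a).mul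
    (((contDiffAt_fderiv_apply (hc j a) _).add (contDiffAt_fderiv_apply (hc i a) _)).sub
      (contDiffAt_fderiv_apply (hc i j) _))

theorem contDiffAt_smul_const {P W : Type*} [NormedAddCommGroup P] [NormedSpace ℝ P]
    [NormedAddCommGroup W] [NormedSpace ℝ W] {φ : P → ℝ} {p : P} (hφ : ContDiffAt ℝ ∞ φ p) (c : W) :
    ContDiffAt ℝ ∞ (fun p => φ p • c) p :=
  hφ.smul contDiffAt_const

theorem contDiffAt_chartConn (hc : ∀ i j, ContDiffAt ℝ ∞ (fun u => chartGram h q u i j) u)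
    (hd : (chartGram h q u).det ≠ 0) : ContDiffAt ℝ ∞ (chartConn h q) u := by
  have : chartConn h q = fun u => chartConn h q u := rfl
  rw [this]
  simp only [chartConn]
  exact ContDiffAt.sum fun l _ => ContDiffAt.sum fun i _ => ContDiffAt.sum fun j _ =>
    contDiffAt_smul_const (contDiffAt_christoffelSymbol hc hd l i j) _

/-- Lowering an index of the Christoffel map. -/
theorem metric_chartConn_stdVec
    {B : EuclideanSpace ℝ (Fin k) →L[ℝ] EuclideanSpace ℝ (Fin k) →L[ℝ] ℝ}
    (hB : ∀ i j, chartGram h q u i j = B (stdVec i) (stdVec j))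
    (hs : ∀ u i j, chartGram h q u i j = chartGram h q u j i)
    (hd : (chartGram h q u).det ≠ 0) (i j l : Fin k) :
    B (chartConn h q u (stdVec i) (stdVec j)) (stdVec l)
      = 1 / 2 * (chartGramDeriv h q u i j l + chartGramDeriv h q u j i l
        - chartGramDeriv h q u l i j) := by
  rw [← sum_christoffelSymbol_mul_chartGram hs hd, chartConn_stdVec]
  simp [hB, sum_apply]

/-- The gradient represents the differential. -/
theorem metric_gradient
    {B : EuclideanSpace ℝ (Fin k) →L[ℝ] EuclideanSpace ℝ (Fin k) →L[ℝ] ℝ}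
    (hB : ∀ i j, chartGram h q (extChartAt (𝓡 k) q q) i j = B (stdVec i) (stdVec j))
    (hs : ∀ i j, chartGram h q (extChartAt (𝓡 k) q q) i j
      = chartGram h q (extChartAt (𝓡 k) q q) j i)
    (hd : (chartGram h q (extChartAt (𝓡 k) q q)).det ≠ 0) (φ : N → ℝ)
    (w : EuclideanSpace ℝ (Fin k)) :
    B (ofTangent (gradient h φ q)) w
      = fderiv ℝ (φ ∘ (extChartAt (𝓡 k) q).symm) (extChartAt (𝓡 k) q q) w := by
  have hinv := Matrix.mul_nonsing_inv _ (isUnit_iff_ne_zero.2 hd)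
  suffices H : B (ofTangent (gradient h φ q))
      = fderiv ℝ (φ ∘ (extChartAt (𝓡 k) q).symm) (extChartAt (𝓡 k) q q) by rw [H]
  refine clm_ext_stdVec fun l => ?_
  have e : B (ofTangent (gradient h φ q)) (stdVec l)
      = ∑ i, (ofTangent (gradient h φ q)) i * B (stdVec i) (stdVec l) :=
    clm_apply_eq_sum (B.flip (stdVec l)) _
  rw [e]
  simp only [← hB, gradient, ofTangent, toTangent, Finset.sum_mul]
  rw [Finset.sum_comm]
  have : ∀ b, ∑ i, (chartGram h q (extChartAt (𝓡 k) q q))⁻¹ i b *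
      fderiv ℝ (φ ∘ (extChartAt (𝓡 k) q).symm) (extChartAt (𝓡 k) q q) (stdVec b) *
      chartGram h q (extChartAt (𝓡 k) q q) i l
      = fderiv ℝ (φ ∘ (extChartAt (𝓡 k) q).symm) (extChartAt (𝓡 k) q q) (stdVec b) *
        (1 : Matrix (Fin k) (Fin k) ℝ) l b := by
    intro b
    rw [← hinv, Matrix.mul_apply, Finset.mul_sum]
    refine Finset.sum_congr rfl fun a _ => ?_
    rw [hs a l]
    ring
  simp only [this, Matrix.one_apply, mul_ite, mul_one, mul_zero, Finset.sum_ite_eq,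
    Finset.mem_univ, if_true]

/-- The Laplacian as the trace of the Hessian in an orthonormal family. -/
theorem laplacian_eq_sum
    {B : EuclideanSpace ℝ (Fin k) →L[ℝ] EuclideanSpace ℝ (Fin k) →L[ℝ] ℝ}
    (hB : ∀ i j, chartGram h q (extChartAt (𝓡 k) q q) i j = B (stdVec i) (stdVec j))
    {e : Fin k → EuclideanSpace ℝ (Fin k)} (he : ∀ i j, B (e i) (e j) = if i = j then 1 else 0)
    {φ : N → ℝ}
    (hφ : ContDiffAt ℝ ∞ (φ ∘ (extChartAt (𝓡 k) q).symm) (extChartAt (𝓡 k) q q)) :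
    laplacian h φ q = ∑ i, (fderiv ℝ (fun u =>
        fderiv ℝ (φ ∘ (extChartAt (𝓡 k) q).symm) u (e i)) (extChartAt (𝓡 k) q q) (e i)
      - fderiv ℝ (φ ∘ (extChartAt (𝓡 k) q).symm) (extChartAt (𝓡 k) q q)
          (chartConn h q (extChartAt (𝓡 k) q q) (e i) (e i))) := by
  set φ' := φ ∘ (extChartAt (𝓡 k) q).symm
  set u := extChartAt (𝓡 k) q q
  -- The Hessian as a continuous bilinear form, so that its trace can be taken in either basis.
  let C : EuclideanSpace ℝ (Fin k) →L[ℝ] EuclideanSpace ℝ (Fin k) →L[ℝ] ℝ :=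
    fderiv ℝ (fderiv ℝ φ') u -
      (ContinuousLinearMap.compL ℝ _ _ _ (fderiv ℝ φ' u)).comp (chartConn h q u)
  have hd : DifferentiableAt ℝ (fderiv ℝ φ') u :=
    (hφ.fderiv_right (m := ∞) (by simp)).differentiableAt (by simp)
  have hC : ∀ v w, C v w = fderiv ℝ (fun u => fderiv ℝ φ' u w) u v
      - fderiv ℝ φ' u (chartConn h q u v w) := by
    intro v w
    rw [fderiv_clm_apply hd (by fun_prop)]
    simp [C]
  simp only [← hC]
  rw [← sum_inv_gram_eq_sum_orthonormal hB he]
  simp only [laplacian, hessian, hC, chartConn_apply, ofTangent, toTangent]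
  rfl

end Christoffel

/-! ### The Levi-Civita connection in a chart -/

section AmbientConnection

variable {m : ℕ} {M : Type*} [TopologicalSpace M]
  [ChartedSpace (EuclideanSpace ℝ (Fin m)) M] [IsManifold (𝓡 m) ∞ M]
  (g : Bundle.ContMDiffRiemannianMetric (𝓡 m) ∞ (EuclideanSpace ℝ (Fin m))
      (fun x : M => TangentSpace (𝓡 m) x))

theorem chartGram_metricFn_symm (q : M) (u : EuclideanSpace ℝ (Fin m)) (i j : Fin m) :
    chartGram (metricFn g) q u i j = chartGram (metricFn g) q u j i := g.symm _ _ _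

theorem chartGram_metricFn_det_pos {q : M} {u : EuclideanSpace ℝ (Fin m)}
    (hu : u ∈ (extChartAt (𝓡 m) q).target) : 0 < (chartGram (metricFn g) q u).det :=
  gram_det_pos (chartMetric_symm g q u) (fun _ hv => chartMetric_pos g hu hv)
    (chartGram_metricFn g q u)

theorem isLeviCivitaOn_chart (q : M) :
    IsLeviCivitaOn (extChartAt (𝓡 m) q).target (chartMetric g q) (chartConn (metricFn g) q) where
  isOpen := isOpen_extChartAt_target q
  contDiffOn_metric := contDiffOn_chartMetric g q
  contDiffOn_conn := fun u hu => by
    have hG := (contDiffOn_chartMetric g q).contDiffAt ((isOpen_extChartAt_target q).mem_nhds hu)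
    refine (contDiffAt_chartConn (fun i j => ?_)
      (chartGram_metricFn_det_pos g hu).ne').contDiffWithinAt
    simp only [chartGram_metricFn]
    exact (hG.clm_apply contDiffAt_const).clm_apply contDiffAt_const
  metric_symm := fun u _ => chartMetric_symm g q u
  conn_symm := fun u _ => chartConn_symm (chartGram_metricFn_symm g q)
  compat := fun u hu v x z => by
    have hG : DifferentiableAt ℝ (chartMetric g q) u := ((contDiffOn_chartMetric g q).contDiffAt
      ((isOpen_extChartAt_target q).mem_nhds hu)).differentiableAt (by simp)
    have hder : ∀ l i j, chartGramDeriv (metricFn g) q u l i j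
        = fderiv ℝ (chartMetric g q) u (stdVec l) (stdVec i) (stdVec j) := by
      intro l i j
      have h1 := hG.hasFDerivAt.clm_apply (hasFDerivAt_const (stdVec i) u)
      have h2 := h1.clm_apply (hasFDerivAt_const (stdVec j) u)
      simp only [chartGramDeriv, chartGram_metricFn]
      rw [h2.fderiv]
      simp
    have hlow := metric_chartConn_stdVec (chartGram_metricFn g q u) (chartGram_metricFn_symm g q)
      (chartGram_metricFn_det_pos g hu).ne'
    set A := fderiv ℝ (chartMetric g q) u
    set B := chartMetric g q u
    set C := chartConn (metricFn g) q u
    have hsymm : ∀ v w, B v w = B w v := chartMetric_symm g q u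
    have hsymmA : ∀ l i j, A (stdVec l) (stdVec i) (stdVec j) = A (stdVec l) (stdVec j) (stdVec i) := by
      intro l i j
      rw [← hder, ← hder]
      simp only [chartGramDeriv, chartGram_metricFn_symm g q _ i j]
    -- The sum of two Koszul expressions: the symmetry of the metric cancels all derivatives but the
    -- one in the direction `l`.
    have hbasis : ∀ l i j, A (stdVec l) (stdVec i) (stdVec j)
        = B (C (stdVec l) (stdVec i)) (stdVec j) + B (stdVec i) (C (stdVec l) (stdVec j)) := by
      intro l i j
      rw [hsymm (stdVec i), hlow, hlow]
      simp only [hder]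
      rw [hsymmA l j i, hsymmA i l j, hsymmA j l i]
      ring
    -- Both sides are trilinear, so the identity extends from basis vectors one argument at a time.
    have h1 : ∀ i j, ∀ v, A v (stdVec i) (stdVec j)
        = B (C v (stdVec i)) (stdVec j) + B (stdVec i) (C v (stdVec j)) := by
      intro i j v
      have := clm_ext_stdVec (A := (A.flip (stdVec i)).flip (stdVec j))
        (B := (B.flip (stdVec j)).comp (C.flip (stdVec i))
          + (B (stdVec i)).comp (C.flip (stdVec j))) fun l => hbasis l i j
      exact DFunLike.congr_fun this v
    have h2 : ∀ j, ∀ v x, A v x (stdVec j)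
        = B (C v x) (stdVec j) + B x (C v (stdVec j)) := by
      intro j v x
      have := clm_ext_stdVec (A := (A v).flip (stdVec j))
        (B := (B.flip (stdVec j)).comp (C v) + B.flip (C v (stdVec j))) fun i => h1 i j v
      exact DFunLike.congr_fun this x
    have := clm_ext_stdVec (A := A v x) (B := B (C v x) + (B x).comp (C v)) fun j => h2 j v x
    exact DFunLike.congr_fun this z

theorem curvature_metricFn (q : M) (x y z : TangentSpace (𝓡 m) q) :
    ofTangent (curvature (metricFn g) q x y z)
      = connCurvature (chartConn (metricFn g) q) (extChartAt (𝓡 m) q q) (ofTangent x)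
          (ofTangent y) (ofTangent z) := by
  have hΓ : DifferentiableAt ℝ (chartConn (metricFn g) q) (extChartAt (𝓡 m) q q) :=
    ((isLeviCivitaOn_chart g q).contDiffOn_conn.contDiffAt
      (extChartAt_target_mem_nhds (I := 𝓡 m) q)).differentiableAt (by simp)
  have hf : ∀ v w a : EuclideanSpace ℝ (Fin m),
      fderiv ℝ (fun u' => christoffel (metricFn g) q u' v w) (extChartAt (𝓡 m) q q) a
        = fderiv ℝ (chartConn (metricFn g) q) (extChartAt (𝓡 m) q q) a v w := by
    intro v w a
    have h1 := hΓ.hasFDerivAt.clm_apply (hasFDerivAt_const v (extChartAt (𝓡 m) q q))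
    have h2 := h1.clm_apply (hasFDerivAt_const w (extChartAt (𝓡 m) q q))
    simp only [← chartConn_apply]
    rw [h2.fderiv]
    simp
  simp only [curvature, connCurvature, ← hf, chartConn_apply]
  rfl

theorem innerModel_eq_chartMetric (q : M) :
    innerModel g q = chartMetric g q (extChartAt (𝓡 m) q q) := by
  ext v w
  rw [chartMetric_apply, chartSymmDeriv_self, extChartAt_to_inv]
  rfl

end AmbientConnection

end WeightedMinimal

namespace WeightedMinimal

/-! ### Families of maps in charts -/

section LocalRep

variable {m n : ℕ} {M : Type*} [TopologicalSpace M]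
  [ChartedSpace (EuclideanSpace ℝ (Fin m)) M] [IsManifold (𝓡 m) ∞ M]
  {S : Type*} [TopologicalSpace S] [ChartedSpace (EuclideanSpace ℝ (Fin n)) S]
  [IsManifold (𝓡 n) ∞ S]

/-- The family `F` in the preferred charts at `p` and `q`. -/
def localRep (F : ℝ → S → M) (p : S) (q : M) (z : ℝ × EuclideanSpace ℝ (Fin n)) :
    EuclideanSpace ℝ (Fin m) :=
  extChartAt (𝓡 m) q (F z.1 ((extChartAt (𝓡 n) p).symm z.2))

/-- The set on which `localRep F p q` represents `F`, for times in `(-ε, ε)`. -/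
def localDomain (ε : ℝ) (F : ℝ → S → M) (p : S) (q : M) : Set (ℝ × EuclideanSpace ℝ (Fin n)) :=
  {z | z.1 ∈ Set.Ioo (-ε) ε ∧ z.2 ∈ (extChartAt (𝓡 n) p).target ∧
    F z.1 ((extChartAt (𝓡 n) p).symm z.2) ∈ (extChartAt (𝓡 m) q).source}

/-- `F` is a smooth family of maps for times in `(-ε, ε)`. -/
def IsSmoothFamily (ε : ℝ) (F : ℝ → S → M) : Prop :=
  ContMDiffOn (𝓘(ℝ, ℝ).prod (𝓡 n)) (𝓡 m) ∞ (fun p : ℝ × S => F p.1 p.2)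
    (Set.Ioo (-ε) ε ×ˢ Set.univ)

variable {ε : ℝ} {F : ℝ → S → M} {p : S} {q : M}

theorem IsSmoothFamily.contMDiffAt (hF : IsSmoothFamily (m := m) (n := n) ε F) {t : ℝ}
    (ht : t ∈ Set.Ioo (-ε) ε) (x : S) :
    ContMDiffAt (𝓘(ℝ, ℝ).prod (𝓡 n)) (𝓡 m) ∞ (fun p : ℝ × S => F p.1 p.2) (t, x) :=
  ContMDiffOn.contMDiffAt hF ((isOpen_Ioo.prod isOpen_univ).mem_nhds ⟨ht, Set.mem_univ _⟩)

theorem IsSmoothFamily.contMDiff (hF : IsSmoothFamily (m := m) (n := n) ε F) {t : ℝ}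
    (ht : t ∈ Set.Ioo (-ε) ε) : ContMDiff (𝓡 n) (𝓡 m) ∞ (F t) := fun x =>
  (hF.contMDiffAt ht x).comp x (f := fun x => (t, x)) (contMDiffAt_const.prodMk contMDiffAt_id)

theorem IsSmoothFamily.contMDiffAt_time (hF : IsSmoothFamily (m := m) (n := n) ε F) {t : ℝ}
    (ht : t ∈ Set.Ioo (-ε) ε) (x : S) :
    ContMDiffAt 𝓘(ℝ, ℝ) (𝓡 m) ∞ (fun s => F s x) t :=
  (hF.contMDiffAt ht x).comp t (f := fun s => (s, x)) (contMDiffAt_id.prodMk contMDiffAt_const)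

theorem contMDiffOn_chartPair (p : S) :
    ContMDiffOn 𝓘(ℝ, ℝ × EuclideanSpace ℝ (Fin n)) (𝓘(ℝ, ℝ).prod (𝓡 n)) ∞
      (fun z : ℝ × EuclideanSpace ℝ (Fin n) => (z.1, (extChartAt (𝓡 n) p).symm z.2))
      (Set.univ ×ˢ (extChartAt (𝓡 n) p).target) :=
  contDiff_fst.contMDiff.contMDiffOn.prodMk
    ((contMDiffOn_extChartAt_symm p).comp contDiff_snd.contMDiff.contMDiffOn fun _ hz => hz.2)

theorem IsSmoothFamily.isOpen_localDomain (hF : IsSmoothFamily (m := m) (n := n) ε F) (p : S)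
    (q : M) : IsOpen (localDomain (n := n) (m := m) ε F p q) := by
  have h1 : ContinuousOn (fun z : ℝ × EuclideanSpace ℝ (Fin n) =>
      F z.1 ((extChartAt (𝓡 n) p).symm z.2)) (Set.Ioo (-ε) ε ×ˢ (extChartAt (𝓡 n) p).target) :=
    (ContMDiffOn.continuousOn hF).comp ((contMDiffOn_chartPair p).continuousOn.mono
      (Set.prod_mono (Set.subset_univ _) le_rfl)) fun z hz => ⟨hz.1, Set.mem_univ _⟩
  have h2 := h1.isOpen_inter_preimage (isOpen_Ioo.prod (isOpen_extChartAt_target p))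
    (isOpen_extChartAt_source (I := 𝓡 m) q)
  convert h2 using 1
  ext z
  simp [localDomain, and_assoc]

theorem mapsTo_localRep : Set.MapsTo (localRep (n := n) (m := m) F p q)
    (localDomain (n := n) (m := m) ε F p q) (extChartAt (𝓡 m) q).target :=
  fun _ hz => (extChartAt (𝓡 m) q).map_source hz.2.2

theorem IsSmoothFamily.contDiffOn_localRep (hF : IsSmoothFamily (m := m) (n := n) ε F) (p : S)
    (q : M) : ContDiffOn ℝ ∞ (localRep (n := n) (m := m) F p q)
      (localDomain (n := n) (m := m) ε F p q) := by
  rw [← contMDiffOn_iff_contDiffOn]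
  have h1 : ContMDiffOn 𝓘(ℝ, ℝ × EuclideanSpace ℝ (Fin n)) (𝓡 m) ∞
      (fun z : ℝ × EuclideanSpace ℝ (Fin n) => F z.1 ((extChartAt (𝓡 n) p).symm z.2))
      (localDomain (n := n) (m := m) ε F p q) :=
    ContMDiffOn.comp (g := fun p : ℝ × S => F p.1 p.2) hF
      ((contMDiffOn_chartPair p).mono fun z hz => ⟨Set.mem_univ _, hz.2.1⟩)
      fun z hz => ⟨hz.1, Set.mem_univ _⟩
  exact ContMDiffOn.comp (t := (chartAt (EuclideanSpace ℝ (Fin m)) q).source)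
    (contMDiffOn_extChartAt (I := 𝓡 m) (x := q)) h1
    fun z hz => by rw [Set.mem_preimage, ← extChartAt_source (𝓡 m)]; exact hz.2.2

theorem IsSmoothFamily.contDiffAt_localRep (hF : IsSmoothFamily (m := m) (n := n) ε F)
    {z : ℝ × EuclideanSpace ℝ (Fin n)} (hz : z ∈ localDomain (n := n) (m := m) ε F p q) :
    ContDiffAt ℝ ∞ (localRep (n := n) (m := m) F p q) z :=
  (hF.contDiffOn_localRep p q).contDiffAt ((hF.isOpen_localDomain p q).mem_nhds hz)

/-- The derivative of a map at `x`, as a map of the model spaces. -/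
def modelDeriv (F : S → M) (x : S) : EuclideanSpace ℝ (Fin n) →L[ℝ] EuclideanSpace ℝ (Fin m) :=
  mfderiv (𝓡 n) (𝓡 m) F x

theorem fderiv_slice {X W : Type*} [NormedAddCommGroup X] [NormedSpace ℝ X]
    [NormedAddCommGroup W] [NormedSpace ℝ W] {φ : ℝ × X → W} {t : ℝ} {u : X}
    (h : DifferentiableAt ℝ φ (t, u)) (v : X) :
    fderiv ℝ (fun u => φ (t, u)) u v = fderiv ℝ φ (t, u) (0, v) := by
  have h1 : HasFDerivAt (fun u : X => (t, u)) (ContinuousLinearMap.inr ℝ ℝ X) u :=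
    hasFDerivAt_prodMk_right t u
  have h2 := h.hasFDerivAt.comp u h1
  have h3 : (φ ∘ fun u => (t, u)) = fun u => φ (t, u) := rfl
  rw [← h3, h2.fderiv]
  simp

theorem fderiv_time {X W : Type*} [NormedAddCommGroup X] [NormedSpace ℝ X]
    [NormedAddCommGroup W] [NormedSpace ℝ W] {φ : ℝ × X → W} {t : ℝ} {u : X}
    (h : DifferentiableAt ℝ φ (t, u)) :
    fderiv ℝ (fun s => φ (s, u)) t 1 = fderiv ℝ φ (t, u) (1, 0) := by
  have h1 : HasFDerivAt (fun s : ℝ => (s, u)) (ContinuousLinearMap.inl ℝ ℝ X) t :=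
    hasFDerivAt_prodMk_left t u
  have h2 := h.hasFDerivAt.comp t h1
  have h3 : (φ ∘ fun s => (s, u)) = fun s => φ (s, u) := rfl
  rw [← h3, h2.fderiv]
  simp

theorem IsSmoothFamily.fderiv_localRep (hF : IsSmoothFamily (m := m) (n := n) ε F)
    {t : ℝ} {u : EuclideanSpace ℝ (Fin n)}
    (hz : (t, u) ∈ localDomain (n := n) (m := m) ε F p q) (v : EuclideanSpace ℝ (Fin n)) :
    fderiv ℝ (localRep (n := n) (m := m) F p q) (t, u) (0, v)
      = chartDeriv q (F t ((extChartAt (𝓡 n) p).symm u))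
          (modelDeriv (F t) ((extChartAt (𝓡 n) p).symm u) (chartSymmDeriv p u v)) := by
  rw [← fderiv_slice ((hF.contDiffAt_localRep hz).differentiableAt (by simp)), ← mfderiv_eq_fderiv]
  have h1 : MDifferentiableAt (𝓡 n) (𝓡 n) (extChartAt (𝓡 n) p).symm u :=
    (extChartAt_symm_contMDiffAt hz.2.1).mdifferentiableAt (by simp)
  have h2 : MDifferentiableAt (𝓡 n) (𝓡 m) (F t) ((extChartAt (𝓡 n) p).symm u) :=
    (hF.contMDiff hz.1 _).mdifferentiableAt (by simp)
  have h3 : MDifferentiableAt (𝓡 m) (𝓡 m) (extChartAt (𝓡 m) q)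
      (F t ((extChartAt (𝓡 n) p).symm u)) :=
    (extChartAt_contMDiffAt hz.2.2).mdifferentiableAt (by simp)
  have h4 := ((h3.hasMFDerivAt.comp _ h2.hasMFDerivAt).comp u h1.hasMFDerivAt).mfderiv
  exact DFunLike.congr_fun h4 v

theorem IsSmoothFamily.fderiv_localRep_time (hF : IsSmoothFamily (m := m) (n := n) ε F)
    {t : ℝ} {u : EuclideanSpace ℝ (Fin n)}
    (hz : (t, u) ∈ localDomain (n := n) (m := m) ε F p q) :
    fderiv ℝ (localRep (n := n) (m := m) F p q) (t, u) (1, 0)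
      = chartDeriv q (F t ((extChartAt (𝓡 n) p).symm u))
          (ofTangent (velocity F t ((extChartAt (𝓡 n) p).symm u))) := by
  rw [← fderiv_time ((hF.contDiffAt_localRep hz).differentiableAt (by simp)), ← mfderiv_eq_fderiv]
  have h2 : MDifferentiableAt 𝓘(ℝ, ℝ) (𝓡 m) (fun s => F s ((extChartAt (𝓡 n) p).symm u)) t :=
    (hF.contMDiffAt_time hz.1 _).mdifferentiableAt (by simp)
  have h3 : MDifferentiableAt (𝓡 m) (𝓡 m) (extChartAt (𝓡 m) q)
      (F t ((extChartAt (𝓡 n) p).symm u)) :=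
    (extChartAt_contMDiffAt hz.2.2).mdifferentiableAt (by simp)
  have h4 := (h3.hasMFDerivAt.comp t h2.hasMFDerivAt).mfderiv
  exact DFunLike.congr_fun h4 (1 : ℝ)

variable (g : Bundle.ContMDiffRiemannianMetric (𝓡 m) ∞ (EuclideanSpace ℝ (Fin m))
      (fun x : M => TangentSpace (𝓡 m) x))

theorem chartGram_inducedMetric (F : S → M) (p : S) (u : EuclideanSpace ℝ (Fin n)) (i j : Fin n) :
    chartGram (inducedMetric (n := n) g F) p u i j
      = innerModel g (F ((extChartAt (𝓡 n) p).symm u))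
          (modelDeriv F ((extChartAt (𝓡 n) p).symm u) (chartSymmDeriv p u (stdVec i)))
          (modelDeriv F ((extChartAt (𝓡 n) p).symm u) (chartSymmDeriv p u (stdVec j))) := rfl

theorem chartGram_inducedMetric_symm (F : S → M) (p : S) (u : EuclideanSpace ℝ (Fin n))
    (i j : Fin n) : chartGram (inducedMetric (n := n) g F) p u i j
      = chartGram (inducedMetric (n := n) g F) p u j i := g.symm _ _ _

/-- The coordinate directions of `S` in the product of time and the model space. -/
def spaceVec (i : Fin n) : ℝ × EuclideanSpace ℝ (Fin n) := (0, stdVec i)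

theorem IsSmoothFamily.chartMetric_localRep (hF : IsSmoothFamily (m := m) (n := n) ε F)
    {t : ℝ} {u : EuclideanSpace ℝ (Fin n)}
    (hz : (t, u) ∈ localDomain (n := n) (m := m) ε F p q) (v w : EuclideanSpace ℝ (Fin n)) :
    chartMetric g q (localRep F p q (t, u)) (fderiv ℝ (localRep F p q) (t, u) (0, v))
        (fderiv ℝ (localRep F p q) (t, u) (0, w))
      = innerModel g (F t ((extChartAt (𝓡 n) p).symm u))
          (modelDeriv (F t) ((extChartAt (𝓡 n) p).symm u) (chartSymmDeriv p u v))
          (modelDeriv (F t) ((extChartAt (𝓡 n) p).symm u) (chartSymmDeriv p u w)) := by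
  rw [hF.fderiv_localRep hz, hF.fderiv_localRep hz]
  exact chartMetric_chartDeriv g hz.2.2 _ _

/-- The chart metric at `q` makes that chart an isometry, so the induced metric can be computed from
the local representation. This is the bridge from the manifold to the vector-space computations. -/
theorem IsSmoothFamily.chartGram_eq_gramAlong (hF : IsSmoothFamily (m := m) (n := n) ε F)
    {t : ℝ} {u : EuclideanSpace ℝ (Fin n)}
    (hz : (t, u) ∈ localDomain (n := n) (m := m) ε F p q) :
    chartGram (inducedMetric (n := n) g (F t)) p u
      = gramAlong (chartMetric g q) (localRep F p q) spaceVec (t, u) := by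
  ext i j
  rw [chartGram_inducedMetric, gramAlong, Matrix.of_apply, spaceVec, spaceVec,
    hF.chartMetric_localRep g hz]

/-- `F t` is an immersion for each time in `(-ε, ε)`. -/
def IsImmersedFamily (ε : ℝ) (F : ℝ → S → M) : Prop :=
  ∀ t ∈ Set.Ioo (-ε) ε, ∀ x, Function.Injective (mfderiv (𝓡 n) (𝓡 m) (F t) x)

theorem chartSymmDeriv_injective {u : EuclideanSpace ℝ (Fin n)}
    (hu : u ∈ (extChartAt (𝓡 n) p).target) : Function.Injective (chartSymmDeriv p u) :=
  Function.LeftInverse.injective (chartDeriv_chartSymmDeriv hu)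

/-- The derivatives of the inverse chart and of `F` are injective, so the pulled-back form is
positive definite. -/
theorem inducedGram_pos {F : S → M} {u : EuclideanSpace ℝ (Fin n)}
    (hu : u ∈ (extChartAt (𝓡 n) p).target)
    (hF : Function.Injective (mfderiv (𝓡 n) (𝓡 m) F ((extChartAt (𝓡 n) p).symm u))) :
    0 < (chartGram (inducedMetric (n := n) g F) p u).det := by
  set L := (modelDeriv (m := m) (n := n) F ((extChartAt (𝓡 n) p).symm u)).comp (chartSymmDeriv p u)
  refine gram_det_pos (B := (innerModel g (F ((extChartAt (𝓡 n) p).symm u))).bilinearComp L L)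
    (fun v w => g.symm _ _ _) (fun v hv => g.pos _ _ fun h0 => hv ?_) (fun i j => rfl)
  have h1 : mfderiv (𝓡 n) (𝓡 m) F ((extChartAt (𝓡 n) p).symm u)
    (toTangent _ (chartSymmDeriv p u v)) = 0 := h0
  have h2 := hF (h1.trans (map_zero _).symm)
  exact chartSymmDeriv_injective hu (h2.trans (map_zero _).symm)

end LocalRep

end WeightedMinimal

namespace WeightedMinimal

open MeasureTheory

/-! ### The Riemannian volume measure -/

section Volume

variable {n : ℕ} {S : Type*} [TopologicalSpace S] [ChartedSpace (EuclideanSpace ℝ (Fin n)) S]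
  [IsManifold (𝓡 n) ∞ S]

/-- The density of the Riemannian volume in the preferred chart at `p`. -/
def chartDensity (h : (x : S) → TangentSpace (𝓡 n) x → TangentSpace (𝓡 n) x → ℝ) (p : S)
    (u : EuclideanSpace ℝ (Fin n)) : ℝ := √(chartGram h p u).det

/-- The derivative of the transition map from the chart at `p` to the chart at `q`. -/
def transDeriv (p q : S) (u : EuclideanSpace ℝ (Fin n)) :
    EuclideanSpace ℝ (Fin n) →L[ℝ] EuclideanSpace ℝ (Fin n) :=
  (chartDeriv q ((extChartAt (𝓡 n) p).symm u)).comp (chartSymmDeriv p u)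

theorem hasFDerivAt_trans {p q : S} {u : EuclideanSpace ℝ (Fin n)}
    (hu : u ∈ (extChartAt (𝓡 n) p).target)
    (hq : (extChartAt (𝓡 n) p).symm u ∈ (extChartAt (𝓡 n) q).source) :
    HasFDerivAt (fun u => extChartAt (𝓡 n) q ((extChartAt (𝓡 n) p).symm u))
      (transDeriv p q u) u := by
  have h1 : MDifferentiableAt (𝓡 n) (𝓡 n) (extChartAt (𝓡 n) p).symm u :=
    (extChartAt_symm_contMDiffAt hu).mdifferentiableAt (by simp)
  have h3 : MDifferentiableAt (𝓡 n) (𝓡 n) (extChartAt (𝓡 n) q) ((extChartAt (𝓡 n) p).symm u) :=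
    (extChartAt_contMDiffAt hq).mdifferentiableAt (by simp)
  have h4 := h3.hasMFDerivAt.comp u h1.hasMFDerivAt
  exact h4.hasFDerivAt

/-- The matrix Q of `L` satisfies A = Qᵀ A' Q; take determinants. -/
theorem gram_det_comp {k : ℕ}
    {B : EuclideanSpace ℝ (Fin k) →L[ℝ] EuclideanSpace ℝ (Fin k) →L[ℝ] ℝ}
    {L : EuclideanSpace ℝ (Fin k) →L[ℝ] EuclideanSpace ℝ (Fin k)}
    {A A' : Matrix (Fin k) (Fin k) ℝ} (hA : ∀ i j, A i j = B (L (stdVec i)) (L (stdVec j)))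
    (hA' : ∀ i j, A' i j = B (stdVec i) (stdVec j)) : A.det = L.det ^ 2 * A'.det := by
  set Q : Matrix (Fin k) (Fin k) ℝ := Matrix.of fun a i => (L (stdVec i)) a with hQ
  have hdet : L.det = Q.det := by
    have := LinearMap.det_toMatrix (EuclideanSpace.basisFun (Fin k) ℝ).toBasis L.toLinearMap
    rw [ContinuousLinearMap.det, ← this]
    congr 1
  have h1 : A = Q.transpose * A' * Q := by
    ext i j
    rw [hA, clm_apply_apply_eq_sum, Finset.sum_comm]
    simp only [Matrix.mul_apply, hQ, Matrix.of_apply, Matrix.transpose_apply, hA', Finset.sum_mul]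
    exact Finset.sum_congr rfl fun a _ => Finset.sum_congr rfl fun b _ => by ring
  rw [h1, Matrix.det_mul, Matrix.det_mul, Matrix.det_transpose, hdet]
  ring

/-- The densities of `h` in the various charts are compatible and continuous. -/
structure IsDensity (h : (x : S) → TangentSpace (𝓡 n) x → TangentSpace (𝓡 n) x → ℝ) :
    Prop where
  continuousOn : ∀ p, ContinuousOn (chartDensity h p) (extChartAt (𝓡 n) p).target
  pos : ∀ p, ∀ u ∈ (extChartAt (𝓡 n) p).target, 0 < chartDensity h p u
  trans : ∀ p q, ∀ u ∈ (extChartAt (𝓡 n) p).target,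
    (extChartAt (𝓡 n) p).symm u ∈ (extChartAt (𝓡 n) q).source →
    chartDensity h p u = |(transDeriv p q u).det| *
      chartDensity h q (extChartAt (𝓡 n) q ((extChartAt (𝓡 n) p).symm u))

variable [MeasurableSpace S] [BorelSpace S]
  {h : (x : S) → TangentSpace (𝓡 n) x → TangentSpace (𝓡 n) x → ℝ}

/-- The Riemannian volume measure of a chart domain. -/
def chartVolume (h : (x : S) → TangentSpace (𝓡 n) x → TangentSpace (𝓡 n) x → ℝ) (p : S) :
    Measure S :=
  Measure.map (extChartAt (𝓡 n) p).symm
    ((volume.restrict (extChartAt (𝓡 n) p).target).withDensity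
      fun u => ENNReal.ofReal (chartDensity h p u))

theorem riemannianVolume_eq_iSup : riemannianVolume h = ⨆ p, chartVolume h p := rfl

theorem measurableSet_chart_target (p : S) : MeasurableSet (extChartAt (𝓡 n) p).target :=
  (isOpen_extChartAt_target p).measurableSet

theorem measurableSet_chart_source (p : S) : MeasurableSet (extChartAt (𝓡 n) p).source :=
  (isOpen_extChartAt_source p).measurableSet

theorem measurableSet_chart_preimage (p : S) {A : Set S} (hA : MeasurableSet A) :
    MeasurableSet ((extChartAt (𝓡 n) p).target ∩ (extChartAt (𝓡 n) p).symm ⁻¹' A) := by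
  have h1 : Measurable fun u : (extChartAt (𝓡 n) p).target => (extChartAt (𝓡 n) p).symm u :=
    (continuousOn_iff_continuous_domRestrict.1 (continuousOn_extChartAt_symm p)).measurable
  have h2 := (MeasurableEmbedding.subtype_coe
    (measurableSet_chart_target (n := n) p)).measurableSet_image.2 (h1 hA)
  convert h2 using 1
  ext u
  constructor
  · rintro ⟨hu, hA⟩
    exact ⟨⟨u, hu⟩, hA, rfl⟩
  · rintro ⟨⟨u, hu⟩, hA, rfl⟩
    exact ⟨hu, hA⟩

theorem indicator_mul_indicator_comp {X Y : Type*} (s : Set X) (A : Set Y) (e : X → Y)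
    (a : X → ENNReal) (φ : Y → ENNReal) :
    s.indicator (fun u => a u * A.indicator φ (e u))
      = (s ∩ e ⁻¹' A).indicator fun u => a u * φ (e u) := by
  ext u
  by_cases h1 : u ∈ s <;> by_cases h2 : e u ∈ A <;> simp [Set.indicator, h1, h2]

theorem IsDensity.lintegral_chartVolume (hh : IsDensity h) (p : S) {φ : S → ENNReal}
    (hφ : Measurable φ) :
    ∫⁻ x, φ x ∂(chartVolume h p) = ∫⁻ u in (extChartAt (𝓡 n) p).target,
      ENNReal.ofReal (chartDensity h p u) * φ ((extChartAt (𝓡 n) p).symm u) := by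
  -- The inverse chart is only known to be continuous on its target. Almost everywhere measurability
  -- for the restricted measure is enough, and without it `Measure.map` would be zero by default.
  have h1 : AEMeasurable (extChartAt (𝓡 n) p).symm
      (volume.restrict (extChartAt (𝓡 n) p).target) :=
    (continuousOn_extChartAt_symm p).aemeasurable (measurableSet_chart_target p)
  have h2 : AEMeasurable (fun u => ENNReal.ofReal (chartDensity h p u))
      (volume.restrict (extChartAt (𝓡 n) p).target) :=
    ((hh.continuousOn p).aemeasurable (measurableSet_chart_target p)).ennreal_ofReal
  have h3 := h1.mono_ac (withDensity_absolutelyContinuous _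
    (fun u => ENNReal.ofReal (chartDensity h p u)))
  rw [chartVolume, lintegral_map' hφ.aemeasurable h3]
  exact lintegral_withDensity_eq_lintegral_mul₀' h2 (hφ.comp_aemeasurable h3)

theorem IsDensity.chartVolume_apply (hh : IsDensity h) (p : S) {A : Set S}
    (hA : MeasurableSet A) :
    chartVolume h p A = ∫⁻ u in (extChartAt (𝓡 n) p).target ∩ (extChartAt (𝓡 n) p).symm ⁻¹' A,
      ENNReal.ofReal (chartDensity h p u) := by
  rw [← lintegral_indicator_one hA, hh.lintegral_chartVolume p (measurable_one.indicator hA),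
    ← lintegral_indicator (measurableSet_chart_target p),
    ← lintegral_indicator (measurableSet_chart_preimage p hA)]
  rw [indicator_mul_indicator_comp]
  simp

/-- The change of variables formula for the transition map, whose Jacobian is exactly the factor
relating the two densities. -/
theorem IsDensity.chartVolume_eq (hh : IsDensity h) (p q : S) {A : Set S} (hA : MeasurableSet A)
    (hp : A ⊆ (extChartAt (𝓡 n) p).source) (hq : A ⊆ (extChartAt (𝓡 n) q).source) :
    chartVolume h p A = chartVolume h q A := by
  rw [hh.chartVolume_apply p hA, hh.chartVolume_apply q hA]
  set s := (extChartAt (𝓡 n) p).target ∩ (extChartAt (𝓡 n) p).symm ⁻¹' A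
  have himg : (extChartAt (𝓡 n) q).target ∩ (extChartAt (𝓡 n) q).symm ⁻¹' A
      = (fun u => extChartAt (𝓡 n) q ((extChartAt (𝓡 n) p).symm u)) '' s := by
    ext v
    constructor
    · rintro ⟨h1, h2⟩
      refine ⟨extChartAt (𝓡 n) p ((extChartAt (𝓡 n) q).symm v),
        ⟨(extChartAt (𝓡 n) p).map_source (hp h2), ?_⟩, ?_⟩
      · rw [Set.mem_preimage, (extChartAt (𝓡 n) p).left_inv (hp h2)]
        exact h2
      · simp only [(extChartAt (𝓡 n) p).left_inv (hp h2), (extChartAt (𝓡 n) q).right_inv h1]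
    · rintro ⟨u, ⟨h1, h2⟩, rfl⟩
      refine ⟨(extChartAt (𝓡 n) q).map_source (hq h2), ?_⟩
      rw [Set.mem_preimage, (extChartAt (𝓡 n) q).left_inv (hq h2)]
      exact h2
  rw [himg, lintegral_image_eq_lintegral_abs_det_fderiv_mul volume
    (measurableSet_chart_preimage p hA)
    (fun u hu => (hasFDerivAt_trans hu.1 (hq hu.2)).hasFDerivWithinAt)]
  · refine setLIntegral_congr_fun (measurableSet_chart_preimage p hA) fun u hu => ?_
    rw [hh.trans p q u hu.1 (hq hu.2), ENNReal.ofReal_mul (abs_nonneg _)]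
  · intro u hu u' hu' he
    have h1 := (extChartAt (𝓡 n) q).injOn (hq hu.2) (hq hu'.2) he
    exact (extChartAt (𝓡 n) p).symm.injOn hu.1 hu'.1 h1

theorem IsDensity.chartVolume_inter_source (hh : IsDensity h) (p : S) {A : Set S}
    (hA : MeasurableSet A) :
    chartVolume h p (A ∩ (extChartAt (𝓡 n) p).source) = chartVolume h p A := by
  rw [hh.chartVolume_apply p hA, hh.chartVolume_apply p (hA.inter (measurableSet_chart_source p))]
  congr 2
  ext u
  simp only [Set.mem_inter_iff, Set.mem_preimage]
  exact ⟨fun h => ⟨h.1, h.2.1⟩, fun h => ⟨h.1, h.2, (extChartAt (𝓡 n) p).map_target h.1⟩⟩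

variable (n) in
-- Second countability gives countably many chart domains that cover `S`; making them disjoint gives
-- the partition. The point `p` only ensures that they can be enumerated by ℕ.
theorem exists_chart_partition [SecondCountableTopology S] (p : S) :
    ∃ (c : ℕ → S) (D : ℕ → Set S), (∀ k, MeasurableSet (D k)) ∧
      (∀ k, D k ⊆ (extChartAt (𝓡 n) (c k)).source) ∧ Pairwise (Function.onFun Disjoint D) ∧
      ⋃ k, D k = Set.univ := by
  obtain ⟨s, hs, hcov⟩ := TopologicalSpace.countable_cover_nhds
    fun x : S => extChartAt_source_mem_nhds (I := 𝓡 n) x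
  have hne : s.Nonempty := by
    have : p ∈ ⋃ x ∈ s, (extChartAt (𝓡 n) x).source := hcov ▸ Set.mem_univ p
    simp only [Set.mem_iUnion] at this
    obtain ⟨x, hx, _⟩ := this
    exact ⟨x, hx⟩
  obtain ⟨c, rfl⟩ := hs.exists_eq_range hne
  refine ⟨c, disjointed fun k => (extChartAt (𝓡 n) (c k)).source, fun k => ?_, fun k => ?_,
    disjoint_disjointed _, ?_⟩
  · exact MeasurableSet.disjointed (fun k => measurableSet_chart_source (n := n) (c k)) k
  · exact disjointed_subset _ k
  · rw [iUnion_disjointed, ← hcov]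
    simp

/-- A supremum of measures could a priori exceed each of them on a set. Here all chart measures lie
below one measure, glued from a partition into pieces of chart domains, and on sets inside a chart
domain this measure agrees with the chart measure. -/
theorem IsDensity.riemannianVolume_apply [SecondCountableTopology S] (hh : IsDensity h) (p : S)
    {A : Set S} (hA : MeasurableSet A) (hp : A ⊆ (extChartAt (𝓡 n) p).source) :
    riemannianVolume h A = chartVolume h p A := by
  refine le_antisymm ?_ (Measure.le_iff'.1 (le_iSup (fun p => chartVolume h p) p) A)
  obtain ⟨c, D, hDm, hDs, hDd, hDu⟩ := exists_chart_partition n p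
  -- The glued measure: on each piece of the partition the volume is taken from the chart whose
  -- domain contains that piece.
  set lam := Measure.sum fun k => (chartVolume h (c k)).restrict (D k)
  have hsum : ∀ q, ∀ B, MeasurableSet B → B ⊆ (extChartAt (𝓡 n) q).source →
      lam B = chartVolume h q B := by
    intro q B hB hq
    rw [Measure.sum_apply _ hB]
    have h1 : ∀ k, (chartVolume h (c k)).restrict (D k) B = chartVolume h q (B ∩ D k) := by
      intro k
      rw [Measure.restrict_apply hB]
      exact hh.chartVolume_eq _ _ (hB.inter (hDm k)) (Set.inter_subset_right.trans (hDs k))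
        (Set.inter_subset_left.trans hq)
    simp only [h1]
    rw [← measure_iUnion, ← Set.inter_iUnion, hDu, Set.inter_univ]
    · intro i j hij
      exact (hDd hij).mono Set.inter_subset_right Set.inter_subset_right
    · exact fun k => hB.inter (hDm k)
  have hle : riemannianVolume h ≤ lam := by
    rw [riemannianVolume_eq_iSup]
    refine iSup_le fun q => Measure.le_iff.2 fun B hB => ?_
    rw [← hh.chartVolume_inter_source q hB,
      ← hsum q _ (hB.inter (measurableSet_chart_source q)) Set.inter_subset_right]
    exact measure_mono Set.inter_subset_left
  exact (Measure.le_iff'.1 hle A).trans_eq (hsum p A hA hp)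

theorem measure_ext_of_chart [SecondCountableTopology S] {μ μ' : Measure S}
    (H : ∀ p, ∀ A, MeasurableSet A → A ⊆ (extChartAt (𝓡 n) p).source → μ A = μ' A) : μ = μ' := by
  refine Measure.ext fun A hA => ?_
  rcases isEmpty_or_nonempty S with hS | ⟨⟨p⟩⟩
  · simp [Set.eq_empty_of_isEmpty A]
  obtain ⟨c, D, hDm, hDs, hDd, hDu⟩ := exists_chart_partition n p
  have h1 : ∀ ν : Measure S, ν A = ∑' k, ν (A ∩ D k) := by
    intro ν
    rw [← measure_iUnion, ← Set.inter_iUnion, hDu, Set.inter_univ]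
    · intro i j hij
      exact (hDd hij).mono Set.inter_subset_right Set.inter_subset_right
    · exact fun k => hA.inter (hDm k)
  rw [h1, h1]
  exact tsum_congr fun k => H (c k) _ (hA.inter (hDm k)) (Set.inter_subset_right.trans (hDs k))

theorem IsDensity.lintegral_riemannianVolume [SecondCountableTopology S] (hh : IsDensity h)
    (p : S) {φ : S → ENNReal} (hφ : Measurable φ) {A : Set S} (hA : MeasurableSet A)
    (hp : A ⊆ (extChartAt (𝓡 n) p).source) :
    ∫⁻ x in A, φ x ∂(riemannianVolume h)
      = ∫⁻ u in (extChartAt (𝓡 n) p).target ∩ (extChartAt (𝓡 n) p).symm ⁻¹' A,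
        ENNReal.ofReal (chartDensity h p u) * φ ((extChartAt (𝓡 n) p).symm u) := by
  have h1 : (riemannianVolume h).restrict A = (chartVolume h p).restrict A := by
    refine Measure.ext fun B hB => ?_
    rw [Measure.restrict_apply hB, Measure.restrict_apply hB]
    exact hh.riemannianVolume_apply p (hB.inter hA) (Set.inter_subset_right.trans hp)
  rw [h1, ← lintegral_indicator hA, hh.lintegral_chartVolume p (hφ.indicator hA),
    ← lintegral_indicator (measurableSet_chart_target p),
    ← lintegral_indicator (measurableSet_chart_preimage p hA)]
  rw [indicator_mul_indicator_comp]

/-- Both measures are determined by their values on sets inside a chart domain, where each is an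
explicit integral. -/
theorem IsDensity.riemannianVolume_eq_withDensity [SecondCountableTopology S]
    {h' : (x : S) → TangentSpace (𝓡 n) x → TangentSpace (𝓡 n) x → ℝ} (hh : IsDensity h)
    (hh' : IsDensity h') {J : S → ℝ} (hJ : Measurable J)
    (hJh : ∀ p, ∀ u ∈ (extChartAt (𝓡 n) p).target,
      chartDensity h' p u = chartDensity h p u * J ((extChartAt (𝓡 n) p).symm u)) :
    riemannianVolume h' = (riemannianVolume h).withDensity fun x => ENNReal.ofReal (J x) := by
  refine measure_ext_of_chart (n := n) fun p A hA hp => ?_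
  rw [withDensity_apply _ hA, hh.lintegral_riemannianVolume p hJ.ennreal_ofReal hA hp,
    hh'.riemannianVolume_apply p hA hp, hh'.chartVolume_apply p hA]
  refine setLIntegral_congr_fun (measurableSet_chart_preimage p hA) fun u hu => ?_
  rw [hJh p u hu.1, ENNReal.ofReal_mul (hh.pos p u hu.1).le]

/-- By continuity the density is bounded on a small ball of the chart. Consequently continuous
functions are integrable on compact sets. -/
theorem IsDensity.isLocallyFiniteMeasure [SecondCountableTopology S] (hh : IsDensity h) :
    IsLocallyFiniteMeasure (riemannianVolume h) := by
  refine ⟨fun p => ?_⟩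
  have hu := mem_extChartAt_target (I := 𝓡 n) p
  have hc : ContinuousAt (chartDensity h p) (extChartAt (𝓡 n) p p) :=
    (hh.continuousOn p).continuousAt (extChartAt_target_mem_nhds p)
  have hev : ∀ᶠ u in 𝓝 (extChartAt (𝓡 n) p p),
      chartDensity h p u < chartDensity h p (extChartAt (𝓡 n) p p) + 1 :=
    hc.eventually_lt continuousAt_const (by simp)
  obtain ⟨r, hr, hball⟩ := Metric.eventually_nhds_iff_ball.1 hev
  set C := chartDensity h p (extChartAt (𝓡 n) p p) + 1
  set A := (extChartAt (𝓡 n) p).source ∩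
    extChartAt (𝓡 n) p ⁻¹' (Metric.ball (extChartAt (𝓡 n) p p) r) with hAdef
  have hAo : IsOpen A := (continuousOn_extChartAt p).isOpen_inter_preimage
    (isOpen_extChartAt_source p) Metric.isOpen_ball
  refine ⟨A, hAo.mem_nhds ⟨mem_extChartAt_source p, by simpa using hr⟩, ?_⟩
  rw [hh.riemannianVolume_apply p hAo.measurableSet Set.inter_subset_left,
    hh.chartVolume_apply p hAo.measurableSet]
  have hsub : (extChartAt (𝓡 n) p).target ∩ (extChartAt (𝓡 n) p).symm ⁻¹' A
      ⊆ Metric.ball (extChartAt (𝓡 n) p p) r := by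
    rintro u ⟨h1, h2, h3⟩
    rwa [Set.mem_preimage, (extChartAt (𝓡 n) p).right_inv h1] at h3
  calc ∫⁻ u in (extChartAt (𝓡 n) p).target ∩ (extChartAt (𝓡 n) p).symm ⁻¹' A,
        ENNReal.ofReal (chartDensity h p u)
      ≤ ∫⁻ _ in (extChartAt (𝓡 n) p).target ∩ (extChartAt (𝓡 n) p).symm ⁻¹' A,
          ENNReal.ofReal C := by
        refine setLIntegral_mono' (measurableSet_chart_preimage p hAo.measurableSet) fun u hu => ?_
        exact ENNReal.ofReal_le_ofReal (hball u (hsub hu)).le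
    _ = ENNReal.ofReal C * volume ((extChartAt (𝓡 n) p).target ∩
          (extChartAt (𝓡 n) p).symm ⁻¹' A) := setLIntegral_const _ _
    _ < ⊤ := ENNReal.mul_lt_top ENNReal.ofReal_lt_top
          ((measure_mono hsub).trans_lt measure_ball_lt_top)

/-- A positive density on a nonempty open set has nonzero integral. This lets a nonnegative
continuous function with zero integral be recognised as zero. -/
theorem IsDensity.isOpenPosMeasure [SecondCountableTopology S] (hh : IsDensity h) :
    (riemannianVolume h).IsOpenPosMeasure := by
  refine ⟨fun U hU ⟨p, hp⟩ h0 => ?_⟩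
  set A := U ∩ (extChartAt (𝓡 n) p).source
  have hAo : IsOpen A := hU.inter (isOpen_extChartAt_source p)
  have h1 : riemannianVolume h A = 0 := measure_mono_null Set.inter_subset_left h0
  rw [hh.riemannianVolume_apply p hAo.measurableSet Set.inter_subset_right,
    hh.chartVolume_apply p hAo.measurableSet] at h1
  have hm := measurableSet_chart_preimage (n := n) p hAo.measurableSet
  have hopen : IsOpen ((extChartAt (𝓡 n) p).target ∩ (extChartAt (𝓡 n) p).symm ⁻¹' A) :=
    (continuousOn_extChartAt_symm p).isOpen_inter_preimage (isOpen_extChartAt_target p) hAo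
  have hne : ((extChartAt (𝓡 n) p).target ∩ (extChartAt (𝓡 n) p).symm ⁻¹' A).Nonempty := by
    refine ⟨extChartAt (𝓡 n) p p, mem_extChartAt_target p, ?_⟩
    rw [Set.mem_preimage, extChartAt_to_inv]
    exact ⟨hp, mem_extChartAt_source p⟩
  have hdm : AEMeasurable (fun u => ENNReal.ofReal (chartDensity h p u))
      (volume.restrict ((extChartAt (𝓡 n) p).target ∩ (extChartAt (𝓡 n) p).symm ⁻¹' A)) :=
    (((hh.continuousOn p).mono Set.inter_subset_left).aemeasurable hm).ennreal_ofReal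
  rw [setLIntegral_eq_zero_iff' hm hdm] at h1
  refine (hopen.measure_pos volume hne).ne' (measure_mono_null (fun u hu => ?_) h1)
  rw [Set.mem_compl_iff, Set.mem_ofPred_eq, Classical.not_imp]
  exact ⟨hu, (ENNReal.ofReal_pos.2 (hh.pos p u hu.1)).ne'⟩

end Volume

end WeightedMinimal

namespace WeightedMinimal

open MeasureTheory

/-! ### Densities of the induced metrics -/

section WeightDensity

variable {m n : ℕ} {M : Type*} [TopologicalSpace M]
  [ChartedSpace (EuclideanSpace ℝ (Fin m)) M] [IsManifold (𝓡 m) ∞ M]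
  {S : Type*} [TopologicalSpace S] [ChartedSpace (EuclideanSpace ℝ (Fin n)) S]
  [IsManifold (𝓡 n) ∞ S]
  (g : Bundle.ContMDiffRiemannianMetric (𝓡 m) ∞ (EuclideanSpace ℝ (Fin m))
      (fun x : M => TangentSpace (𝓡 m) x))
  {ε : ℝ} {F : ℝ → S → M} {p : S} {q : M}

theorem IsSmoothFamily.contDiffAt_chartGram (hF : IsSmoothFamily (m := m) (n := n) ε F) {t : ℝ}
    (ht : t ∈ Set.Ioo (-ε) ε) {u : EuclideanSpace ℝ (Fin n)}
    (hu : u ∈ (extChartAt (𝓡 n) p).target) (i j : Fin n) :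
    ContDiffAt ℝ ∞ (fun z : ℝ × EuclideanSpace ℝ (Fin n) =>
      chartGram (inducedMetric (n := n) g (F z.1)) p z.2 i j) (t, u) := by
  set q := F t ((extChartAt (𝓡 n) p).symm u) with hq
  have hz : (t, u) ∈ localDomain (m := m) (n := n) ε F p q :=
    ⟨ht, hu, by rw [hq]; exact mem_extChartAt_source _⟩
  have hΩ := hF.isOpen_localDomain p q
  refine ((isLeviCivitaOn_chart g q).contDiffAt_gramAlong (mapsTo_localRep hz)
    (hF.contDiffAt_localRep hz) spaceVec i j).congr_of_eventuallyEq ?_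
  filter_upwards [hΩ.mem_nhds hz] with z hz
  rw [hF.chartGram_eq_gramAlong g (t := z.1) (u := z.2) hz]

theorem IsSmoothFamily.contDiffAt_chartDensity (hF : IsSmoothFamily (m := m) (n := n) ε F)
    (hI : IsImmersedFamily (m := m) (n := n) ε F) {t : ℝ} (ht : t ∈ Set.Ioo (-ε) ε)
    {u : EuclideanSpace ℝ (Fin n)} (hu : u ∈ (extChartAt (𝓡 n) p).target) :
    ContDiffAt ℝ ∞ (fun z : ℝ × EuclideanSpace ℝ (Fin n) =>
      chartDensity (inducedMetric (n := n) g (F z.1)) p z.2) (t, u) := by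
  simp only [chartDensity]
  exact (contDiffAt_det fun i j => hF.contDiffAt_chartGram g ht hu i j).sqrt
    (inducedGram_pos g hu (hI t ht _)).ne'

/-- For the transition rule, the derivative of one inverse chart is that of the other composed with
the transition derivative. The Gram determinants then differ by the square of its determinant, and
the square root gives the absolute value. -/
theorem IsSmoothFamily.isDensity (hF : IsSmoothFamily (m := m) (n := n) ε F)
    (hI : IsImmersedFamily (m := m) (n := n) ε F) {t : ℝ} (ht : t ∈ Set.Ioo (-ε) ε) :
    IsDensity (inducedMetric (n := n) g (F t)) where
  continuousOn := fun p u hu => by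
    have h1 := (hF.contDiffAt_chartDensity g hI ht hu).continuousAt
    have h2 : ContinuousAt (fun u : EuclideanSpace ℝ (Fin n) => (t, u)) u := by fun_prop
    exact (ContinuousAt.comp (x := u) (f := fun u => (t, u)) h1 h2).continuousWithinAt
  pos := fun p u hu => Real.sqrt_pos.2 (inducedGram_pos g hu (hI t ht _))
  trans := fun p q u hu hq => by
    have e : ∀ v, chartSymmDeriv p u v = chartSymmDeriv q
        (extChartAt (𝓡 n) q ((extChartAt (𝓡 n) p).symm u)) (transDeriv p q u v) := fun v =>
      (chartSymmDeriv_chartDeriv hq _).symm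
    set v := extChartAt (𝓡 n) q ((extChartAt (𝓡 n) p).symm u) with hv
    have hx : (extChartAt (𝓡 n) q).symm v = (extChartAt (𝓡 n) p).symm u :=
      (extChartAt (𝓡 n) q).left_inv hq
    set L := (modelDeriv (m := m) (n := n) (F t) ((extChartAt (𝓡 n) q).symm v)).comp
      (chartSymmDeriv q v)
    have h1 := gram_det_comp
      (B := (innerModel g (F t ((extChartAt (𝓡 n) q).symm v))).bilinearComp L L)
      (L := transDeriv p q u) (A := chartGram (inducedMetric (n := n) g (F t)) p u)
      (A' := chartGram (inducedMetric (n := n) g (F t)) q v)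
      (fun i j => by
        rw [chartGram_inducedMetric, e, e, ← hx]
        rfl)
      (fun i j => rfl)
    rw [chartDensity, chartDensity, h1, Real.sqrt_mul (sq_nonneg _), Real.sqrt_sq_eq_abs]

/-- The ratio of the Riemannian volumes induced at times `t` and `0`. -/
def volumeRatio (F : ℝ → S → M) (t : ℝ) (x : S) : ℝ :=
  chartDensity (inducedMetric (n := n) g (F t)) x (extChartAt (𝓡 n) x x) /
    chartDensity (inducedMetric (n := n) g (F 0)) x (extChartAt (𝓡 n) x x)

/-- The ratio is defined at each point in its own preferred chart. In another chart both densities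
pick up the same nonzero Jacobian, which cancels. -/
theorem IsSmoothFamily.volumeRatio_eq (hF : IsSmoothFamily (m := m) (n := n) ε F)
    (hI : IsImmersedFamily (m := m) (n := n) ε F) {t : ℝ} (ht : t ∈ Set.Ioo (-ε) ε)
    (h0 : (0 : ℝ) ∈ Set.Ioo (-ε) ε) {u : EuclideanSpace ℝ (Fin n)}
    (hu : u ∈ (extChartAt (𝓡 n) p).target) :
    volumeRatio (n := n) g F t ((extChartAt (𝓡 n) p).symm u)
      = chartDensity (inducedMetric (n := n) g (F t)) p u /
        chartDensity (inducedMetric (n := n) g (F 0)) p u := by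
  have hx := mem_extChartAt_source (I := 𝓡 n) ((extChartAt (𝓡 n) p).symm u)
  have hD0 := (hF.isDensity g hI h0).pos p u hu
  rw [(hF.isDensity g hI h0).trans p _ u hu hx] at hD0
  have hne := (pos_of_mul_pos_left hD0 (Real.sqrt_nonneg _)).ne'
  rw [(hF.isDensity g hI h0).trans p _ u hu hx, (hF.isDensity g hI ht).trans p _ u hu hx,
    volumeRatio, mul_div_mul_left _ _ hne]

theorem IsSmoothFamily.volumeRatio_eq' (hF : IsSmoothFamily (m := m) (n := n) ε F)
    (hI : IsImmersedFamily (m := m) (n := n) ε F) {t : ℝ} (ht : t ∈ Set.Ioo (-ε) ε)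
    (h0 : (0 : ℝ) ∈ Set.Ioo (-ε) ε) {x : S} (hx : x ∈ (extChartAt (𝓡 n) p).source) :
    volumeRatio (n := n) g F t x
      = chartDensity (inducedMetric (n := n) g (F t)) p (extChartAt (𝓡 n) p x) /
        chartDensity (inducedMetric (n := n) g (F 0)) p (extChartAt (𝓡 n) p x) := by
  have := hF.volumeRatio_eq g hI ht h0 ((extChartAt (𝓡 n) p).map_source hx)
  rwa [(extChartAt (𝓡 n) p).left_inv hx] at this

/-- The density of the weighted area of `F t` with respect to the Riemannian volume of `F 0`. -/
def weightDensity (f : M → ℝ) (F : ℝ → S → M) (t : ℝ) (x : S) : ℝ :=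
  Real.exp (-f (F t x)) * volumeRatio (n := n) g F t x

end WeightDensity

/-! ### Differentiation under the integral sign -/

section LocallySmooth

variable {n : ℕ} {S : Type*} [TopologicalSpace S] [ChartedSpace (EuclideanSpace ℝ (Fin n)) S]

variable (n) in
/-- A function of time and of the points of `S` that is smooth in charts, for times in `(-ε, ε)`. -/
def IsLocallySmooth (ε : ℝ) (ρ : ℝ → S → ℝ) : Prop :=
  ∀ t ∈ Set.Ioo (-ε) ε, ∀ p : S, ∃ φ : ℝ × EuclideanSpace ℝ (Fin n) → ℝ,
    ContDiffAt ℝ ∞ φ (t, extChartAt (𝓡 n) p p) ∧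
    ∀ᶠ z : ℝ × S in 𝓝 (t, p), ρ z.1 z.2 = φ (z.1, extChartAt (𝓡 n) p z.2)

variable {ε : ℝ} {ρ : ℝ → S → ℝ}

theorem continuousAt_timeChart (t : ℝ) (p : S) :
    ContinuousAt (fun z : ℝ × S => (z.1, extChartAt (𝓡 n) p z.2)) (t, p) := by
  refine continuousAt_fst.prodMk ?_
  exact ContinuousAt.comp (x := (t, p)) (f := Prod.snd) (continuousAt_extChartAt (I := 𝓡 n) p)
    continuousAt_snd

theorem IsLocallySmooth.continuousAt (hρ : IsLocallySmooth n ε ρ) {t : ℝ}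
    (ht : t ∈ Set.Ioo (-ε) ε) (p : S) :
    ContinuousAt (fun z : ℝ × S => ρ z.1 z.2) (t, p) := by
  obtain ⟨φ, hφ, hev⟩ := hρ t ht p
  refine ContinuousAt.congr_of_eventuallyEq ?_ hev
  exact ContinuousAt.comp (x := (t, p)) (g := φ) hφ.continuousAt (continuousAt_timeChart t p)

theorem IsLocallySmooth.continuous (hρ : IsLocallySmooth n ε ρ) {t : ℝ}
    (ht : t ∈ Set.Ioo (-ε) ε) : Continuous (ρ t) :=
  continuous_iff_continuousAt.2 fun p => by
    have h1 : ContinuousAt (fun x : S => (t, x)) p := by fun_prop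
    exact ContinuousAt.comp (x := p) (f := fun x => (t, x)) (hρ.continuousAt ht p) h1

theorem hasDerivAt_time {X : Type*} [NormedAddCommGroup X] [NormedSpace ℝ X] {φ : ℝ × X → ℝ}
    {t : ℝ} {u : X} (hφ : DifferentiableAt ℝ φ (t, u)) :
    HasDerivAt (fun s => φ (s, u)) (fderiv ℝ φ (t, u) (1, 0)) t := by
  have h1 : HasDerivAt (fun s : ℝ => (s, u)) (1, 0) t :=
    (hasDerivAt_id t).prodMk (hasDerivAt_const t u)
  exact hφ.hasFDerivAt.comp_hasDerivAt t h1

theorem IsLocallySmooth.eventually_hasDerivAt {t : ℝ} {p : S}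
    {φ : ℝ × EuclideanSpace ℝ (Fin n) → ℝ}
    (hφ : ContDiffAt ℝ ∞ φ (t, extChartAt (𝓡 n) p p))
    (hev : ∀ᶠ z : ℝ × S in 𝓝 (t, p), ρ z.1 z.2 = φ (z.1, extChartAt (𝓡 n) p z.2)) :
    ∀ᶠ z : ℝ × S in 𝓝 (t, p), HasDerivAt (fun s => ρ s z.2)
      (fderiv ℝ φ (z.1, extChartAt (𝓡 n) p z.2) (1, 0)) z.1 := by
  have h1 : ∀ᶠ w in 𝓝 (t, extChartAt (𝓡 n) p p), ContDiffAt ℝ 1 φ w :=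
    (hφ.of_le (m := 1) ENat.LEInfty.out).eventually (by simp)
  have h2 := (continuousAt_timeChart (n := n) t p).eventually h1
  filter_upwards [hev.eventually_nhds, h2] with z hz hz2
  refine (hasDerivAt_time (hz2.differentiableAt (by simp))).congr_of_eventuallyEq ?_
  have h3 : ContinuousAt (fun s : ℝ => (s, z.2)) z.1 := by fun_prop
  exact h3.eventually hz

theorem IsLocallySmooth.hasDerivAt (hρ : IsLocallySmooth n ε ρ) {t : ℝ}
    (ht : t ∈ Set.Ioo (-ε) ε) (p : S) :
    HasDerivAt (fun s => ρ s p) (deriv (fun s => ρ s p) t) t := by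
  obtain ⟨φ, hφ, hev⟩ := hρ t ht p
  exact (eventually_hasDerivAt hφ hev).self_of_nhds.differentiableAt.hasDerivAt

/-- Smoothness of infinite order loses nothing under differentiation, so the theorem on integrals
below can be applied a second time, to the time derivative. -/
theorem IsLocallySmooth.deriv (hρ : IsLocallySmooth n ε ρ) :
    IsLocallySmooth n ε fun t x => deriv (fun s => ρ s x) t := by
  intro t ht p
  obtain ⟨φ, hφ, hev⟩ := hρ t ht p
  refine ⟨fun z => fderiv ℝ φ z (1, 0), contDiffAt_fderiv_apply hφ _, ?_⟩
  filter_upwards [eventually_hasDerivAt hφ hev] with z hz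
  exact hz.deriv

theorem deriv_eq_zero_of_const_off {K : Set S} (hK : ∀ t ∈ Set.Ioo (-ε) ε, ∀ x ∉ K, ρ t x = ρ 0 x)
    {t : ℝ} (ht : t ∈ Set.Ioo (-ε) ε) {x : S} (hx : x ∉ K) : deriv (fun s => ρ s x) t = 0 := by
  have : (fun s => ρ s x) =ᶠ[𝓝 t] fun _ => ρ 0 x := by
    filter_upwards [isOpen_Ioo.mem_nhds ht] with s hs using hK s hs x hx
  rw [this.deriv_eq]
  simp

variable [T2Space S] [SecondCountableTopology S] [MeasurableSpace S] [BorelSpace S]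

/-- Differentiation under the integral sign for a family that is constant in time off a compact
set. -/
theorem IsLocallySmooth.hasDerivAt_integral (hρ : IsLocallySmooth n ε ρ) {μ : Measure S}
    [IsFiniteMeasureOnCompacts μ] {K T : Set S} (hKc : IsCompact K)
    (hK : ∀ t ∈ Set.Ioo (-ε) ε, ∀ x ∉ K, ρ t x = ρ 0 x) (hT : MeasurableSet T)
    (hint : IntegrableOn (ρ 0) T μ) {t : ℝ} (ht : t ∈ Set.Ioo (-ε) ε) :
    IntegrableOn (fun x => _root_.deriv (fun s => ρ s x) t) T μ ∧
      HasDerivAt (fun s => ∫ x in T, ρ s x ∂μ)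
        (∫ x in T, _root_.deriv (fun s => ρ s x) t ∂μ) t := by
  have hKm : MeasurableSet K := hKc.measurableSet
  -- On a compact time interval times `K` the continuous time derivative is bounded by some C, and
  -- off `K` it vanishes. The dominating function is therefore C times the indicator of `K`.
  obtain ⟨δ, hδ, hsub⟩ := Metric.nhds_basis_closedBall.mem_iff.1 (isOpen_Ioo.mem_nhds ht)
  have hcont : ContinuousOn (fun z : ℝ × S => _root_.deriv (fun s => ρ s z.2) z.1)
      (Metric.closedBall t δ ×ˢ K) := fun z hz =>
    (hρ.deriv.continuousAt (hsub hz.1) z.2).continuousWithinAt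
  obtain ⟨C, hC⟩ := ((isCompact_closedBall t δ).prod hKc).exists_bound_of_continuousOn hcont
  -- On T ∩ K the function is continuous with compact carrier; on T \ K it equals its initial value,
  -- integrable by assumption.
  have hintt : IntegrableOn (ρ t) T μ := by
    have h1 : IntegrableOn (ρ t) (T ∩ K) μ :=
      ((hρ.continuous ht).continuousOn.integrableOn_compact hKc).mono_set Set.inter_subset_right
    have h2 : IntegrableOn (ρ t) (T \ K) μ :=
      (hint.mono_set Set.sdiff_subset).congr_fun (fun x hx => (hK t ht x hx.2).symm)
        (hT.diff hKm)
    have h3 := h1.union h2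
    rwa [Set.inter_union_sdiff] at h3
  refine hasDerivAt_integral_of_dominated_loc_of_deriv_le (μ := μ.restrict T)
    (bound := K.indicator fun _ => C)
    (F' := fun s x => _root_.deriv (fun r => ρ r x) s) (Metric.ball_mem_nhds t hδ) ?_ hintt ?_ ?_ ?_ ?_
  · filter_upwards [isOpen_Ioo.mem_nhds ht] with s hs
    exact (hρ.continuous hs).aestronglyMeasurable
  · exact (hρ.deriv.continuous ht).aestronglyMeasurable
  · refine Filter.Eventually.of_forall fun x s hs => ?_
    have hs' := Metric.ball_subset_closedBall hs
    by_cases hx : x ∈ K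
    · rw [Set.indicator_of_mem hx]
      exact hC (s, x) ⟨hs', hx⟩
    · rw [Set.indicator_of_notMem hx, deriv_eq_zero_of_const_off hK (hsub hs') hx, norm_zero]
  · refine (IntegrableOn.integrable_indicator ?_ hKm)
    exact integrableOn_const (hs := ((Measure.restrict_apply_le _ _).trans_lt
      hKc.measure_lt_top).ne)
  · exact Filter.Eventually.of_forall fun x s hs =>
      hρ.hasDerivAt (hsub (Metric.ball_subset_closedBall hs)) x

end LocallySmooth

/-! ### Derivatives of the weighted area -/

section WeightedArea

variable {m n : ℕ} {M : Type*} [TopologicalSpace M]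
  [ChartedSpace (EuclideanSpace ℝ (Fin m)) M] [IsManifold (𝓡 m) ∞ M]
  {S : Type*} [TopologicalSpace S] [ChartedSpace (EuclideanSpace ℝ (Fin n)) S]
  [IsManifold (𝓡 n) ∞ S]
  (g : Bundle.ContMDiffRiemannianMetric (𝓡 m) ∞ (EuclideanSpace ℝ (Fin m))
      (fun x : M => TangentSpace (𝓡 m) x))
  {ε : ℝ} {F : ℝ → S → M} {f : M → ℝ}

theorem IsSmoothFamily.isLocallySmooth_exp (hF : IsSmoothFamily (m := m) (n := n) ε F)
    (hf : ContMDiff (𝓡 m) 𝓘(ℝ, ℝ) ∞ f) :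
    IsLocallySmooth n ε fun t x => Real.exp (-f (F t x)) := by
  intro t ht p
  refine ⟨fun z => Real.exp (-f (F z.1 ((extChartAt (𝓡 n) p).symm z.2))), ?_, ?_⟩
  · rw [← contMDiffAt_iff_contDiffAt]
    have h1 : ContMDiffAt 𝓘(ℝ, ℝ × EuclideanSpace ℝ (Fin n)) (𝓘(ℝ, ℝ).prod (𝓡 n)) ∞
        (fun z : ℝ × EuclideanSpace ℝ (Fin n) => (z.1, (extChartAt (𝓡 n) p).symm z.2))
        (t, extChartAt (𝓡 n) p p) :=
      (contMDiffOn_chartPair p).contMDiffAt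
        ((isOpen_univ.prod (isOpen_extChartAt_target p)).mem_nhds
          ⟨Set.mem_univ _, mem_extChartAt_target p⟩)
    have h2 := (hf (F t ((extChartAt (𝓡 n) p).symm (extChartAt (𝓡 n) p p)))).comp
      (t, (extChartAt (𝓡 n) p).symm (extChartAt (𝓡 n) p p)) (hF.contMDiffAt ht _)
    have h3 := h2.comp (t, extChartAt (𝓡 n) p p) h1
    exact (Real.contDiff_exp.comp contDiff_neg).comp_contMDiffAt h3
  · have h1 : ∀ᶠ z : ℝ × S in 𝓝 (t, p), z.2 ∈ (extChartAt (𝓡 n) p).source :=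
      continuousAt_snd.eventually_mem (extChartAt_source_mem_nhds p)
    filter_upwards [h1] with z hz
    simp only [(extChartAt (𝓡 n) p).left_inv hz]

theorem IsSmoothFamily.isLocallySmooth_volumeRatio (hF : IsSmoothFamily (m := m) (n := n) ε F)
    (hI : IsImmersedFamily (m := m) (n := n) ε F) (h0 : (0 : ℝ) ∈ Set.Ioo (-ε) ε) :
    IsLocallySmooth n ε (volumeRatio (n := n) g F) := by
  intro t ht p
  have hu := mem_extChartAt_target (I := 𝓡 n) p
  refine ⟨fun z => chartDensity (inducedMetric (n := n) g (F z.1)) p z.2 /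
    chartDensity (inducedMetric (n := n) g (F 0)) p z.2, ?_, ?_⟩
  · refine (hF.contDiffAt_chartDensity g hI ht hu).div ?_ ((hF.isDensity g hI h0).pos p _ hu).ne'
    exact ContDiffAt.comp (t, extChartAt (𝓡 n) p p)
      (f := fun z : ℝ × EuclideanSpace ℝ (Fin n) => ((0 : ℝ), z.2))
      (hF.contDiffAt_chartDensity g hI h0 hu) (contDiffAt_const.prodMk contDiffAt_snd)
  · have h1 : ∀ᶠ z : ℝ × S in 𝓝 (t, p), z.2 ∈ (extChartAt (𝓡 n) p).source :=
      continuousAt_snd.eventually_mem (extChartAt_source_mem_nhds p)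
    have h2 : ∀ᶠ z : ℝ × S in 𝓝 (t, p), z.1 ∈ Set.Ioo (-ε) ε :=
      continuousAt_fst.eventually_mem (isOpen_Ioo.mem_nhds ht)
    filter_upwards [h1, h2] with z hz hz'
    exact hF.volumeRatio_eq' g hI hz' h0 hz

theorem IsLocallySmooth.mul {ρ σ : ℝ → S → ℝ} (hρ : IsLocallySmooth n ε ρ)
    (hσ : IsLocallySmooth n ε σ) : IsLocallySmooth n ε fun t x => ρ t x * σ t x := by
  intro t ht p
  obtain ⟨φ, hφ, hev⟩ := hρ t ht p
  obtain ⟨ψ, hψ, hev'⟩ := hσ t ht p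
  refine ⟨fun z => φ z * ψ z, hφ.mul hψ, ?_⟩
  filter_upwards [hev, hev'] with z h1 h2
  rw [h1, h2]

theorem IsSmoothFamily.isLocallySmooth_weightDensity (hF : IsSmoothFamily (m := m) (n := n) ε F)
    (hI : IsImmersedFamily (m := m) (n := n) ε F) (h0 : (0 : ℝ) ∈ Set.Ioo (-ε) ε)
    (hf : ContMDiff (𝓡 m) 𝓘(ℝ, ℝ) ∞ f) :
    IsLocallySmooth n ε (weightDensity (n := n) g f F) :=
  (hF.isLocallySmooth_exp hf).mul (hF.isLocallySmooth_volumeRatio g hI h0)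

theorem IsSmoothFamily.weightDensity_zero (hF : IsSmoothFamily (m := m) (n := n) ε F)
    (hI : IsImmersedFamily (m := m) (n := n) ε F) (h0 : (0 : ℝ) ∈ Set.Ioo (-ε) ε) (x : S) :
    weightDensity (n := n) g f F 0 x = Real.exp (-f (F 0 x)) := by
  rw [weightDensity, volumeRatio, div_self, mul_one]
  exact ((hF.isDensity g hI h0).pos x _ (mem_extChartAt_target x)).ne'

theorem IsVariation.isSmoothFamily {ι : S → M} {K : Set S}
    (hV : IsVariation (m := m) (n := n) ι ε F K) : IsSmoothFamily (m := m) (n := n) ε F := hV.smooth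

theorem IsVariation.isImmersedFamily {ι : S → M} {K : Set S}
    (hV : IsVariation (m := m) (n := n) ι ε F K) : IsImmersedFamily (m := m) (n := n) ε F :=
  hV.immersion

theorem IsVariation.zero_mem {ι : S → M} {K : Set S}
    (hV : IsVariation (m := m) (n := n) ι ε F K) : (0 : ℝ) ∈ Set.Ioo (-ε) ε :=
  ⟨by linarith [hV.pos], hV.pos⟩

/-- The density involves the derivative of `F t`, so agreement at the point alone would not do. As
`K` is closed, `F t` and `F 0` agree on a neighbourhood of any point outside it. -/
theorem IsVariation.weightDensity_const [T2Space S] {ι : S → M} {K : Set S}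
    (hV : IsVariation (m := m) (n := n) ι ε F K) {t : ℝ} (ht : t ∈ Set.Ioo (-ε) ε) {x : S}
    (hx : x ∉ K) : weightDensity (n := n) g f F t x = weightDensity (n := n) g f F 0 x := by
  have hev : F t =ᶠ[𝓝 x] F 0 := by
    filter_upwards [hV.isCompact.isClosed.isOpen_compl.mem_nhds hx] with y hy
    rw [hV.const t ht y hy, hV.start]
  have h1 : modelDeriv (m := m) (n := n) (F t) x = modelDeriv (F 0) x := hev.mfderiv_eq
  have h2 : chartGram (inducedMetric (n := n) g (F t)) x (extChartAt (𝓡 n) x x)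
      = chartGram (inducedMetric (n := n) g (F 0)) x (extChartAt (𝓡 n) x x) := by
    ext i j
    rw [chartGram_inducedMetric, chartGram_inducedMetric, extChartAt_to_inv, h1, hev.eq_of_nhds]
  rw [weightDensity, weightDensity, volumeRatio, volumeRatio, chartDensity, chartDensity, h2,
    hev.eq_of_nhds]

variable [SecondCountableTopology S] [MeasurableSpace S] [BorelSpace S]

/-- The volume at time `t` has density `volumeRatio` with respect to the volume at time 0, so the
area is an integral against a measure that no longer moves. -/
theorem IsSmoothFamily.weightedArea_eq (hF : IsSmoothFamily (m := m) (n := n) ε F)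
    (hI : IsImmersedFamily (m := m) (n := n) ε F) (h0 : (0 : ℝ) ∈ Set.Ioo (-ε) ε) {t : ℝ}
    (ht : t ∈ Set.Ioo (-ε) ε) {T : Set S} (hT : MeasurableSet T) :
    weightedArea (n := n) g f (F t) T = ∫ x in T, weightDensity (n := n) g f F t x
      ∂(riemannianVolume (inducedMetric (n := n) g (F 0))) := by
  have hJ : Measurable (volumeRatio (n := n) g F t) :=
    ((hF.isLocallySmooth_volumeRatio g hI h0).continuous ht).measurable
  have hJ0 : ∀ x, 0 ≤ volumeRatio (n := n) g F t x := fun x =>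
    div_nonneg (Real.sqrt_nonneg _) (Real.sqrt_nonneg _)
  rw [weightedArea, (hF.isDensity g hI h0).riemannianVolume_eq_withDensity (hF.isDensity g hI ht) hJ
    fun p u hu => ?_, setIntegral_withDensity_eq_setIntegral_toReal_smul hJ.ennreal_ofReal
      (Filter.Eventually.of_forall fun _ => ENNReal.ofReal_lt_top) _ hT]
  · refine integral_congr_ae (Filter.Eventually.of_forall fun x => ?_)
    simp only [weightDensity, ENNReal.toReal_ofReal (hJ0 x), smul_eq_mul]
    ring
  · rw [hF.volumeRatio_eq g hI ht h0 hu,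
      mul_div_cancel₀ _ ((hF.isDensity g hI h0).pos p u hu).ne']

variable [T2Space S]

/-- First and second derivatives of the weighted area under a compactly supported variation. -/
theorem IsVariation.weightedArea_deriv {ι : S → M} {K : Set S}
    (hV : IsVariation (m := m) (n := n) ι ε F K) (hf : ContMDiff (𝓡 m) 𝓘(ℝ, ℝ) ∞ f) {T : Set S}
    (hT : MeasurableSet T)
    (hint : IntegrableOn (fun x => Real.exp (-f (F 0 x))) T
      (riemannianVolume (inducedMetric (n := n) g (F 0)))) {t : ℝ} (ht : t ∈ Set.Ioo (-ε) ε) :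
    HasDerivAt (fun s => weightedArea (n := n) g f (F s) T)
      (∫ x in T, deriv (fun s => weightDensity (n := n) g f F s x) t
        ∂(riemannianVolume (inducedMetric (n := n) g (F 0)))) t := by
  have hF := hV.isSmoothFamily
  have hI := hV.isImmersedFamily
  have h0 := hV.zero_mem
  have hloc := (hF.isDensity g hI h0).isLocallyFiniteMeasure
  have hρ := hF.isLocallySmooth_weightDensity g hI h0 hf
  have h1 := (hρ.hasDerivAt_integral (μ := riemannianVolume (inducedMetric (n := n) g (F 0)))
    hV.isCompact (fun t ht x hx => hV.weightDensity_const g ht hx) hT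
    (by simpa only [funext fun x => hF.weightDensity_zero (f := f) g hI h0 x] using hint) ht).2
  refine h1.congr_of_eventuallyEq ?_
  filter_upwards [isOpen_Ioo.mem_nhds ht] with s hs
  exact hF.weightedArea_eq g hI h0 hs hT

theorem IsVariation.weightedArea_deriv_deriv {ι : S → M} {K : Set S}
    (hV : IsVariation (m := m) (n := n) ι ε F K) (hf : ContMDiff (𝓡 m) 𝓘(ℝ, ℝ) ∞ f) :
    Integrable (fun x => deriv (deriv fun s => weightDensity (n := n) g f F s x) 0)
      (riemannianVolume (inducedMetric (n := n) g (F 0))) ∧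
    ∀ T : Set S, MeasurableSet T → K ⊆ T → IntegrableOn (fun x => Real.exp (-f (F 0 x))) T
      (riemannianVolume (inducedMetric (n := n) g (F 0))) →
      HasDerivAt (deriv fun s => weightedArea (n := n) g f (F s) T)
        (∫ x, deriv (deriv fun s => weightDensity (n := n) g f F s x) 0
          ∂(riemannianVolume (inducedMetric (n := n) g (F 0)))) 0 := by
  have hF := hV.isSmoothFamily
  have hI := hV.isImmersedFamily
  have h0 := hV.zero_mem
  have hloc := (hF.isDensity g hI h0).isLocallyFiniteMeasure
  have hρ := hF.isLocallySmooth_weightDensity g hI h0 hf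
  have hoff : ∀ t ∈ Set.Ioo (-ε) ε, ∀ x ∉ K,
      deriv (fun s => weightDensity (n := n) g f F s x) t = 0 := fun t ht x hx =>
    deriv_eq_zero_of_const_off (ρ := weightDensity (n := n) g f F) (K := K)
      (fun t ht x hx => hV.weightDensity_const g ht hx) ht hx
  -- The time derivative is zero off `K`, in particular constant in time there, as differentiating
  -- the integral once more requires.
  have hoff' : ∀ t ∈ Set.Ioo (-ε) ε, ∀ x ∉ K,
      deriv (fun s => weightDensity (n := n) g f F s x) t
        = deriv (fun s => weightDensity (n := n) g f F s x) 0 := fun t ht x hx => by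
    rw [hoff t ht x hx, hoff 0 h0 x hx]
  have hint : Integrable (fun x => deriv (fun s => weightDensity (n := n) g f F s x) 0)
      (riemannianVolume (inducedMetric (n := n) g (F 0))) := by
    rw [← integrableOn_iff_integrable_of_support_subset (s := K)]
    · exact (hρ.deriv.continuous h0).continuousOn.integrableOn_compact hV.isCompact
    · intro x hx
      by_contra hxK
      exact hx (hoff 0 h0 x hxK)
  have key := fun (T : Set S) (hT : MeasurableSet T) =>
    hρ.deriv.hasDerivAt_integral (μ := riemannianVolume (inducedMetric (n := n) g (F 0)))
      hV.isCompact hoff' hT hint.integrableOn h0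
  refine ⟨by simpa using (key Set.univ MeasurableSet.univ).1, fun T hT hKT hTint => ?_⟩
  have h1 := (key T hT).2
  -- The integrand vanishes off `K`, and K ⊆ T, so the integral over `T` is the integral over all of
  -- `S`.
  rw [setIntegral_eq_integral_of_forall_compl_eq_zero] at h1
  · refine h1.congr_of_eventuallyEq ?_
    filter_upwards [isOpen_Ioo.mem_nhds h0] with s hs
    exact (hV.weightedArea_deriv g hf hT hTint hs).deriv
  · intro x hx
    exact deriv_eq_zero_of_const_off hoff' h0 fun h => hx (hKT h)

end WeightedArea

end WeightedMinimal

namespace WeightedMinimal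

/-! ### Restriction to a fixed time -/

section Slices

variable {X E : Type*} [NormedAddCommGroup X] [NormedSpace ℝ X] [NormedAddCommGroup E]
  [NormedSpace ℝ E] {Γ : E → E →L[ℝ] E →L[ℝ] E} {F Y : ℝ × X → E} {t : ℝ} {u : X}

theorem covD_slice (hF : DifferentiableAt ℝ F (t, u)) (hY : DifferentiableAt ℝ Y (t, u)) (v : X) :
    covD Γ (fun u => F (t, u)) (fun u => Y (t, u)) u v = covD Γ F Y (t, u) (0, v) := by
  rw [covD, covD, fderiv_slice hF, fderiv_slice hY]

theorem covD_congr {P : Type*} [NormedAddCommGroup P] [NormedSpace ℝ P] {F Y Y' : P → E} {p : P}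
    (h : Y =ᶠ[𝓝 p] Y') (v : P) : covD Γ F Y p v = covD Γ F Y' p v := by
  rw [covD, covD, h.fderiv_eq, h.eq_of_nhds]

theorem eventually_slice {Q : ℝ × X → Prop} (h : ∀ᶠ z in 𝓝 (t, u), Q z) :
    ∀ᶠ v in 𝓝 u, Q (t, v) := by
  have h3 : ContinuousAt (fun v : X => (t, v)) u := by fun_prop
  exact h3.eventually h

/-- The critical equation involves a single map `F 0`, while the variation formulas differentiate on
time × space. This identifies the covariant second derivatives of the slice with the spatial ones of
the family. -/
theorem covD_fderiv_slice (hF : ContDiffAt ℝ ∞ F (t, u)) (v w : X) :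
    covD Γ (fun u => F (t, u)) (fun u' => fderiv ℝ (fun u => F (t, u)) u' w) u v
      = covD Γ F (fun z => fderiv ℝ F z (0, w)) (t, u) (0, v) := by
  rw [← covD_slice (hF.differentiableAt (by simp))
    ((contDiffAt_fderiv_apply hF _).differentiableAt (by simp))]
  refine covD_congr ?_ v
  have h1 : ∀ᶠ z in 𝓝 (t, u), ContDiffAt ℝ 1 F z :=
    (hF.of_le (m := 1) ENat.LEInfty.out).eventually (by simp)
  filter_upwards [eventually_slice h1] with u' hu'
  exact fderiv_slice (hu'.differentiableAt (by simp)) w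

end Slices

/-! ### A single immersion in charts, and the Gauss formula -/

section MapRep

variable {m n : ℕ} {M : Type*} [TopologicalSpace M]
  [ChartedSpace (EuclideanSpace ℝ (Fin m)) M] [IsManifold (𝓡 m) ∞ M]
  {S : Type*} [TopologicalSpace S] [ChartedSpace (EuclideanSpace ℝ (Fin n)) S]
  [IsManifold (𝓡 n) ∞ S]
  (g : Bundle.ContMDiffRiemannianMetric (𝓡 m) ∞ (EuclideanSpace ℝ (Fin m))
      (fun x : M => TangentSpace (𝓡 m) x))

/-- The map `F` in the preferred charts at `p` and `q`. -/
def mapRep (F : S → M) (p : S) (q : M) (u : EuclideanSpace ℝ (Fin n)) :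
    EuclideanSpace ℝ (Fin m) :=
  extChartAt (𝓡 m) q (F ((extChartAt (𝓡 n) p).symm u))

variable {F : S → M} {p : S} {q : M} {u : EuclideanSpace ℝ (Fin n)}

theorem isSmoothFamily_const (hF : ContMDiff (𝓡 n) (𝓡 m) ∞ F) :
    IsSmoothFamily (m := m) (n := n) 1 fun _ => F :=
  (hF.comp contMDiff_snd).contMDiffOn

theorem mem_localDomain_const (hu : u ∈ (extChartAt (𝓡 n) p).target)
    (hq : F ((extChartAt (𝓡 n) p).symm u) ∈ (extChartAt (𝓡 m) q).source) :
    ((0 : ℝ), u) ∈ localDomain (m := m) (n := n) 1 (fun _ => F) p q :=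
  ⟨by simp, hu, hq⟩

theorem contDiffAt_mapRep (hF : ContMDiff (𝓡 n) (𝓡 m) ∞ F)
    (hu : u ∈ (extChartAt (𝓡 n) p).target)
    (hq : F ((extChartAt (𝓡 n) p).symm u) ∈ (extChartAt (𝓡 m) q).source) :
    ContDiffAt ℝ ∞ (mapRep (m := m) (n := n) F p q) u := by
  have h1 := (isSmoothFamily_const hF).contDiffAt_localRep (mem_localDomain_const hu hq)
  exact ContDiffAt.comp u (f := fun u => ((0 : ℝ), u)) h1 (contDiffAt_const.prodMk contDiffAt_id)

theorem fderiv_mapRep (hF : ContMDiff (𝓡 n) (𝓡 m) ∞ F)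
    (hu : u ∈ (extChartAt (𝓡 n) p).target)
    (hq : F ((extChartAt (𝓡 n) p).symm u) ∈ (extChartAt (𝓡 m) q).source)
    (v : EuclideanSpace ℝ (Fin n)) :
    fderiv ℝ (mapRep (m := m) (n := n) F p q) u v
      = chartDeriv q (F ((extChartAt (𝓡 n) p).symm u))
          (modelDeriv F ((extChartAt (𝓡 n) p).symm u) (chartSymmDeriv p u v)) := by
  have hz := mem_localDomain_const hu hq
  rw [← (isSmoothFamily_const hF).fderiv_localRep hz,
    ← fderiv_slice (((isSmoothFamily_const hF).contDiffAt_localRep hz).differentiableAt (by simp))]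
  rfl

theorem eventually_mem_chart (hF : ContMDiff (𝓡 n) (𝓡 m) ∞ F)
    (hu : u ∈ (extChartAt (𝓡 n) p).target)
    (hq : F ((extChartAt (𝓡 n) p).symm u) ∈ (extChartAt (𝓡 m) q).source) :
    ∀ᶠ u' in 𝓝 u, u' ∈ (extChartAt (𝓡 n) p).target ∧
      F ((extChartAt (𝓡 n) p).symm u') ∈ (extChartAt (𝓡 m) q).source := by
  have h := ((isSmoothFamily_const hF).isOpen_localDomain p q).mem_nhds
    (mem_localDomain_const hu hq)
  filter_upwards [eventually_slice h] with u' hu'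
  exact hu'.2

theorem chartGram_eq_mapRep (hF : ContMDiff (𝓡 n) (𝓡 m) ∞ F)
    (hu : u ∈ (extChartAt (𝓡 n) p).target)
    (hq : F ((extChartAt (𝓡 n) p).symm u) ∈ (extChartAt (𝓡 m) q).source) (i j : Fin n) :
    chartGram (inducedMetric (n := n) g F) p u i j
      = chartMetric g q (mapRep F p q u) (fderiv ℝ (mapRep F p q) u (stdVec i))
          (fderiv ℝ (mapRep F p q) u (stdVec j)) := by
  rw [fderiv_mapRep hF hu hq, fderiv_mapRep hF hu hq, chartGram_inducedMetric]
  exact (chartMetric_chartDeriv g hq _ _).symm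

theorem contDiffAt_chartGram_induced (hF : ContMDiff (𝓡 n) (𝓡 m) ∞ F)
    (hu : u ∈ (extChartAt (𝓡 n) p).target) (i j : Fin n) :
    ContDiffAt ℝ ∞ (fun u => chartGram (inducedMetric (n := n) g F) p u i j) u :=
  ContDiffAt.comp u (f := fun u => ((0 : ℝ), u))
    ((isSmoothFamily_const hF).contDiffAt_chartGram g (t := 0) (by simp) hu i j)
    (contDiffAt_const.prodMk contDiffAt_id)

/-- The Gauss formula: the induced connection is the tangential part of the ambient one. -/
theorem metric_chartConn_induced (hF : ContMDiff (𝓡 n) (𝓡 m) ∞ F)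
    (hu : u ∈ (extChartAt (𝓡 n) p).target)
    (hq : F ((extChartAt (𝓡 n) p).symm u) ∈ (extChartAt (𝓡 m) q).source)
    (hI : Function.Injective (mfderiv (𝓡 n) (𝓡 m) F ((extChartAt (𝓡 n) p).symm u)))
    (v w τ : EuclideanSpace ℝ (Fin n)) :
    chartMetric g q (mapRep F p q u)
        (fderiv ℝ (mapRep F p q) u (chartConn (inducedMetric (n := n) g F) p u v w))
        (fderiv ℝ (mapRep F p q) u τ)
      = chartMetric g q (mapRep F p q u)
          (covD (chartConn (metricFn g) q) (mapRep F p q)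
            (fun u => fderiv ℝ (mapRep F p q) u w) u v) (fderiv ℝ (mapRep F p q) u τ) := by
  set φ := mapRep (m := m) (n := n) F p q with hφ
  set G := chartMetric g q (φ u) with hG
  set L := fderiv ℝ φ u with hL
  set K := chartConn (inducedMetric (n := n) g F) p u
  have hLC := isLeviCivitaOn_chart g q
  have hy : φ u ∈ (extChartAt (𝓡 m) q).target := (extChartAt (𝓡 m) q).map_source hq
  have hφc := contDiffAt_mapRep hF hu hq
  have hd : DifferentiableAt ℝ (fderiv ℝ φ) u :=
    (hφc.fderiv_right (m := ∞) (by simp)).differentiableAt (by simp)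
  -- The covariant Hessian ∇_v ∂_w φ of the chart representation, as a bilinear map.
  let N : EuclideanSpace ℝ (Fin n) →L[ℝ] EuclideanSpace ℝ (Fin n) →L[ℝ] EuclideanSpace ℝ (Fin m) :=
    fderiv ℝ (fderiv ℝ φ) u + (chartConn (metricFn g) q (φ u)).bilinearComp L L
  have hN : ∀ v w, covD (chartConn (metricFn g) q) φ (fun u => fderiv ℝ φ u w) u v = N v w := by
    intro v w
    rw [covD, fderiv_clm_apply hd (by fun_prop)]
    simp [N, hL]
  have hgram : ∀ᶠ u' in 𝓝 u, ∀ i j, chartGram (inducedMetric (n := n) g F) p u' i j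
      = chartMetric g q (φ u') (fderiv ℝ φ u' (stdVec i)) (fderiv ℝ φ u' (stdVec j)) := by
    filter_upwards [eventually_mem_chart hF hu hq] with u' hu' i j
    exact chartGram_eq_mapRep g hF hu'.1 hu'.2 i j
  have hder : ∀ l i j, chartGramDeriv (inducedMetric (n := n) g F) p u l i j
      = G (N (stdVec l) (stdVec i)) (L (stdVec j)) + G (L (stdVec i)) (N (stdVec l) (stdVec j)) := by
    intro l i j
    have hev : (fun u' => chartGram (inducedMetric (n := n) g F) p u' i j) =ᶠ[𝓝 u]
        fun u' => chartMetric g q (φ u') (fderiv ℝ φ u' (stdVec i)) (fderiv ℝ φ u' (stdVec j)) := by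
      filter_upwards [hgram] with u' hu' using hu' i j
    rw [chartGramDeriv, hev.fderiv_eq, hLC.fderiv_metric hy (hφc.differentiableAt (by simp))
      ((contDiffAt_fderiv_apply hφc _).differentiableAt (by simp))
      ((contDiffAt_fderiv_apply hφc _).differentiableAt (by simp)), hN, hN]
  have hNsymm : ∀ v w, N v w = N w v := fun v w => by
    rw [← hN, ← hN]
    exact hLC.covD_fderiv_comm hy (hφc.of_le ENat.LEInfty.out) v w
  have hGs : ∀ v w, G v w = G w v := chartMetric_symm g q _
  have hlow := metric_chartConn_stdVec (h := inducedMetric (n := n) g F) (q := p) (u := u)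
    (B := G.bilinearComp L L) (fun i j => hgram.self_of_nhds i j)
    (chartGram_inducedMetric_symm g F p) (inducedGram_pos g hu hI).ne'
  -- Lowered with the induced metric, the left side is its Koszul expression. Its Gram derivatives
  -- are sums of terms ⟨N, L⟩, and by the symmetry of N all cancel but the one wanted.
  have hbasis : ∀ i j l, G (L (K (stdVec i) (stdVec j))) (L (stdVec l))
      = G (N (stdVec i) (stdVec j)) (L (stdVec l)) := by
    intro i j l
    refine (hlow i j l).trans ?_
    rw [hder, hder, hder, hNsymm (stdVec j) (stdVec i), hNsymm (stdVec l) (stdVec i),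
      hNsymm (stdVec l) (stdVec j), hGs (L (stdVec j)), hGs (L (stdVec i))]
    ring
  rw [hN]
  have h1 : ∀ i j, G (L (K (stdVec i) (stdVec j))) (L τ) = G (N (stdVec i) (stdVec j)) (L τ) := by
    intro i j
    have := clm_ext_stdVec (A := (G (L (K (stdVec i) (stdVec j)))).comp L)
      (B := (G (N (stdVec i) (stdVec j))).comp L) fun l => hbasis i j l
    exact DFunLike.congr_fun this τ
  have h2 : ∀ i, G (L (K (stdVec i) w)) (L τ) = G (N (stdVec i) w) (L τ) := by
    intro i
    have := clm_ext_stdVec (A := (G.flip (L τ)).comp (L.comp (K (stdVec i))))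
      (B := (G.flip (L τ)).comp (N (stdVec i))) fun j => h1 i j
    exact DFunLike.congr_fun this w
  have := clm_ext_stdVec (A := (G.flip (L τ)).comp (L.comp (K.flip w)))
    (B := (G.flip (L τ)).comp (N.flip w)) fun i => h2 i
  exact DFunLike.congr_fun this v

/-- The function `f` in the preferred chart at `q`. -/
def chartFun (f : M → ℝ) (q : M) : EuclideanSpace ℝ (Fin m) → ℝ := f ∘ (extChartAt (𝓡 m) q).symm

theorem contDiffOn_chartFun {f : M → ℝ} (hf : ContMDiff (𝓡 m) 𝓘(ℝ, ℝ) ∞ f) (q : M) :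
    ContDiffOn ℝ ∞ (chartFun (m := m) f q) (extChartAt (𝓡 m) q).target := by
  rw [← contMDiffOn_iff_contDiffOn]
  exact hf.comp_contMDiffOn (contMDiffOn_extChartAt_symm q)

theorem chartFun_mapRep {f : M → ℝ}
    (hq : F ((extChartAt (𝓡 n) p).symm u) ∈ (extChartAt (𝓡 m) q).source) :
    chartFun (m := m) f q (mapRep F p q u) = f (F ((extChartAt (𝓡 n) p).symm u)) := by
  rw [chartFun, mapRep, Function.comp_apply, (extChartAt (𝓡 m) q).left_inv hq]

/-- The first variation of the weighted area in the direction `w`, in the preferred charts at `p`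
and `q`, where `w` is normal. -/
def firstVariationForm (f : M → ℝ) (F : S → M) (p : S) (q : M) (u : EuclideanSpace ℝ (Fin n))
    (w : EuclideanSpace ℝ (Fin m)) : ℝ :=
  fderiv ℝ (chartFun f q) (mapRep F p q u) w
    + ∑ i, ∑ j, (chartGram (inducedMetric (n := n) g F) p u)⁻¹ i j *
      chartMetric g q (mapRep F p q u) w (covD (chartConn (metricFn g) q) (mapRep F p q)
        (fun u => fderiv ℝ (mapRep F p q) u (stdVec j)) u (stdVec i))

/-- In an orthonormal family the trace in `firstVariationForm` is a plain sum. -/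
theorem firstVariationForm_eq_sum {f : M → ℝ} (hF : ContMDiff (𝓡 n) (𝓡 m) ∞ F)
    (hu : u ∈ (extChartAt (𝓡 n) p).target)
    (hq : F ((extChartAt (𝓡 n) p).symm u) ∈ (extChartAt (𝓡 m) q).source)
    {e : Fin n → EuclideanSpace ℝ (Fin n)}
    (he : ∀ i j, chartMetric g q (mapRep F p q u) (fderiv ℝ (mapRep F p q) u (e i))
      (fderiv ℝ (mapRep F p q) u (e j)) = if i = j then 1 else 0)
    (w : EuclideanSpace ℝ (Fin m)) :
    firstVariationForm g f F p q u w = fderiv ℝ (chartFun f q) (mapRep F p q u) w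
    + ∑ i, chartMetric g q (mapRep F p q u) w (covD (chartConn (metricFn g) q) (mapRep F p q)
        (fun u => fderiv ℝ (mapRep F p q) u (e i)) u (e i)) := by
  rw [firstVariationForm]
  congr 1
  set φ := mapRep (m := m) (n := n) F p q with hφ
  set G := chartMetric g q (φ u) with hG
  set L := fderiv ℝ φ u with hL
  have hφc := contDiffAt_mapRep hF hu hq
  have hd : DifferentiableAt ℝ (fderiv ℝ φ) u :=
    (hφc.fderiv_right (m := ∞) (by simp)).differentiableAt (by simp)
  let C : EuclideanSpace ℝ (Fin n) →L[ℝ] EuclideanSpace ℝ (Fin n) →L[ℝ] ℝ :=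
    (ContinuousLinearMap.compL ℝ _ _ _ (G w)).comp
      (fderiv ℝ (fderiv ℝ φ) u + (chartConn (metricFn g) q (φ u)).bilinearComp L L)
  have hC : ∀ v v', G w (covD (chartConn (metricFn g) q) φ (fun u => fderiv ℝ φ u v') u v)
      = C v v' := by
    intro v v'
    rw [covD, fderiv_clm_apply hd (by fun_prop)]
    simp [C, hL]
  simp only [hC]
  exact sum_inv_gram_eq_sum_orthonormal (B := G.bilinearComp L L)
    (fun i j => chartGram_eq_mapRep g hF hu hq i j) he

end MapRep

/-! ### The first variation on the manifold -/

section FirstVariation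

variable {m n : ℕ} {M : Type*} [TopologicalSpace M]
  [ChartedSpace (EuclideanSpace ℝ (Fin m)) M] [IsManifold (𝓡 m) ∞ M]
  {S : Type*} [TopologicalSpace S] [ChartedSpace (EuclideanSpace ℝ (Fin n)) S]
  [IsManifold (𝓡 n) ∞ S]
  (g : Bundle.ContMDiffRiemannianMetric (𝓡 m) ∞ (EuclideanSpace ℝ (Fin m))
      (fun x : M => TangentSpace (𝓡 m) x))
  {ε : ℝ} {F : ℝ → S → M} {p : S} {q : M} {f : M → ℝ} {u : EuclideanSpace ℝ (Fin n)}

theorem IsSmoothFamily.weightDensity_eq (hF : IsSmoothFamily (m := m) (n := n) ε F)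
    (hI : IsImmersedFamily (m := m) (n := n) ε F) (h0 : (0 : ℝ) ∈ Set.Ioo (-ε) ε) {t : ℝ}
    (hz : (t, u) ∈ localDomain (m := m) (n := n) ε F p q) :
    weightDensity (n := n) g f F t ((extChartAt (𝓡 n) p).symm u)
      = Real.exp (-chartFun (m := m) f q (localRep (m := m) (n := n) F p q (t, u)))
        * √(gramAlong (chartMetric g q) (localRep (m := m) (n := n) F p q) spaceVec (t, u)).det
        / chartDensity (inducedMetric (n := n) g (F 0)) p u := by
  have h1 : chartFun (m := m) f q (localRep (m := m) (n := n) F p q (t, u))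
      = f (F t ((extChartAt (𝓡 n) p).symm u)) := chartFun_mapRep hz.2.2
  rw [weightDensity, hF.volumeRatio_eq g hI hz.1 h0 hz.2.1, chartDensity,
    hF.chartGram_eq_gramAlong g hz, h1, mul_div_assoc]

/-- The first variation of the weighted area density. -/
theorem IsSmoothFamily.deriv_weightDensity (hF : IsSmoothFamily (m := m) (n := n) ε F)
    (hI : IsImmersedFamily (m := m) (n := n) ε F) (h0 : (0 : ℝ) ∈ Set.Ioo (-ε) ε)
    (hf : ContMDiff (𝓡 m) 𝓘(ℝ, ℝ) ∞ f)
    (hz : ((0 : ℝ), u) ∈ localDomain (m := m) (n := n) ε F p q)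
    (hn : ∀ᶠ u' in 𝓝 u, ∀ v, chartMetric g q (localRep (m := m) (n := n) F p q (0, u'))
      (fderiv ℝ (localRep (m := m) (n := n) F p q) (0, u') (1, 0)) (fderiv ℝ (localRep (m := m) (n := n) F p q) (0, u') (0, v)) = 0) :
    deriv (fun t => weightDensity (n := n) g f F t ((extChartAt (𝓡 n) p).symm u)) 0
      = -(Real.exp (-f (F 0 ((extChartAt (𝓡 n) p).symm u))) *
        firstVariationForm g f (F 0) p q u (fderiv ℝ (localRep (m := m) (n := n) F p q) (0, u) (1, 0))) := by
  have hLC := isLeviCivitaOn_chart g q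
  have hy := mapsTo_localRep hz
  have hFz := hF.contDiffAt_localRep hz
  have hd0 : 0 < chartDensity (inducedMetric (n := n) g (F 0)) p u :=
    (hF.isDensity g hI h0).pos p u hz.2.1
  have hgram := hF.chartGram_eq_gramAlong g hz
  have h1 := hLC.hasDerivAt_density (f := chartFun (m := m) f q) hy hFz
    (((contDiffOn_chartFun hf q).contDiffAt (hLC.isOpen.mem_nhds hy)).differentiableAt (by simp))
    -- Normality is assumed only on the slice t = 0, so only spatial derivatives of ⟨∂_t F, ∂_j F⟩
    -- are known to vanish. The first variation needs no others.
    (1, 0) spaceVec (fun i j => by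
      have hd : DifferentiableAt ℝ (fun z => chartMetric g q (localRep (m := m) (n := n) F p q z)
          (fderiv ℝ (localRep (m := m) (n := n) F p q) z (1, 0))
          (fderiv ℝ (localRep (m := m) (n := n) F p q) z (spaceVec j))) ((0 : ℝ), u) :=
        (hLC.contDiffAt_metric hy hFz (contDiffAt_fderiv_apply hFz _)
          (contDiffAt_fderiv_apply hFz _)).differentiableAt (by simp)
      have h2 := fderiv_slice hd (stdVec i)
      have h3 : (fun u' => chartMetric g q (localRep (m := m) (n := n) F p q ((0 : ℝ), u'))
          (fderiv ℝ (localRep (m := m) (n := n) F p q) ((0 : ℝ), u') (1, 0))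
          (fderiv ℝ (localRep (m := m) (n := n) F p q) ((0 : ℝ), u') (spaceVec j))) =ᶠ[𝓝 u] fun _ => 0 := by
        filter_upwards [hn] with u' hu' using hu' _
      rw [h3.fderiv_eq] at h2
      exact h2.symm.trans (by simp))
    (by rw [← hgram]; exact inducedGram_pos g hz.2.1 (hI 0 h0 _))
  have h2 : HasDerivAt (fun t => weightDensity (n := n) g f F t ((extChartAt (𝓡 n) p).symm u)) _ 0 :=
    (h1.div_const (chartDensity (inducedMetric (n := n) g (F 0)) p u)).congr_of_eventuallyEq (by
      have hline : ∀ᶠ t : ℝ in 𝓝 0, (t, u) ∈ localDomain (m := m) (n := n) ε F p q := by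
        have h3 : ContinuousAt (fun t : ℝ => (t, u)) 0 := by fun_prop
        exact h3.eventually_mem ((hF.isOpen_localDomain p q).mem_nhds hz)
      filter_upwards [hline] with t ht
      rw [hF.weightDensity_eq g hI h0 ht]
      simp)
  rw [h2.deriv, ← hgram]
  have h3 : chartFun (m := m) f q (localRep (m := m) (n := n) F p q (0, u))
      = f (F 0 ((extChartAt (𝓡 n) p).symm u)) := chartFun_mapRep hz.2.2
  have h4 : √(chartGram (inducedMetric (n := n) g (F 0)) p u).det
      = chartDensity (inducedMetric (n := n) g (F 0)) p u := rfl
  have h5 : firstVariationForm g f (F 0) p q u (fderiv ℝ (localRep (m := m) (n := n) F p q) (0, u) (1, 0))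
      = fderiv ℝ (chartFun (m := m) f q) (localRep (m := m) (n := n) F p q (0, u)) (fderiv ℝ (localRep (m := m) (n := n) F p q) (0, u) (1, 0))
        + ∑ i, ∑ j, (chartGram (inducedMetric (n := n) g (F 0)) p u)⁻¹ i j *
          chartMetric g q (localRep (m := m) (n := n) F p q (0, u)) (fderiv ℝ (localRep (m := m) (n := n) F p q) (0, u) (1, 0))
            (covD (chartConn (metricFn g) q) (localRep (m := m) (n := n) F p q)
              (fun p_1 => fderiv ℝ (localRep (m := m) (n := n) F p q) p_1 (spaceVec j)) (0, u) (spaceVec i)) := by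
    rw [firstVariationForm]
    simp only [spaceVec]
    simp only [← covD_fderiv_slice hFz]
    rfl
  rw [h3, h4, ← h5]
  field_simp

end FirstVariation

end WeightedMinimal

namespace WeightedMinimal

/-! ### Covariant derivatives and frames in charts -/

section PointwiseRep

variable {m n : ℕ} {M : Type*} [TopologicalSpace M]
  [ChartedSpace (EuclideanSpace ℝ (Fin m)) M] [IsManifold (𝓡 m) ∞ M]
  {S : Type*} [TopologicalSpace S] [ChartedSpace (EuclideanSpace ℝ (Fin n)) S]
  [IsManifold (𝓡 n) ∞ S]
  (g : Bundle.ContMDiffRiemannianMetric (𝓡 m) ∞ (EuclideanSpace ℝ (Fin m))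
      (fun x : M => TangentSpace (𝓡 m) x))
  {F : S → M} {x : S}

theorem extChartAt_symm_self_mem_source (F : S → M) (x : S) :
    F ((extChartAt (𝓡 n) x).symm (extChartAt (𝓡 n) x x)) ∈ (extChartAt (𝓡 m) (F x)).source := by
  rw [extChartAt_to_inv]
  exact mem_extChartAt_source _

theorem mapRep_self (F : S → M) (x : S) :
    mapRep (m := m) (n := n) F x (F x) (extChartAt (𝓡 n) x x) = extChartAt (𝓡 m) (F x) (F x) := by
  rw [mapRep, extChartAt_to_inv]

theorem fderiv_mapRep_self (hF : ContMDiff (𝓡 n) (𝓡 m) ∞ F) (v : EuclideanSpace ℝ (Fin n)) :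
    fderiv ℝ (mapRep (m := m) (n := n) F x (F x)) (extChartAt (𝓡 n) x x) v
      = modelDeriv F x v := by
  rw [fderiv_mapRep hF (mem_extChartAt_target x) (extChartAt_symm_self_mem_source F x),
    chartSymmDeriv_self, extChartAt_to_inv, chartDeriv_self]
  rfl

/-- The covariant derivative along `F` in charts. -/
theorem covDerivAlong_eq_covD (hF : ContMDiff (𝓡 n) (𝓡 m) ∞ F)
    {V : (y : S) → TangentSpace (𝓡 m) (F y)}
    {X : EuclideanSpace ℝ (Fin n) → EuclideanSpace ℝ (Fin m)}
    (hX : DifferentiableAt ℝ X (extChartAt (𝓡 n) x x))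
    (hV : ∀ᶠ u in 𝓝 (extChartAt (𝓡 n) x x),
      chartDeriv (F x) (F ((extChartAt (𝓡 n) x).symm u))
        (ofTangent (V ((extChartAt (𝓡 n) x).symm u))) = X u)
    (v : TangentSpace (𝓡 n) x) :
    ofTangent (covDerivAlong (n := n) g F V x v)
      = covD (chartConn (metricFn g) (F x)) (mapRep F x (F x)) X (extChartAt (𝓡 n) x x)
          (ofTangent v) := by
  set comp : S → EuclideanSpace ℝ (Fin m) := fun y => chartDeriv (F x) (F y) (ofTangent (V y))
    with hcomp
  have hev : comp =ᶠ[𝓝 x] X ∘ extChartAt (𝓡 n) x := by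
    have h1 := (continuousAt_extChartAt (I := 𝓡 n) x).eventually hV
    filter_upwards [h1, extChartAt_source_mem_nhds (I := 𝓡 n) x] with y hy hy'
    rwa [(extChartAt (𝓡 n) x).left_inv hy'] at hy
  have hd : ∀ v : EuclideanSpace ℝ (Fin n), modelDeriv (m := m) comp x v
      = fderiv ℝ X (extChartAt (𝓡 n) x x) v := by
    intro v
    have h1 : MDifferentiableAt (𝓡 n) (𝓡 n) (extChartAt (𝓡 n) x) x :=
      (extChartAt_contMDiffAt (mem_extChartAt_source x)).mdifferentiableAt (by simp)
    have h2 : mfderiv (𝓡 n) (𝓡 m) comp x = (mfderiv (𝓡 n) (𝓡 m) X (extChartAt (𝓡 n) x x)).comp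
        (mfderiv (𝓡 n) (𝓡 n) (extChartAt (𝓡 n) x) x) := by
      rw [hev.mfderiv_eq]
      exact mfderiv_comp x hX.mdifferentiableAt h1
    have h3 : modelDeriv (m := m) comp x v = mfderiv (𝓡 n) (𝓡 m) X (extChartAt (𝓡 n) x x)
        (chartDeriv x x v) := congrArg (fun A => A v) h2
    rw [h3, mfderiv_eq_fderiv, chartDeriv_self]
    rfl
  have h0 : X (extChartAt (𝓡 n) x x) = ofTangent (V x) := by
    rw [← hV.self_of_nhds]
    -- The type of `V y` depends on `y`, and the inverse chart returns `x` only up to a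
    -- propositional equality. Generalising the point allows substitution.
    have : ∀ y, y = x → chartDeriv (F x) (F y) (ofTangent (V y)) = ofTangent (V x) := by
      rintro y rfl
      rw [chartDeriv_self]
      rfl
    exact this _ (extChartAt_to_inv x)
  rw [covD, mapRep_self, fderiv_mapRep_self hF, h0, ← hd, chartConn_apply]
  rfl

/-- Over the chart domain the tangent bundle trivialization at `q` is the derivative of the
preferred chart, so these are the components that define smoothness of a section. -/
theorem contMDiffAt_section_chartDeriv {k : ℕ} {N : Type*} [TopologicalSpace N]
    [ChartedSpace (EuclideanSpace ℝ (Fin k)) N] [IsManifold (𝓡 k) ∞ N]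
    {V : (y : N) → TangentSpace (𝓡 k) y} {q : N}
    (hV : ContMDiffAt (𝓡 k) (𝓡 k).tangent ∞
      (fun y => (⟨y, V y⟩ : TangentBundle (𝓡 k) N)) q) :
    ContMDiffAt (𝓡 k) (𝓡 k) ∞ (fun y => chartDeriv q y (ofTangent (V y))) q := by
  have : IsManifold (𝓡 k) 1 N := isManifold_one
  have h1 := (Bundle.contMDiffAt_section (F := EuclideanSpace ℝ (Fin k))
    (E := fun x : N => TangentSpace (𝓡 k) x) q).1 hV
  refine h1.congr_of_eventuallyEq ?_
  filter_upwards [extChartAt_source_mem_nhds (I := 𝓡 k) q] with y hy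
  rw [extChartAt_source] at hy
  have h2 := TangentBundle.continuousLinearMapAt_trivializationAt (I := 𝓡 k) hy
  have h3 : chartDeriv q y (ofTangent (V y)) = (trivializationAt (EuclideanSpace ℝ (Fin k))
      (TangentSpace (𝓡 k)) q).continuousLinearMapAt ℝ y (V y) := congrArg (fun A => A (V y)) h2.symm
  rw [h3, Bundle.Trivialization.continuousLinearMapAt_apply,
    Bundle.Trivialization.linearMapAt_apply, if_pos]
  simpa using hy

/-- The vectors `∇_{eᵢ} eⱼ` in charts, up to tangential terms. -/
theorem frameDeriv_eq_covD (hF : ContMDiff (𝓡 n) (𝓡 m) ∞ F) {U : Set S} (hU : IsOpen U)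
    (hx : x ∈ U) {e : Fin n → (x : S) → TangentSpace (𝓡 n) x}
    (he : ∀ i, ContMDiffOn (𝓡 n) (𝓡 n).tangent ∞
      (fun x => (⟨x, e i x⟩ : TangentBundle (𝓡 n) S)) U) (i j : Fin n) :
    ∃ τ, ofTangent (frameDeriv (n := n) g F e x i j)
      = covD (chartConn (metricFn g) (F x)) (mapRep F x (F x))
          (fun u => fderiv ℝ (mapRep F x (F x)) u (ofTangent (e j x))) (extChartAt (𝓡 n) x x)
          (ofTangent (e i x)) + modelDeriv (n := n) F x τ := by
  set u₀ := extChartAt (𝓡 n) x x with hu₀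
  set φ := mapRep (m := m) (n := n) F x (F x) with hφ
  have hφc : ContDiffAt ℝ ∞ φ u₀ :=
    contDiffAt_mapRep hF (mem_extChartAt_target x) (extChartAt_symm_self_mem_source F x)
  have hd : DifferentiableAt ℝ (fderiv ℝ φ) u₀ :=
    (hφc.fderiv_right (m := ∞) (by simp)).differentiableAt (by simp)
  set E : EuclideanSpace ℝ (Fin n) → EuclideanSpace ℝ (Fin n) := fun u =>
    chartDeriv x ((extChartAt (𝓡 n) x).symm u) (ofTangent (e j ((extChartAt (𝓡 n) x).symm u)))
    with hE
  have hEd : DifferentiableAt ℝ E u₀ := by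
    have h1 := contMDiffAt_section_chartDeriv ((he j).contMDiffAt (hU.mem_nhds hx))
    have h2 := extChartAt_symm_contMDiffAt (mem_extChartAt_target (I := 𝓡 n) x)
    have h3 : ContMDiffAt (𝓡 n) (𝓡 n) ∞ E u₀ := by
      refine (ContMDiffAt.comp u₀ (g := fun y => chartDeriv x y (ofTangent (e j y))) ?_ h2)
      have h4 : (extChartAt (𝓡 n) x).symm u₀ = x := extChartAt_to_inv x
      rw [h4]
      exact h1
    exact (contMDiffAt_iff_contDiffAt.1 h3).differentiableAt (by simp)
  have hE0 : E u₀ = ofTangent (e j x) := by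
    have : ∀ y, y = x → chartDeriv x y (ofTangent (e j y)) = ofTangent (e j x) := by
      rintro y rfl
      rw [chartDeriv_self]
      rfl
    exact this _ (extChartAt_to_inv x)
  -- By the product rule, replacing the frame field by a constant field costs the derivative of its
  -- components, pushed forward by `F`. It is tangential.
  refine ⟨fderiv ℝ E u₀ (ofTangent (e i x)), ?_⟩
  rw [frameDeriv, covDerivAlong_eq_covD g hF (X := fun u => fderiv ℝ φ u (E u))
    (hd.clm_apply hEd) ?_, covD, covD, fderiv_clm_apply hd hEd, fderiv_clm_apply hd (by fun_prop),
    hE0, ← fderiv_mapRep_self hF]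
  · simp only [add_apply, ContinuousLinearMap.comp_apply, ContinuousLinearMap.flip_apply,
      fderiv_fun_const, Pi.zero_apply, zero_apply, map_zero, zero_add, ← hu₀, ← hφ]
    abel
  · filter_upwards [eventually_mem_chart hF (mem_extChartAt_target x)
      (extChartAt_symm_self_mem_source F x)] with u hu
    rw [hφ, fderiv_mapRep hF hu.1 hu.2, hE]
    have h1 := chartSymmDeriv_chartDeriv ((extChartAt (𝓡 n) x).map_target hu.1)
      (ofTangent (e j ((extChartAt (𝓡 n) x).symm u)))
    rw [(extChartAt (𝓡 n) x).right_inv hu.1] at h1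
    rw [h1]
    rfl

end PointwiseRep

/-! ### The velocity field in charts -/

section Family

variable {m n : ℕ} {M : Type*} [TopologicalSpace M]
  [ChartedSpace (EuclideanSpace ℝ (Fin m)) M] [IsManifold (𝓡 m) ∞ M]
  {S : Type*} [TopologicalSpace S] [ChartedSpace (EuclideanSpace ℝ (Fin n)) S]
  [IsManifold (𝓡 n) ∞ S]
  (g : Bundle.ContMDiffRiemannianMetric (𝓡 m) ∞ (EuclideanSpace ℝ (Fin m))
      (fun x : M => TangentSpace (𝓡 m) x))
  {ε : ℝ} {F : ℝ → S → M} {p x : S} {q : M}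

theorem self_mem_localDomain (h0 : (0 : ℝ) ∈ Set.Ioo (-ε) ε) (x : S) :
    ((0 : ℝ), extChartAt (𝓡 n) x x) ∈ localDomain (m := m) (n := n) ε F x (F 0 x) :=
  ⟨h0, mem_extChartAt_target x, extChartAt_symm_self_mem_source (F 0) x⟩

theorem fderiv_localRep_eq_mapRep (hF : IsSmoothFamily (m := m) (n := n) ε F) {t : ℝ}
    {u : EuclideanSpace ℝ (Fin n)} (hz : (t, u) ∈ localDomain (m := m) (n := n) ε F p q)
    (v : EuclideanSpace ℝ (Fin n)) :
    fderiv ℝ (localRep (m := m) (n := n) F p q) (t, u) (0, v)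
      = fderiv ℝ (mapRep (m := m) (n := n) (F t) p q) u v :=
  (fderiv_slice ((hF.contDiffAt_localRep hz).differentiableAt (by simp)) v).symm

theorem fderiv_localRep_time_self (hF : IsSmoothFamily (m := m) (n := n) ε F)
    (h0 : (0 : ℝ) ∈ Set.Ioo (-ε) ε) :
    fderiv ℝ (localRep (m := m) (n := n) F x (F 0 x)) (0, extChartAt (𝓡 n) x x) (1, 0)
      = ofTangent (velocity F 0 x) := by
  rw [hF.fderiv_localRep_time (self_mem_localDomain h0 x)]
  have : ∀ y, y = x → chartDeriv (F 0 x) (F 0 y) (ofTangent (velocity F 0 y))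
      = (ofTangent (velocity F 0 x) : EuclideanSpace ℝ (Fin m)) := by
    rintro y rfl
    rw [chartDeriv_self]
    rfl
  exact this _ (extChartAt_to_inv x)

/-- A velocity field normal to every slice, in charts. -/
theorem metric_velocity_eq_zero (hF : IsSmoothFamily (m := m) (n := n) ε F) {t : ℝ}
    {u : EuclideanSpace ℝ (Fin n)} (hz : (t, u) ∈ localDomain (m := m) (n := n) ε F p q)
    (hn : IsNormalVec (n := n) g (F t) ((extChartAt (𝓡 n) p).symm u)
      (velocity F t ((extChartAt (𝓡 n) p).symm u))) (v : EuclideanSpace ℝ (Fin n)) :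
    chartMetric g q (localRep F p q (t, u)) (fderiv ℝ (localRep F p q) (t, u) (1, 0))
      (fderiv ℝ (localRep F p q) (t, u) (0, v)) = 0 := by
  rw [hF.fderiv_localRep hz, hF.fderiv_localRep_time hz]
  exact (chartMetric_chartDeriv g hz.2.2 _ _).trans (hn _)

theorem normSq_velocity_eq (hF : IsSmoothFamily (m := m) (n := n) ε F) {t : ℝ}
    {u : EuclideanSpace ℝ (Fin n)} (hz : (t, u) ∈ localDomain (m := m) (n := n) ε F p q) :
    normSq g (F t) (velocity F t) ((extChartAt (𝓡 n) p).symm u)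
      = chartMetric g q (localRep F p q (t, u)) (fderiv ℝ (localRep F p q) (t, u) (1, 0))
          (fderiv ℝ (localRep F p q) (t, u) (1, 0)) := by
  rw [hF.fderiv_localRep_time hz]
  exact (chartMetric_chartDeriv g hz.2.2 _ _).symm

/-- The covariant derivative of the velocity in charts. -/
theorem covDerivAlong_velocity (hF : IsSmoothFamily (m := m) (n := n) ε F)
    (h0 : (0 : ℝ) ∈ Set.Ioo (-ε) ε) (v : TangentSpace (𝓡 n) x) :
    ofTangent (covDerivAlong (n := n) g (F 0) (velocity F 0) x v)
      = covD (chartConn (metricFn g) (F 0 x)) (localRep F x (F 0 x))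
          (fun z => fderiv ℝ (localRep F x (F 0 x)) z (1, 0)) (0, extChartAt (𝓡 n) x x)
          (0, ofTangent v) := by
  have hz := self_mem_localDomain (m := m) (n := n) (F := F) h0 x
  have hFz := hF.contDiffAt_localRep hz
  have hd := (contDiffAt_fderiv_apply hFz (1, 0)).differentiableAt (by simp)
  rw [covDerivAlong_eq_covD g (hF.contMDiff h0)
    (X := fun u => fderiv ℝ (localRep F x (F 0 x)) (0, u) (1, 0)),
    ← covD_slice (hFz.differentiableAt (by simp)) hd]
  · rfl
  · have h1 : DifferentiableAt ℝ (fun u : EuclideanSpace ℝ (Fin n) => ((0 : ℝ), u))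
      (extChartAt (𝓡 n) x x) := by fun_prop
    exact hd.comp (extChartAt (𝓡 n) x x) h1
  · filter_upwards [eventually_slice ((hF.isOpen_localDomain x (F 0 x)).mem_nhds hz)] with u hu
    exact (hF.fderiv_localRep_time hu).symm

end Family

end WeightedMinimal

namespace WeightedMinimal

/-! ### The second variation on the manifold -/

section SecondVariation

variable {m n : ℕ} {M : Type*} [TopologicalSpace M]
  [ChartedSpace (EuclideanSpace ℝ (Fin m)) M] [IsManifold (𝓡 m) ∞ M]
  {S : Type*} [TopologicalSpace S] [ChartedSpace (EuclideanSpace ℝ (Fin n)) S]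
  [IsManifold (𝓡 n) ∞ S]
  (g : Bundle.ContMDiffRiemannianMetric (𝓡 m) ∞ (EuclideanSpace ℝ (Fin m))
      (fun x : M => TangentSpace (𝓡 m) x))
  {ε : ℝ} {F : ℝ → S → M} {p x : S} {q : M} {f : M → ℝ}

theorem exists_clm_stdVec (E : Fin n → EuclideanSpace ℝ (Fin n)) :
    ∃ L : EuclideanSpace ℝ (Fin n) →L[ℝ] EuclideanSpace ℝ (Fin n), ∀ i, L (stdVec i) = E i := by
  refine ⟨∑ i, (EuclideanSpace.proj i : EuclideanSpace ℝ (Fin n) →L[ℝ] ℝ).smulRight (E i),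
    fun i => ?_⟩
  simp [sum_apply, stdVec_apply]

/-- The density in terms of a family that is orthonormal at time zero. -/
theorem IsSmoothFamily.weightDensity_eq_of_orthonormal
    (hF : IsSmoothFamily (m := m) (n := n) ε F)
    (hI : IsImmersedFamily (m := m) (n := n) ε F) (h0 : (0 : ℝ) ∈ Set.Ioo (-ε) ε) {t : ℝ}
    {u : EuclideanSpace ℝ (Fin n)}
    (hz : (t, u) ∈ localDomain (m := m) (n := n) ε F p q)
    (hz0 : (0, u) ∈ localDomain (m := m) (n := n) ε F p q)
    {E : Fin n → EuclideanSpace ℝ (Fin n)}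
    (hE : gramAlong (chartMetric g q) (localRep F p q)
      (fun i => ((0 : ℝ), E i)) (0, u) = 1) :
    weightDensity (n := n) g f F t ((extChartAt (𝓡 n) p).symm u)
      = Real.exp (-chartFun (m := m) f q (localRep F p q (t, u)))
        * √(gramAlong (chartMetric g q) (localRep F p q)
          (fun i => ((0 : ℝ), E i)) (t, u)).det := by
  obtain ⟨L, hL⟩ := exists_clm_stdVec E
  have hdet : ∀ s : ℝ, (gramAlong (chartMetric g q) (localRep (m := m) (n := n) F p q)
      (fun i => ((0 : ℝ), E i)) (s, u)).det
      = L.det ^ 2 * (gramAlong (chartMetric g q) (localRep F p q) spaceVec (s, u)).det := by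
    intro s
    let D : EuclideanSpace ℝ (Fin n) →L[ℝ] EuclideanSpace ℝ (Fin m) :=
      (fderiv ℝ (localRep (m := m) (n := n) F p q) (s, u)).comp (ContinuousLinearMap.inr ℝ ℝ _)
    refine gram_det_comp (B := (chartMetric g q (localRep F p q (s, u))).bilinearComp D D) (L := L)
      (fun i j => ?_) (fun i j => rfl)
    rw [hL, hL]
    rfl
  have hg0 : chartGram (inducedMetric (n := n) g (F 0)) p u
      = gramAlong (chartMetric g q) (localRep F p q) spaceVec (0, u) :=
    hF.chartGram_eq_gramAlong g hz0
  have h1 := hdet 0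
  rw [hE, Matrix.det_one, ← hg0] at h1
  -- At time 0 the new Gram matrix is the identity, so |det L| is the inverse of the initial
  -- density, which is the denominator of the volume ratio.
  have h2 : 1 = |L.det| * chartDensity (inducedMetric (n := n) g (F 0)) p u := by
    rw [chartDensity, ← Real.sqrt_sq_eq_abs, ← Real.sqrt_mul (sq_nonneg _), ← h1, Real.sqrt_one]
  have hd0 : 0 < chartDensity (inducedMetric (n := n) g (F 0)) p u :=
    (hF.isDensity g hI h0).pos p u hz.2.1
  rw [hF.weightDensity_eq g hI h0 hz, hdet t, Real.sqrt_mul (sq_nonneg _), Real.sqrt_sq_eq_abs,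
    div_eq_iff hd0.ne']
  linear_combination (Real.exp (-chartFun (m := m) f q (localRep F p q (t, u)))
    * √(gramAlong (chartMetric g q) (localRep F p q) spaceVec (t, u)).det) * h2

theorem connCurvature_swap {E : Type*} [NormedAddCommGroup E] [NormedSpace ℝ E]
    (Γ : E → E →L[ℝ] E →L[ℝ] E) (y v w z : E) :
    connCurvature Γ y v w z = -connCurvature Γ y w v z := by
  simp only [connCurvature]
  abel

/-- `F` is a critical point of the weighted area at `x`, in charts. -/
def IsCriticalAt (f : M → ℝ) (F : S → M) (x : S) : Prop :=
  ∀ w : EuclideanSpace ℝ (Fin m),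
    (∀ v : EuclideanSpace ℝ (Fin n), innerModel g (F x) w (modelDeriv F x v) = 0) →
      firstVariationForm (n := n) g f F x (F x) (extChartAt (𝓡 n) x x) w = 0

set_option synthInstance.maxHeartbeats 200000 in
/-- The pointwise second variation of the weighted area density. -/
theorem IsSmoothFamily.hasDerivAt_deriv_weightDensity
    (hF : IsSmoothFamily (m := m) (n := n) ε F)
    (hI : IsImmersedFamily (m := m) (n := n) ε F) (h0 : (0 : ℝ) ∈ Set.Ioo (-ε) ε)
    (hf : ContMDiff (𝓡 m) 𝓘(ℝ, ℝ) ∞ f)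
    (hn : ∀ t ∈ Set.Ioo (-ε) ε, ∀ x : S, IsNormalVec (n := n) g (F t) x (velocity F t x))
    (hcrit : IsCriticalAt (n := n) g f (F 0) x)
    {U : Set S} (hU : IsOpen U) (hx : x ∈ U) {e : Fin n → (x : S) → TangentSpace (𝓡 n) x}
    (he : IsOrthonormalFrameOn g (F 0) U e) :
    HasDerivAt (deriv fun t => weightDensity (n := n) g f F t x)
      (Real.exp (-f (F 0 x)) * secondVariationExpr g f (F 0) (velocity F 0) e x) 0 := by
  have hF0 := hF.contMDiff h0
  set q := F 0 x with hq
  set u₀ := extChartAt (𝓡 n) x x with hu₀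
  set Φ := localRep (m := m) (n := n) F x q with hΦ
  set φ := mapRep (m := m) (n := n) (F 0) x q with hφ
  set G := chartMetric g q with hG
  set Γ := chartConn (metricFn g) q with hΓ
  set f' := chartFun (m := m) f q with hf'
  set E : Fin n → EuclideanSpace ℝ (Fin n) := fun i => ofTangent (e i x) with hE
  set b : Fin n → ℝ × EuclideanSpace ℝ (Fin n) := fun i => (0, E i) with hb
  set T : ℝ × EuclideanSpace ℝ (Fin n) := (1, 0) with hT
  set W : ℝ × EuclideanSpace ℝ (Fin n) → ℝ := fun z => G (Φ z) (fderiv ℝ Φ z T) (fderiv ℝ Φ z T)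
    with hW
  set D := modelDeriv (m := m) (n := n) (F 0) x with hD
  set N : S → ℝ := normSq g (F 0) (velocity F 0) with hN
  -- Half of the image of this gradient of |ν|² is the vector that, added to the acceleration, makes
  -- it normal.
  set c : EuclideanSpace ℝ (Fin n) := ofTangent (gradient (inducedMetric (n := n) g (F 0)) N x)
    with hc
  have hLC := isLeviCivitaOn_chart g q
  have hΩ := hF.isOpen_localDomain x q
  have hz : ((0 : ℝ), u₀) ∈ localDomain (m := m) (n := n) ε F x q := self_mem_localDomain h0 x
  have hΦz : ContDiffAt ℝ ∞ Φ (0, u₀) := hF.contDiffAt_localRep hz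
  have hy0 : Φ (0, u₀) = extChartAt (𝓡 m) q q := mapRep_self (F 0) x
  have hGq : innerModel g q = G (Φ (0, u₀)) := by rw [hy0, hG, innerModel_eq_chartMetric]
  have hfD : ∀ v, fderiv ℝ Φ (0, u₀) (0, v) = D v := fun v => by
    rw [hΦ, fderiv_localRep_eq_mapRep hF hz, hu₀, hq, fderiv_mapRep_self hF0]
  have hφD : ∀ v, fderiv ℝ φ u₀ v = D v := fun v => fderiv_mapRep_self hF0 v
  have hfT : fderiv ℝ Φ (0, u₀) T = ofTangent (velocity F 0 x) := fderiv_localRep_time_self hF h0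
  have hev := eventually_slice (hΩ.mem_nhds hz)
  have hWc : ContDiffAt ℝ ∞ W (0, u₀) :=
    hLC.contDiffAt_metric (mapsTo_localRep hz) hΦz (contDiffAt_fderiv_apply hΦz _)
      (contDiffAt_fderiv_apply hΦz _)
  have hNW : (N ∘ (extChartAt (𝓡 n) x).symm) =ᶠ[𝓝 u₀] fun u => W (0, u) := by
    filter_upwards [hev] with u hu using normSq_velocity_eq g hF hu
  have hNd : ∀ v, fderiv ℝ (N ∘ (extChartAt (𝓡 n) x).symm) u₀ v = fderiv ℝ W (0, u₀) (0, v) := by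
    intro v
    rw [hNW.fderiv_eq, fderiv_slice (hWc.differentiableAt (by simp))]
  have hNc : ContDiffAt ℝ ∞ (N ∘ (extChartAt (𝓡 n) x).symm) u₀ :=
    (ContDiffAt.comp u₀ (f := fun u => ((0 : ℝ), u)) hWc
      (contDiffAt_const.prodMk contDiffAt_id)).congr_of_eventuallyEq hNW
  have hNdd : ∀ v w, fderiv ℝ (fun u => fderiv ℝ (N ∘ (extChartAt (𝓡 n) x).symm) u w) u₀ v
      = fderiv ℝ (fun z => fderiv ℝ W z (0, w)) (0, u₀) (0, v) := by
    intro v w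
    rw [← fderiv_slice ((contDiffAt_fderiv_apply hWc _).differentiableAt (by simp))]
    have hWe : ∀ᶠ z in 𝓝 ((0 : ℝ), u₀), ContDiffAt ℝ 1 W z :=
      (hWc.of_le (m := 1) ENat.LEInfty.out).eventually (by simp)
    have : (fun u => fderiv ℝ (N ∘ (extChartAt (𝓡 n) x).symm) u w)
        =ᶠ[𝓝 u₀] fun u => fderiv ℝ W (0, u) (0, w) := by
      filter_upwards [hNW.eventuallyEq_nhds, eventually_slice hWe] with u hu hu'
      rw [hu.fderiv_eq, fderiv_slice (hu'.differentiableAt (by simp))]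
    rw [this.fderiv_eq]
  set B := (G (Φ (0, u₀))).bilinearComp D D with hB
  have hgram : ∀ i j, chartGram (inducedMetric (n := n) g (F 0)) x u₀ i j
      = B (stdVec i) (stdVec j) := by
    intro i j
    rw [chartGram_eq_mapRep g hF0 hz.2.1 hz.2.2, ← hφ, hφD, hφD]
    rfl
  have hgs := chartGram_inducedMetric_symm (n := n) g (F 0) x u₀
  have hgd : (chartGram (inducedMetric (n := n) g (F 0)) x u₀).det ≠ 0 :=
    (inducedGram_pos g hz.2.1 (hI 0 h0 _)).ne'
  have hgrad : ∀ (ψ : S → ℝ) (w : EuclideanSpace ℝ (Fin n)),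
      G (Φ (0, u₀)) (D (ofTangent (gradient (inducedMetric (n := n) g (F 0)) ψ x))) (D w)
        = fderiv ℝ (ψ ∘ (extChartAt (𝓡 n) x).symm) u₀ w := fun ψ w =>
    metric_gradient hgram hgs hgd ψ w
  have hon : ∀ i j, G (Φ (0, u₀)) (D (E i)) (D (E j)) = if i = j then 1 else 0 := by
    intro i j
    rw [← hGq]
    exact he.2 x hx i j
  have hG1 : gramAlong G Φ b (0, u₀) = 1 := by
    ext i j
    rw [gramAlong, Matrix.of_apply, hfD, hfD, hon, Matrix.one_apply]
  have hcrit' : ∀ w, (∀ i, G (Φ (0, u₀)) w (fderiv ℝ Φ (0, u₀) (b i)) = 0) →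
      fderiv ℝ f' (Φ (0, u₀)) w + ∑ i, G (Φ (0, u₀)) w
        (covD Γ Φ (fun z => fderiv ℝ Φ z (b i)) (0, u₀) (b i)) = 0 := by
    intro w hw
    have h1 := hcrit w (fun v => by
      rw [← hq, hGq]
      -- The n vectors `E i` are orthonormal for the induced metric, hence independent, hence a
      -- basis of the model space. So orthogonality to their images is orthogonality to the whole
      -- image of D.
      have hexp : D v = ∑ i, G (Φ (0, u₀)) (D v) (D (E i)) • D (E i) := by
        obtain ⟨L, hL⟩ := exists_clm_stdVec E
        have hinj : Function.Injective L := by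
          rw [injective_iff_map_eq_zero]
          intro a ha
          ext j
          have h2 : ∑ i, a i • E i = 0 := by
            rw [← ha]
            conv_rhs => rw [← sum_smul_stdVec a]
            simp [hL]
          have h3 : G (Φ (0, u₀)) (D (∑ i, a i • E i)) (D (E j)) = a j := by
            simp only [map_sum, map_smul, sum_apply, smul_apply, hon, smul_eq_mul]
            simp
          rw [h2] at h3
          simpa using h3.symm
        have hsurj : Function.Surjective L := LinearMap.surjective_of_injective
          (f := L.toLinearMap) hinj
        obtain ⟨a, rfl⟩ := hsurj v
        have h2 : L a = ∑ i, a i • E i := by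
          conv_lhs => rw [← sum_smul_stdVec a]
          simp [hL]
        have h3 : ∀ j, G (Φ (0, u₀)) (D (L a)) (D (E j)) = a j := fun j => by
          rw [h2]
          simp only [map_sum, map_smul, sum_apply, smul_apply, hon, smul_eq_mul]
          simp
        simp only [h3]
        rw [h2]
        simp
      rw [← hD, hexp, map_sum]
      refine Finset.sum_eq_zero fun i _ => ?_
      have h2 := hw i
      rw [hfD] at h2
      rw [map_smul, h2, smul_zero])
    rw [firstVariationForm_eq_sum g hF0 hz.2.1 hz.2.2 (e := E) (fun i j => by
      rw [← hφ, hφD, hφD]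
      exact hon i j)] at h1
    refine Eq.trans ?_ h1
    refine congrArg (fderiv ℝ f' (Φ (0, u₀)) w + ·) (Finset.sum_congr rfl fun i _ => ?_)
    rw [← covD_fderiv_slice hΦz]
    rfl
  have hcgrad : ∀ i, G (Φ (0, u₀)) (fderiv ℝ Φ (0, u₀) (0, c)) (fderiv ℝ Φ (0, u₀) (b i))
      = fderiv ℝ W (0, u₀) (b i) := by
    intro i
    rw [hfD, hfD, hc, hgrad, hNd]
  have key := hLC.hasDerivAt_deriv_density hΩ (hF.contDiffOn_localRep x q) mapsTo_localRep hz
    (contDiffOn_chartFun hf q) T (0, c) b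
    (fun z hz' i => metric_velocity_eq_zero g hF hz' (hn z.1 hz'.1 _) _) hG1 hcrit' hcgrad
  rw [← hΦ, ← hG, ← hΓ, ← hf'] at key
  have hdens : (fun t => weightDensity (n := n) g f F t x) =ᶠ[𝓝 0]
      fun t : ℝ => Real.exp (-f' (Φ ((0, u₀) + t • T))) * √(gramAlong G Φ b ((0, u₀) + t • T)).det := by
    have hline : ∀ᶠ t : ℝ in 𝓝 0, (t, u₀) ∈ localDomain (m := m) (n := n) ε F x q := by
      have h3 : ContinuousAt (fun t : ℝ => (t, u₀)) 0 := by fun_prop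
      exact h3.eventually_mem (hΩ.mem_nhds hz)
    filter_upwards [hline] with t ht
    have h1 := hF.weightDensity_eq_of_orthonormal (f := f) g hI h0 ht hz hG1
    rw [hu₀, extChartAt_to_inv, ← hu₀] at h1
    have h2 : ((0 : ℝ), u₀) + t • T = (t, u₀) := by simp [hT]
    rw [h1, h2]
  refine (key.congr_of_eventuallyEq hdens.deriv).congr_deriv ?_
  have hfq : f' (Φ (0, u₀)) = f q := by
    rw [hy0, hf', chartFun, Function.comp_apply, extChartAt_to_inv]
  rw [hfq]
  congr 1
  have hGs : ∀ v w, G (Φ (0, u₀)) v w = G (Φ (0, u₀)) w v := chartMetric_symm g q _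
  set V : EuclideanSpace ℝ (Fin m) := ofTangent (velocity F 0 x) with hV
  have hVD : ∀ v, G (Φ (0, u₀)) V (D v) = 0 := by
    intro v
    rw [← hGq]
    exact hn 0 h0 x v
  rw [hfT]
  -- The local formula has ⟨R(ν, eᵢ)ν, eᵢ⟩, the statement ⟨R(eᵢ, ν)ν, eᵢ⟩; antisymmetry in the first
  -- two arguments gives the sign.
  have e1 : ∑ i, g.inner (F 0 x) (curvature (metricFn g) (F 0 x)
        (mfderiv (𝓡 n) (𝓡 m) (F 0) x (e i x)) (velocity F 0 x) (velocity F 0 x))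
        (mfderiv (𝓡 n) (𝓡 m) (F 0) x (e i x))
      = -∑ i, G (Φ (0, u₀)) (connCurvature Γ (Φ (0, u₀)) V (fderiv ℝ Φ (0, u₀) (b i)) V)
        (fderiv ℝ Φ (0, u₀) (b i)) := by
    rw [← Finset.sum_neg_distrib]
    refine Finset.sum_congr rfl fun i _ => ?_
    refine (congrArg (fun a => innerModel g q a (D (E i))) (curvature_metricFn g q
      (mfderiv (𝓡 n) (𝓡 m) (F 0) x (e i x)) (velocity F 0 x) (velocity F 0 x))).trans ?_
    have h1 := connCurvature_swap Γ (Φ (0, u₀)) V (D (E i)) V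
    rw [hfD, h1, map_neg, neg_apply, neg_neg, ← hGq, hy0]
    rfl
  -- The Christoffel term of the intrinsic Hessian is dN(Γ(eᵢ, eᵢ)) = ⟨∇N, Γ(eᵢ, eᵢ)⟩. By the Gauss
  -- formula it is the ambient product of ∇_i ∂_i F with the tangent vector D c.
  have e2 : laplacian (inducedMetric (n := n) g (F 0)) N x
      = ∑ i, (fderiv ℝ (fun z => fderiv ℝ W z (b i)) (0, u₀) (b i)
        - G (Φ (0, u₀)) (fderiv ℝ Φ (0, u₀) (0, c))
          (covD Γ Φ (fun z => fderiv ℝ Φ z (b i)) (0, u₀) (b i))) := by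
    rw [laplacian_eq_sum hgram (e := E) hon hNc]
    refine Finset.sum_congr rfl fun i _ => ?_
    rw [hNdd, ← hgrad, hfD, ← hc, hGs, hGs (D c)]
    congr 1
    have h1 := metric_chartConn_induced g hF0 hz.2.1 hz.2.2 (hI 0 h0 _) (E i) (E i) c
    rw [← hφ, hφD, hφD] at h1
    refine h1.trans ?_
    rw [← covD_fderiv_slice hΦz]
    rfl
  have e3 : ∀ i, ofTangent (covDerivAlong (n := n) g (F 0) (velocity F 0) x (e i x))
      = covD Γ Φ (fun z => fderiv ℝ Φ z T) (0, u₀) (b i) := fun i =>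
    covDerivAlong_velocity g hF h0 (e i x)
  -- The frame and the constant fields extending its value at `x` have second derivatives that
  -- differ by a tangent vector, which the normal vector ν does not see.
  have e4 : ∀ i j, secondFundCoeff (n := n) g (F 0) (velocity F 0) e x i j
      = -G (Φ (0, u₀)) (covD Γ Φ (fun z => fderiv ℝ Φ z (b j)) (0, u₀) (b i)) V := by
    intro i j
    obtain ⟨τ, hτ⟩ := frameDeriv_eq_covD g hF0 hU hx he.1 i j
    have h1 : secondFundCoeff (n := n) g (F 0) (velocity F 0) e x i j
        = -innerModel g q (ofTangent (frameDeriv (n := n) g (F 0) e x i j)) V := rfl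
    rw [h1, hτ, hGq, map_add, add_apply, ← hD, hGs (D τ), hVD, add_zero,
      ← covD_fderiv_slice hΦz]
    rfl
  have e5 : hessian (metricFn g) f (F 0 x) (velocity F 0 x) (velocity F 0 x)
      = fderiv ℝ (fun y => fderiv ℝ f' y V) (Φ (0, u₀)) V
        - fderiv ℝ f' (Φ (0, u₀)) (Γ (Φ (0, u₀)) V V) := by
    rw [hy0, hΓ, chartConn_apply]
    rfl
  -- The chain rule: pairing with the gradient of f ∘ F on `S` is df applied to the pushed-forward
  -- vector.
  have e6 : inducedMetric (n := n) g (F 0) x (gradient (inducedMetric (n := n) g (F 0)) (f ∘ F 0) x)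
        (gradient (inducedMetric (n := n) g (F 0)) N x)
      = fderiv ℝ f' (Φ (0, u₀)) (fderiv ℝ Φ (0, u₀) (0, c)) := by
    have h1 : inducedMetric (n := n) g (F 0) x
        (gradient (inducedMetric (n := n) g (F 0)) (f ∘ F 0) x)
        (gradient (inducedMetric (n := n) g (F 0)) N x) = innerModel g q
          (D (ofTangent (gradient (inducedMetric (n := n) g (F 0)) (f ∘ F 0) x))) (D c) := rfl
    rw [h1, hGq, hgrad, hfD, ← hφD]
    have h2 : ((f ∘ F 0) ∘ (extChartAt (𝓡 n) x).symm) =ᶠ[𝓝 u₀] f' ∘ φ := by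
      filter_upwards [hev] with u hu
      exact (chartFun_mapRep (m := m) hu.2.2).symm
    have h3 : DifferentiableAt ℝ f' (φ u₀) :=
      ((contDiffOn_chartFun hf q).contDiffAt
        (hLC.isOpen.mem_nhds (mapsTo_localRep hz))).differentiableAt (by simp)
    rw [h2.fderiv_eq, fderiv_comp u₀ h3
      ((contDiffAt_mapRep hF0 hz.2.1 hz.2.2).differentiableAt (by simp))]
    rfl
  have e3' : ∀ i, g.inner (F 0 x) (covDerivAlong (n := n) g (F 0) (velocity F 0) x (e i x))
      (covDerivAlong (n := n) g (F 0) (velocity F 0) x (e i x))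
      = G (Φ (0, u₀)) (covD Γ Φ (fun z => fderiv ℝ Φ z T) (0, u₀) (b i))
        (covD Γ Φ (fun z => fderiv ℝ Φ z T) (0, u₀) (b i)) := by
    intro i
    rw [← e3, ← hGq]
    rfl
  rw [secondVariationExpr, e1, ← hN, e2, e5, e6, neg_neg]
  simp only [e3', e4, neg_sq]
  rfl

end SecondVariation

end WeightedMinimal

namespace WeightedMinimal

/-! ### Projection onto the normal space -/

section OrthogonalProjection

variable {n m : ℕ}

/-- The component of `w` that is orthogonal, for `B`, to the range of `A`. -/
def orthoProj (B : EuclideanSpace ℝ (Fin m) →L[ℝ] EuclideanSpace ℝ (Fin m) →L[ℝ] ℝ)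
    (A : EuclideanSpace ℝ (Fin n) →L[ℝ] EuclideanSpace ℝ (Fin m)) (w : EuclideanSpace ℝ (Fin m)) :
    EuclideanSpace ℝ (Fin m) :=
  w - ∑ i, ∑ j, ((Matrix.of fun i j => B (A (stdVec i)) (A (stdVec j)))⁻¹ i j
    * B w (A (stdVec i))) • A (stdVec j)

variable {B : EuclideanSpace ℝ (Fin m) →L[ℝ] EuclideanSpace ℝ (Fin m) →L[ℝ] ℝ}
  {A : EuclideanSpace ℝ (Fin n) →L[ℝ] EuclideanSpace ℝ (Fin m)}

theorem orthoProj_eq_self {w : EuclideanSpace ℝ (Fin m)} (hw : ∀ v, B w (A v) = 0) :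
    orthoProj B A w = w := by
  simp [orthoProj, hw]

theorem orthoProj_add (w w' : EuclideanSpace ℝ (Fin m)) :
    orthoProj B A (w + w') = orthoProj B A w + orthoProj B A w' := by
  simp only [orthoProj, map_add, add_apply, mul_add, add_smul, Finset.sum_add_distrib]
  abel

/-- A vector orthogonal to the range of A is blind to the tangential part that the projection
removes. -/
theorem metric_sub_orthoProj {z : EuclideanSpace ℝ (Fin m)} (hz : ∀ v, B z (A v) = 0)
    (w : EuclideanSpace ℝ (Fin m)) : B z (orthoProj B A w) = B z w := by
  simp [orthoProj, map_sum, hz]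

/-- It is enough to test against the images of basis vectors, where the inverse Gram matrix cancels
the Gram matrix. -/
theorem metric_orthoProj
    (hd : (Matrix.of fun i j => B (A (stdVec i)) (A (stdVec j))).det ≠ 0)
    (w : EuclideanSpace ℝ (Fin m)) (v : EuclideanSpace ℝ (Fin n)) :
    B (orthoProj B A w) (A v) = 0 := by
  have hinv := Matrix.nonsing_inv_mul _ (isUnit_iff_ne_zero.2 hd)
  have h : (B (orthoProj B A w)).comp A = 0 := by
    refine clm_ext_stdVec fun l => ?_
    have h1 : ∀ i, ∑ j, (Matrix.of fun i j => B (A (stdVec i)) (A (stdVec j)))⁻¹ i j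
        * B (A (stdVec j)) (A (stdVec l)) = if i = l then 1 else 0 := by
      intro i
      rw [← Matrix.one_apply, ← hinv, Matrix.mul_apply]
      rfl
    have h2 : ∑ i, ∑ j, ((Matrix.of fun i j => B (A (stdVec i)) (A (stdVec j)))⁻¹ i j
        * B w (A (stdVec i))) * B (A (stdVec j)) (A (stdVec l)) = B w (A (stdVec l)) := by
      have h3 : ∀ i, ∑ j, ((Matrix.of fun i j => B (A (stdVec i)) (A (stdVec j)))⁻¹ i j
          * B w (A (stdVec i))) * B (A (stdVec j)) (A (stdVec l))
          = B w (A (stdVec i)) * if i = l then 1 else 0 := by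
        intro i
        rw [← h1, Finset.mul_sum]
        exact Finset.sum_congr rfl fun j _ => by ring
      simp only [h3]
      simp
    rw [ContinuousLinearMap.comp_apply, orthoProj, map_sub, sub_apply]
    simp only [map_sum, map_smul, sum_apply, smul_apply, smul_eq_mul]
    rw [h2, sub_self, zero_apply]
  exact DFunLike.congr_fun h v

theorem contDiffAt_orthoProj {P : Type*} [NormedAddCommGroup P] [NormedSpace ℝ P]
    {B : P → EuclideanSpace ℝ (Fin m) →L[ℝ] EuclideanSpace ℝ (Fin m) →L[ℝ] ℝ}
    {A : P → EuclideanSpace ℝ (Fin n) →L[ℝ] EuclideanSpace ℝ (Fin m)} {p : P}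
    (hB : ContDiffAt ℝ ∞ B p) (hA : ContDiffAt ℝ ∞ A p)
    (hd : (Matrix.of fun i j => B p (A p (stdVec i)) (A p (stdVec j))).det ≠ 0)
    (w : EuclideanSpace ℝ (Fin m)) : ContDiffAt ℝ ∞ (fun p => orthoProj (B p) (A p) w) p := by
  have hA' : ∀ i, ContDiffAt ℝ ∞ (fun p => A p (stdVec i)) p := fun i =>
    hA.clm_apply contDiffAt_const
  simp only [orthoProj]
  refine contDiffAt_const.sub (ContDiffAt.sum fun i _ => ContDiffAt.sum fun j _ => ?_)
  refine ContDiffAt.smul (ContDiffAt.mul ?_ ((hB.clm_apply contDiffAt_const).clm_apply (hA' i)))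
    (hA' j)
  exact contDiffAt_inv_apply
    (A := fun p => Matrix.of fun i j => B p (A p (stdVec i)) (A p (stdVec j)))
    (fun i j => (hB.clm_apply (hA' i)).clm_apply (hA' j)) hd i j

end OrthogonalProjection

/-! ### Variations supported in a chart -/

section ChartVariation

variable {m n : ℕ} {M : Type*} [TopologicalSpace M]
  [ChartedSpace (EuclideanSpace ℝ (Fin m)) M] [IsManifold (𝓡 m) ∞ M]
  {S : Type*} [TopologicalSpace S] [ChartedSpace (EuclideanSpace ℝ (Fin n)) S]
  [IsManifold (𝓡 n) ∞ S]
  {ι : S → M} {p : S} {q : M} {V : EuclideanSpace ℝ (Fin n) → EuclideanSpace ℝ (Fin m)}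

/-- The points of `S` at which `ι` is represented by `mapRep ι p q`. -/
def repSource (ι : S → M) (p : S) (q : M) : Set S :=
  (extChartAt (𝓡 n) p).source ∩ ι ⁻¹' (extChartAt (𝓡 m) q).source

/-- The domain of `mapRep ι p q`. -/
def repTarget (ι : S → M) (p : S) (q : M) : Set (EuclideanSpace ℝ (Fin n)) :=
  {u | u ∈ (extChartAt (𝓡 n) p).target ∧
    ι ((extChartAt (𝓡 n) p).symm u) ∈ (extChartAt (𝓡 m) q).source}

theorem isOpen_repSource (hι : Continuous ι) : IsOpen (repSource (m := m) (n := n) ι p q) :=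
  (isOpen_extChartAt_source p).inter ((isOpen_extChartAt_source q).preimage hι)

theorem isOpen_repTarget (hι : ContMDiff (𝓡 n) (𝓡 m) ∞ ι) :
    IsOpen (repTarget (m := m) (n := n) ι p q) :=
  isOpen_iff_mem_nhds.2 fun _ hu => eventually_mem_chart hι hu.1 hu.2

theorem extChartAt_mem_repTarget {x : S} (hx : x ∈ repSource (m := m) (n := n) ι p q) :
    extChartAt (𝓡 n) p x ∈ repTarget (m := m) (n := n) ι p q := by
  refine ⟨(extChartAt (𝓡 n) p).map_source hx.1, ?_⟩
  rw [(extChartAt (𝓡 n) p).left_inv hx.1]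
  exact hx.2

theorem symm_mem_repSource {u : EuclideanSpace ℝ (Fin n)}
    (hu : u ∈ repTarget (m := m) (n := n) ι p q) :
    (extChartAt (𝓡 n) p).symm u ∈ repSource (m := m) (n := n) ι p q :=
  ⟨(extChartAt (𝓡 n) p).map_target hu.1, hu.2⟩

/-- The map `ι + t V` in the preferred charts at `p` and `q`. -/
def shiftRep (ι : S → M) (p : S) (q : M) (V : EuclideanSpace ℝ (Fin n) → EuclideanSpace ℝ (Fin m))
    (z : ℝ × EuclideanSpace ℝ (Fin n)) : EuclideanSpace ℝ (Fin m) :=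
  mapRep ι p q z.2 + z.1 • V z.2

open scoped Classical in
/-- The family that moves `ι` in the direction `V` in the preferred charts at `p` and `q`. -/
def chartVariation (ι : S → M) (p : S) (q : M)
    (V : EuclideanSpace ℝ (Fin n) → EuclideanSpace ℝ (Fin m)) (t : ℝ) (x : S) : M :=
  if x ∈ repSource (m := m) (n := n) ι p q then
    (extChartAt (𝓡 m) q).symm (shiftRep ι p q V (t, extChartAt (𝓡 n) p x)) else ι x

theorem chartVariation_of_mem {t : ℝ} {x : S} (hx : x ∈ repSource (m := m) (n := n) ι p q) :
    chartVariation ι p q V t x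
      = (extChartAt (𝓡 m) q).symm (shiftRep ι p q V (t, extChartAt (𝓡 n) p x)) := if_pos hx

theorem chartVariation_eq_self {t : ℝ} {x : S}
    (hx : x ∈ repSource (m := m) (n := n) ι p q → t • V (extChartAt (𝓡 n) p x) = 0) :
    chartVariation ι p q V t x = ι x := by
  by_cases h : x ∈ repSource (m := m) (n := n) ι p q
  · rw [chartVariation_of_mem h, shiftRep, hx h, add_zero, mapRep,
      (extChartAt (𝓡 n) p).left_inv h.1, (extChartAt (𝓡 m) q).left_inv h.2]
  · exact if_neg h

theorem chartVariation_zero : chartVariation (m := m) (n := n) ι p q V 0 = ι :=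
  funext fun _ => chartVariation_eq_self fun _ => zero_smul _ _

theorem contDiffAt_shiftRep (hι : ContMDiff (𝓡 n) (𝓡 m) ∞ ι)
    (hV : ContDiffOn ℝ ∞ V (repTarget (m := m) (n := n) ι p q)) {t : ℝ}
    {u : EuclideanSpace ℝ (Fin n)} (hu : u ∈ repTarget (m := m) (n := n) ι p q) :
    ContDiffAt ℝ ∞ (shiftRep ι p q V) (t, u) := by
  have h1 : ContDiffAt ℝ ∞ (mapRep (m := m) ι p q) u := contDiffAt_mapRep hι hu.1 hu.2
  have h2 : ContDiffAt ℝ ∞ V u := hV.contDiffAt ((isOpen_repTarget hι).mem_nhds hu)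
  exact (ContDiffAt.comp (t, u) (f := Prod.snd) h1 contDiffAt_snd).add
    (contDiffAt_fst.smul (ContDiffAt.comp (t, u) (f := Prod.snd) h2 contDiffAt_snd))

theorem fderiv_shiftRep_zero (hι : ContMDiff (𝓡 n) (𝓡 m) ∞ ι)
    (hV : ContDiffOn ℝ ∞ V (repTarget (m := m) (n := n) ι p q))
    {u : EuclideanSpace ℝ (Fin n)} (hu : u ∈ repTarget (m := m) (n := n) ι p q)
    (v : EuclideanSpace ℝ (Fin n)) :
    fderiv ℝ (shiftRep ι p q V) (0, u) (0, v) = fderiv ℝ (mapRep (m := m) ι p q) u v := by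
  rw [← fderiv_slice ((contDiffAt_shiftRep hι hV hu).differentiableAt (by simp))]
  simp [shiftRep]

theorem fderiv_shiftRep_time (hι : ContMDiff (𝓡 n) (𝓡 m) ∞ ι)
    (hV : ContDiffOn ℝ ∞ V (repTarget (m := m) (n := n) ι p q)) {t : ℝ}
    {u : EuclideanSpace ℝ (Fin n)} (hu : u ∈ repTarget (m := m) (n := n) ι p q) :
    fderiv ℝ (shiftRep ι p q V) (t, u) (1, 0) = V u := by
  rw [← fderiv_time ((contDiffAt_shiftRep hι hV hu).differentiableAt (by simp))]
  have h : HasDerivAt (fun s : ℝ => shiftRep ι p q V (s, u)) (V u) t := by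
    simpa [shiftRep] using (hasDerivAt_id t).smul_const (V u)
  rw [fderiv_apply_one_eq_deriv, h.deriv]

theorem localRep_chartVariation {t : ℝ} {u : EuclideanSpace ℝ (Fin n)}
    (hu : u ∈ repTarget (m := m) (n := n) ι p q)
    (ht : shiftRep ι p q V (t, u) ∈ (extChartAt (𝓡 m) q).target) :
    localRep (chartVariation ι p q V) p q (t, u) = shiftRep ι p q V (t, u) := by
  rw [localRep, chartVariation_of_mem (symm_mem_repSource hu), (extChartAt (𝓡 n) p).right_inv hu.1,
    (extChartAt (𝓡 m) q).right_inv ht]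

theorem eventually_localRep_chartVariation (hι : ContMDiff (𝓡 n) (𝓡 m) ∞ ι)
    (hV : ContDiffOn ℝ ∞ V (repTarget (m := m) (n := n) ι p q)) {t : ℝ}
    {u : EuclideanSpace ℝ (Fin n)} (hu : u ∈ repTarget (m := m) (n := n) ι p q)
    (ht : shiftRep ι p q V (t, u) ∈ (extChartAt (𝓡 m) q).target) :
    localRep (chartVariation ι p q V) p q =ᶠ[𝓝 (t, u)] shiftRep ι p q V := by
  have h1 : ∀ᶠ z in 𝓝 (t, u), shiftRep ι p q V z ∈ (extChartAt (𝓡 m) q).target :=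
    (contDiffAt_shiftRep hι hV hu).continuousAt.eventually_mem
      ((isOpen_extChartAt_target q).mem_nhds ht)
  have h2 : ∀ᶠ z : ℝ × EuclideanSpace ℝ (Fin n) in 𝓝 (t, u),
      z.2 ∈ repTarget (m := m) (n := n) ι p q :=
    continuousAt_snd.eventually_mem ((isOpen_repTarget hι).mem_nhds hu)
  filter_upwards [h1, h2] with z hz1 hz2 using localRep_chartVariation hz2 hz1

variable [T2Space S]

/-- The family is a compactly supported variation for small times. -/
theorem exists_isVariation_chartVariation (hι : IsSmoothImmersion (m := m) (n := n) ι)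
    (hV : ContDiffOn ℝ ∞ V (repTarget (m := m) (n := n) ι p q)) {K : Set S} (hK : IsCompact K)
    (hKD : K ⊆ repSource (m := m) (n := n) ι p q)
    (hVK : ∀ x ∈ repSource (m := m) (n := n) ι p q, x ∉ K → V (extChartAt (𝓡 n) p x) = 0) :
    ∃ ε, IsVariation (m := m) (n := n) ι ε (chartVariation ι p q V) K := by
  set Y := shiftRep (m := m) (n := n) ι p q V with hY
  set F := chartVariation (m := m) (n := n) ι p q V with hF
  have hDo : IsOpen (repSource (m := m) (n := n) ι p q) := isOpen_repSource hι.1.continuous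
  let A : ℝ × EuclideanSpace ℝ (Fin n) → EuclideanSpace ℝ (Fin n) →L[ℝ] EuclideanSpace ℝ (Fin m) :=
    fun z => (fderiv ℝ Y z).comp (ContinuousLinearMap.inr ℝ ℝ _)
  -- Staying in the chart target and having injective spatial derivative are open conditions on time
  -- × space, and both hold at time 0.
  have hgood : ∀ x ∈ K, ∀ᶠ z : ℝ × S in 𝓝 (0, x),
      Y (z.1, extChartAt (𝓡 n) p z.2) ∈ (extChartAt (𝓡 m) q).target ∧
      Function.Injective (A (z.1, extChartAt (𝓡 n) p z.2)) := by
    intro x hx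
    have hu := extChartAt_mem_repTarget (hKD hx)
    have hYc := contDiffAt_shiftRep (t := 0) hι.1 hV hu
    have hcx : ContinuousAt (extChartAt (𝓡 n) p) x := continuousAt_extChartAt' (hKD hx).1
    have hc : ContinuousAt (fun z : ℝ × S => (z.1, extChartAt (𝓡 n) p z.2)) (0, x) :=
      continuousAt_fst.prodMk (ContinuousAt.comp (x := ((0 : ℝ), x)) (f := Prod.snd) hcx
        continuousAt_snd)
    have h1 : ∀ᶠ w in 𝓝 ((0 : ℝ), extChartAt (𝓡 n) p x), Y w ∈ (extChartAt (𝓡 m) q).target := by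
      refine hYc.continuousAt.eventually_mem ((isOpen_extChartAt_target q).mem_nhds ?_)
      rw [shiftRep, zero_smul, add_zero]
      exact (extChartAt (𝓡 m) q).map_source hu.2
    have h2 : ∀ᶠ w in 𝓝 ((0 : ℝ), extChartAt (𝓡 n) p x), Function.Injective (A w) := by
      have hAc : ContinuousAt A ((0 : ℝ), extChartAt (𝓡 n) p x) :=
        ContinuousAt.clm_comp (hYc.continuousAt_fderiv (by simp)) continuousAt_const
      refine hAc.eventually_mem (ContinuousLinearMap.isOpen_injective.mem_nhds ?_)
      have h3 : ∀ v, A ((0 : ℝ), extChartAt (𝓡 n) p x) v = chartDeriv q (ι x)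
          (modelDeriv ι x (chartSymmDeriv p (extChartAt (𝓡 n) p x) v)) := by
        intro v
        have h4 := fderiv_mapRep hι.1 hu.1 hu.2 v
        rw [(extChartAt (𝓡 n) p).left_inv (hKD hx).1] at h4
        exact (fderiv_shiftRep_zero hι.1 hV hu v).trans h4
      intro v w hvw
      rw [h3, h3] at hvw
      have h5 := congrArg (chartSymmDeriv q (extChartAt (𝓡 m) q (ι x))) hvw
      rw [chartSymmDeriv_chartDeriv (hKD hx).2, chartSymmDeriv_chartDeriv (hKD hx).2] at h5
      exact chartSymmDeriv_injective hu.1 (hι.2 x h5)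
    exact hc.eventually (h1.and h2)
  -- Compactness of `K` makes the admissible time interval uniform in the point.
  have hev := hK.eventually_forall_of_forall_eventually
    (P := fun t x => Y (t, extChartAt (𝓡 n) p x) ∈ (extChartAt (𝓡 m) q).target ∧
      Function.Injective (A (t, extChartAt (𝓡 n) p x))) hgood
  obtain ⟨ε, hε, hball⟩ := Metric.eventually_nhds_iff_ball.1 hev
  rw [Real.ball_zero_eq_Ioo] at hball
  have hoff : ∀ t, ∀ x ∉ K, F t x = ι x := fun t x hx =>
    chartVariation_eq_self fun hxD => by rw [hVK x hxD hx, smul_zero]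
  have hsmooth : IsSmoothFamily (m := m) (n := n) ε F := by
    rintro ⟨t, x⟩ ⟨ht, -⟩
    refine ContMDiffAt.contMDiffWithinAt ?_
    by_cases hx : x ∈ K
    · have hu := extChartAt_mem_repTarget (hKD hx)
      have h1 : ContMDiffAt (𝓘(ℝ, ℝ).prod (𝓡 n)) 𝓘(ℝ, ℝ × EuclideanSpace ℝ (Fin n)) ∞
          (fun z : ℝ × S => (z.1, extChartAt (𝓡 n) p z.2)) (t, x) :=
        contMDiffAt_fst.prodMk_space
          (ContMDiffAt.comp (t, x) (extChartAt_contMDiffAt (hKD hx).1) contMDiffAt_snd)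
      have h2 : ContMDiffAt 𝓘(ℝ, ℝ × EuclideanSpace ℝ (Fin n)) (𝓡 m) ∞ Y
          (t, extChartAt (𝓡 n) p x) := (contDiffAt_shiftRep hι.1 hV hu).contMDiffAt
      have h3 := (extChartAt_symm_contMDiffAt (hball t ht x hx).1).comp
        (t, extChartAt (𝓡 n) p x) h2
      refine (ContMDiffAt.comp (t, x) h3 h1).congr_of_eventuallyEq ?_
      have h4 : ∀ᶠ z : ℝ × S in 𝓝 (t, x), z.2 ∈ repSource (m := m) (n := n) ι p q :=
        continuousAt_snd.eventually_mem (hDo.mem_nhds (hKD hx))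
      filter_upwards [h4] with z hz using chartVariation_of_mem hz
    · refine (ContMDiffAt.comp (t, x) (hι.1 x) contMDiffAt_snd).congr_of_eventuallyEq ?_
      have h4 : ∀ᶠ z : ℝ × S in 𝓝 (t, x), z.2 ∈ Kᶜ :=
        continuousAt_snd.eventually_mem (hK.isClosed.isOpen_compl.mem_nhds hx)
      filter_upwards [h4] with z hz using hoff z.1 z.2 hz
  refine ⟨ε, hε, hsmooth, ?_, chartVariation_zero, hK, fun t _ x hx => hoff t x hx⟩
  intro t ht x
  by_cases hx : x ∈ K
  · have hu := extChartAt_mem_repTarget (hKD hx)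
    have hYt := (hball t ht x hx).1
    have hxeq := (extChartAt (𝓡 n) p).left_inv (hKD hx).1
    have hq : F t x ∈ (extChartAt (𝓡 m) q).source := by
      rw [hF, chartVariation_of_mem (hKD hx)]
      exact (extChartAt (𝓡 m) q).map_target hYt
    have hz : (t, extChartAt (𝓡 n) p x) ∈ localDomain (m := m) (n := n) ε F p q :=
      ⟨ht, hu.1, by rwa [hxeq]⟩
    have h3 : ∀ v, A (t, extChartAt (𝓡 n) p x) v = chartDeriv q (F t x)
        (modelDeriv (F t) x (chartSymmDeriv p (extChartAt (𝓡 n) p x) v)) := by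
      intro v
      have h4 := hsmooth.fderiv_localRep hz v
      rw [(eventually_localRep_chartVariation hι.1 hV hu hYt).fderiv_eq, hxeq] at h4
      exact h4
    -- On `K` the chart derivatives are invertible, so injectivity of the spatial derivative of the
    -- shifted map passes to `F t`.
    have h5 : ∀ a, modelDeriv (m := m) (n := n) (F t) x a = 0 → a = 0 := by
      intro a ha
      have h6 := h3 (chartDeriv p x a)
      rw [chartSymmDeriv_chartDeriv (hKD hx).1, ha, map_zero] at h6
      have h7 := (hball t ht x hx).2 (h6.trans (map_zero _).symm)
      rw [← chartSymmDeriv_chartDeriv (hKD hx).1 a, h7, map_zero]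
    exact (injective_iff_map_eq_zero (modelDeriv (m := m) (n := n) (F t) x)).2 h5
  · have h1 : F t =ᶠ[𝓝 x] ι := by
      filter_upwards [hK.isClosed.isOpen_compl.mem_nhds hx] with y hy using hoff t y hy
    have h2 : modelDeriv (m := m) (n := n) (F t) x = modelDeriv ι x := h1.mfderiv_eq
    have h3 : Function.Injective (modelDeriv (m := m) (n := n) (F t) x) := by
      rw [h2]
      exact hι.2 x
    exact h3

end ChartVariation

end WeightedMinimal

namespace WeightedMinimal

open MeasureTheory

/-! ### From `f`-minimality to the pointwise equation -/

section Criticality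

variable {m n : ℕ} {M : Type*} [TopologicalSpace M]
  [ChartedSpace (EuclideanSpace ℝ (Fin m)) M] [IsManifold (𝓡 m) ∞ M]
  {S : Type*} [TopologicalSpace S] [ChartedSpace (EuclideanSpace ℝ (Fin n)) S]
  [IsManifold (𝓡 n) ∞ S]
  (g : Bundle.ContMDiffRiemannianMetric (𝓡 m) ∞ (EuclideanSpace ℝ (Fin m))
      (fun x : M => TangentSpace (𝓡 m) x))
  {ι : S → M} {p x : S} {q : M} {f : M → ℝ} {u : EuclideanSpace ℝ (Fin n)}

theorem contDiffAt_firstVariationForm (hι : IsSmoothImmersion (m := m) (n := n) ι)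
    (hf : ContMDiff (𝓡 m) 𝓘(ℝ, ℝ) ∞ f) (hu : u ∈ repTarget (m := m) (n := n) ι p q)
    {X : EuclideanSpace ℝ (Fin n) → EuclideanSpace ℝ (Fin m)} (hX : ContDiffAt ℝ ∞ X u) :
    ContDiffAt ℝ ∞ (fun u => firstVariationForm g f ι p q u (X u)) u := by
  have hLC := isLeviCivitaOn_chart g q
  have hy : mapRep ι p q u ∈ (extChartAt (𝓡 m) q).target := (extChartAt (𝓡 m) q).map_source hu.2
  have hφ : ContDiffAt ℝ ∞ (mapRep (m := m) (n := n) ι p q) u := contDiffAt_mapRep hι.1 hu.1 hu.2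
  have hfd : ContDiffAt ℝ ∞ (fderiv ℝ (chartFun (m := m) f q)) (mapRep ι p q u) :=
    ((contDiffOn_chartFun hf q).contDiffAt (hLC.isOpen.mem_nhds hy)).fderiv_right (m := ∞) (by simp)
  simp only [firstVariationForm]
  refine ((hfd.comp u hφ).clm_apply hX).add (ContDiffAt.sum fun i _ => ContDiffAt.sum fun j _ => ?_)
  exact (contDiffAt_inv_apply (fun i j => contDiffAt_chartGram_induced g hι.1 hu.1 i j)
    (inducedGram_pos g hu.1 (hι.2 _)).ne' i j).mul
      (hLC.contDiffAt_metric hy hφ hX (hLC.contDiffAt_covD hy hφ (contDiffAt_fderiv_apply hφ _) _))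

theorem firstVariationForm_smul (c : ℝ) (w : EuclideanSpace ℝ (Fin m)) :
    firstVariationForm (n := n) g f ι p q u (c • w) = c * firstVariationForm g f ι p q u w := by
  simp only [firstVariationForm, map_smul, smul_apply, smul_eq_mul, mul_add, Finset.mul_sum]
  congr 1
  exact Finset.sum_congr rfl fun i _ => Finset.sum_congr rfl fun j _ => by ring

/-- The normal component, in the preferred charts at `p` and `q`, of a constant vector. -/
def normalField (ι : S → M) (p : S) (q : M) (w : EuclideanSpace ℝ (Fin m))
    (u : EuclideanSpace ℝ (Fin n)) : EuclideanSpace ℝ (Fin m) :=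
  orthoProj (chartMetric g q (mapRep ι p q u)) (fderiv ℝ (mapRep (m := m) (n := n) ι p q) u) w

theorem gram_mapRep_ne_zero (hι : IsSmoothImmersion (m := m) (n := n) ι)
    (hu : u ∈ repTarget (m := m) (n := n) ι p q) :
    (Matrix.of fun i j => chartMetric g q (mapRep ι p q u)
      (fderiv ℝ (mapRep (m := m) (n := n) ι p q) u (stdVec i))
      (fderiv ℝ (mapRep (m := m) (n := n) ι p q) u (stdVec j))).det ≠ 0 := by
  have h : (Matrix.of fun i j => chartMetric g q (mapRep ι p q u)
      (fderiv ℝ (mapRep (m := m) (n := n) ι p q) u (stdVec i))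
      (fderiv ℝ (mapRep (m := m) (n := n) ι p q) u (stdVec j)))
      = chartGram (inducedMetric (n := n) g ι) p u := by
    ext i j
    exact (chartGram_eq_mapRep g hι.1 hu.1 hu.2 i j).symm
  rw [h]
  exact (inducedGram_pos g hu.1 (hι.2 _)).ne'

theorem metric_normalField (hι : IsSmoothImmersion (m := m) (n := n) ι)
    (hu : u ∈ repTarget (m := m) (n := n) ι p q) (w : EuclideanSpace ℝ (Fin m))
    (v : EuclideanSpace ℝ (Fin n)) :
    chartMetric g q (mapRep ι p q u) (normalField g ι p q w u) (fderiv ℝ (mapRep ι p q) u v) = 0 :=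
  metric_orthoProj (gram_mapRep_ne_zero g hι hu) w v

theorem contDiffAt_normalField (hι : IsSmoothImmersion (m := m) (n := n) ι)
    (hu : u ∈ repTarget (m := m) (n := n) ι p q) (w : EuclideanSpace ℝ (Fin m)) :
    ContDiffAt ℝ ∞ (normalField (n := n) g ι p q w) u := by
  have hy : mapRep ι p q u ∈ (extChartAt (𝓡 m) q).target := (extChartAt (𝓡 m) q).map_source hu.2
  have hφ : ContDiffAt ℝ ∞ (mapRep (m := m) (n := n) ι p q) u := contDiffAt_mapRep hι.1 hu.1 hu.2
  have hG : ContDiffAt ℝ ∞ (chartMetric g q) (mapRep ι p q u) :=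
    (contDiffOn_chartMetric g q).contDiffAt ((isOpen_extChartAt_target q).mem_nhds hy)
  exact contDiffAt_orthoProj (B := fun u => chartMetric g q (mapRep ι p q u))
    (A := fderiv ℝ (mapRep (m := m) (n := n) ι p q))
    (ContDiffAt.comp (g := chartMetric g q) u hG hφ) (hφ.fderiv_right (m := ∞) (by simp))
    (gram_mapRep_ne_zero g hι hu) w

theorem orthoProj_sum {B : EuclideanSpace ℝ (Fin m) →L[ℝ] EuclideanSpace ℝ (Fin m) →L[ℝ] ℝ}
    {A : EuclideanSpace ℝ (Fin n) →L[ℝ] EuclideanSpace ℝ (Fin m)} {κ : Type*} (s : Finset κ)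
    (w : κ → EuclideanSpace ℝ (Fin m)) :
    orthoProj B A (∑ i ∈ s, w i) = ∑ i ∈ s, orthoProj B A (w i) :=
  map_sum (AddMonoidHom.mk' (orthoProj B A) orthoProj_add) w s

theorem ofTangent_normalPart (w : TangentSpace (𝓡 m) (ι x)) :
    ofTangent (normalPart (n := n) g ι x w)
      = orthoProj (innerModel g (ι x)) (modelDeriv (n := n) ι x) (ofTangent w) := rfl

theorem ofTangent_meanCurvature (e : Fin n → (x : S) → TangentSpace (𝓡 n) x) :
    ofTangent (meanCurvature (n := n) g ι e x) = -∑ i, orthoProj (innerModel g (ι x))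
      (modelDeriv (n := n) ι x) (ofTangent (frameDeriv (n := n) g ι e x i i)) := rfl

/-- At a critical point of the weighted area, the mean curvature is the normal gradient. -/
theorem IsCriticalAt.meanCurvature_eq (hcrit : IsCriticalAt (n := n) g f ι x)
    (hι : IsSmoothImmersion (m := m) (n := n) ι) {U : Set S} (hU : IsOpen U) (hx : x ∈ U)
    {e : Fin n → (x : S) → TangentSpace (𝓡 n) x} (he : IsOrthonormalFrameOn g ι U e) :
    meanCurvature g ι e x = normalPart (n := n) g ι x (gradient (metricFn g) f (ι x)) := by
  set B := innerModel g (ι x) with hB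
  set D := modelDeriv (m := m) (n := n) ι x with hD
  set H : Fin n → EuclideanSpace ℝ (Fin m) := fun i => ofTangent (frameDeriv (n := n) g ι e x i i)
    with hH
  set a : EuclideanSpace ℝ (Fin m) := ofTangent (gradient (metricFn g) f (ι x)) with ha
  have hxD : x ∈ repSource (m := m) (n := n) ι x (ι x) :=
    ⟨mem_extChartAt_source x, mem_extChartAt_source (ι x)⟩
  have hu0 := extChartAt_mem_repTarget hxD
  have hφD := fderiv_mapRep_self (x := x) hι.1
  have hdet := gram_mapRep_ne_zero g hι hu0
  simp only [hφD, mapRep_self, ← innerModel_eq_chartMetric] at hdet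
  have hnormal : ∀ w v, B (orthoProj B D w) (D v) = 0 := metric_orthoProj hdet
  -- The critical equation is the pairing of w with the sum of all ∇_{eᵢ} eᵢ and ∇f, since a normal
  -- w ignores the tangential discrepancy between the frame and constant fields.
  have hzero : ∀ w, (∀ v, B w (D v) = 0) → B w (∑ i, H i + a) = 0 := by
    intro w hw
    have h1 := hcrit w hw
    rw [firstVariationForm_eq_sum g hι.1 hu0.1 hu0.2 (e := fun i => ofTangent (e i x))
      (fun i j => by
        rw [hφD, hφD, mapRep_self, ← innerModel_eq_chartMetric]
        exact he.2 x hx i j), mapRep_self, ← innerModel_eq_chartMetric] at h1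
    have h2 : B w a = fderiv ℝ (chartFun (m := m) f (ι x)) (extChartAt (𝓡 m) (ι x) (ι x)) w := by
      have h3 : B w a = B a w := g.symm _ _ _
      rw [h3]
      refine metric_gradient (fun i j => ?_) (chartGram_metricFn_symm g (ι x) _)
        (chartGram_metricFn_det_pos g (mem_extChartAt_target (ι x))).ne' f w
      rw [chartGram_metricFn, hB, innerModel_eq_chartMetric]
    rw [map_add, h2, map_sum, ← h1, add_comm]
    refine congrArg _ (Finset.sum_congr rfl fun i _ => ?_)
    obtain ⟨τ, hτ⟩ := frameDeriv_eq_covD g hι.1 hU hx he.1 i i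
    rw [hH]
    simp only
    rw [hτ, map_add, hw, add_zero]
  -- The projection P v of v = ∑ Hᵢ + a is itself normal, so ⟨P v, P v⟩ = ⟨P v, v⟩ = 0 and P v
  -- vanishes by positivity.
  have hP : orthoProj B D (∑ i, H i + a) = 0 := by
    by_contra hne
    have h1 : 0 < B (orthoProj B D (∑ i, H i + a)) (orthoProj B D (∑ i, H i + a)) := g.pos _ _ hne
    rw [metric_sub_orthoProj (hnormal _), hzero _ (hnormal _)] at h1
    exact h1.false
  have h2 : ofTangent (meanCurvature (n := n) g ι e x)
      = ofTangent (normalPart (n := n) g ι x (gradient (metricFn g) f (ι x))) := by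
    rw [ofTangent_meanCurvature, ofTangent_normalPart, ← orthoProj_sum, neg_eq_iff_add_eq_zero,
      ← orthoProj_add]
    exact hP
  exact h2

variable [T2Space S] [SecondCountableTopology S] [MeasurableSpace S] [BorelSpace S]

/-- If the form were negative at `x` on a normal vector, it would stay negative nearby on a normal
extension. A cutoff of that extension generates a variation whose density has nonnegative, somewhere
positive derivative, so the area could not be stationary. -/
theorem IsFMinimal.firstVariationForm_nonneg (hι : IsSmoothImmersion (m := m) (n := n) ι)
    (hf : ContMDiff (𝓡 m) 𝓘(ℝ, ℝ) ∞ f) (hmin : IsFMinimal (n := n) g f ι)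
    (w : EuclideanSpace ℝ (Fin m))
    (hw : ∀ v : EuclideanSpace ℝ (Fin n), innerModel g (ι x) w (modelDeriv ι x v) = 0) :
    0 ≤ firstVariationForm (n := n) g f ι x (ι x) (extChartAt (𝓡 n) x x) w := by
  by_contra! hneg
  set q := ι x with hq
  set u₀ := extChartAt (𝓡 n) x x with hu₀
  have hxD : x ∈ repSource (m := m) (n := n) ι x q :=
    ⟨mem_extChartAt_source x, mem_extChartAt_source q⟩
  have hu0 : u₀ ∈ repTarget (m := m) (n := n) ι x q := extChartAt_mem_repTarget hxD
  -- Projecting the constant field w onto the normal spaces extends w, because w is already normal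
  -- at `x`.
  have hN0 : normalField (n := n) g ι x q w u₀ = w := by
    refine orthoProj_eq_self fun v => ?_
    rw [hu₀, fderiv_mapRep_self hι.1, hq, mapRep_self, ← innerModel_eq_chartMetric]
    exact hw v
  set z : EuclideanSpace ℝ (Fin n) → ℝ := fun u =>
    firstVariationForm (n := n) g f ι x q u (normalField g ι x q w u) with hz
  have hzc : ContinuousAt z u₀ :=
    (contDiffAt_firstVariationForm g hι hf hu0 (contDiffAt_normalField g hι hu0 w)).continuousAt
  have hz0 : z u₀ < 0 := by
    rw [hz]
    simp only [hN0]
    exact hneg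
  have hnhds : ∀ᶠ y in 𝓝 x, y ∈ repSource (m := m) (n := n) ι x q ∧
      z (extChartAt (𝓡 n) x y) < 0 :=
    Filter.Eventually.and ((isOpen_repSource hι.1.continuous).mem_nhds hxD)
      ((continuousAt_extChartAt (I := 𝓡 n) x).eventually (hzc.eventually_lt_const hz0))
  -- The closed support of the bump lies in the chart region where `z` is negative.
  obtain ⟨χ, -, hχ⟩ := (SmoothBumpFunction.nhds_basis_tsupport (I := 𝓡 n) x).mem_iff.1 hnhds
  set K := tsupport χ with hKdef
  have hK : IsCompact K := χ.hasCompactSupport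
  have hKD : K ⊆ repSource (m := m) (n := n) ι x q := fun y hy => (hχ hy).1
  set V : EuclideanSpace ℝ (Fin n) → EuclideanSpace ℝ (Fin m) := fun u =>
    χ ((extChartAt (𝓡 n) x).symm u) • normalField g ι x q w u with hVdef
  have hV : ContDiffOn ℝ ∞ V (repTarget (m := m) (n := n) ι x q) := by
    intro u hu
    suffices h : ContDiffAt ℝ ∞ (fun u => χ ((extChartAt (𝓡 n) x).symm u)) u from
      (h.smul (contDiffAt_normalField g hι hu w)).contDiffWithinAt
    rw [← contMDiffAt_iff_contDiffAt]
    exact χ.contMDiffAt.comp u (extChartAt_symm_contMDiffAt hu.1)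
  obtain ⟨ε, hvar⟩ := exists_isVariation_chartVariation hι hV hK hKD (fun y hy hyK => by
    rw [hVdef]
    simp only
    rw [(extChartAt (𝓡 n) x).left_inv hy.1, image_eq_zero_of_notMem_tsupport hyK, zero_smul])
  set F := chartVariation (m := m) (n := n) ι x q V with hFdef
  have hFs := hvar.isSmoothFamily
  have hFi := hvar.isImmersedFamily
  have h0 := hvar.zero_mem
  have hF0 : F 0 = ι := hvar.start
  have hden := hFs.isDensity g hFi h0
  have hlf := hden.isLocallyFiniteMeasure
  have hop := hden.isOpenPosMeasure
  set h : S → ℝ := fun y => deriv (fun s => weightDensity (n := n) g f F s y) 0 with hh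
  have hcont : Continuous h := (hFs.isLocallySmooth_weightDensity g hFi h0 hf).deriv.continuous h0
  have hoff : ∀ y ∉ K, h y = 0 := fun y hy =>
    deriv_eq_zero_of_const_off (ρ := weightDensity (n := n) g f F)
      (fun t ht y hy => hvar.weightDensity_const g ht hy) h0 hy
  have hon : ∀ y ∈ K, h y = -(Real.exp (-f (ι y)) * (χ y * z (extChartAt (𝓡 n) x y))) := by
    intro y hy
    set u := extChartAt (𝓡 n) x y with hu
    have huD : u ∈ repTarget (m := m) (n := n) ι x q := extChartAt_mem_repTarget (hKD hy)
    have hyu : (extChartAt (𝓡 n) x).symm u = y := (extChartAt (𝓡 n) x).left_inv (hKD hy).1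
    have hY : ∀ u ∈ repTarget (m := m) (n := n) ι x q,
        shiftRep ι x q V (0, u) ∈ (extChartAt (𝓡 m) q).target := by
      intro u hu
      rw [shiftRep, zero_smul, add_zero]
      exact (extChartAt (𝓡 m) q).map_source hu.2
    have hdT : ∀ u ∈ repTarget (m := m) (n := n) ι x q,
        fderiv ℝ (localRep (m := m) (n := n) F x q) (0, u) (1, 0) = V u := by
      intro u hu
      rw [(eventually_localRep_chartVariation hι.1 hV hu (hY u hu)).fderiv_eq,
        fderiv_shiftRep_time hι.1 hV hu]
    have hdD : ∀ u ∈ repTarget (m := m) (n := n) ι x q, ∀ v,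
        fderiv ℝ (localRep (m := m) (n := n) F x q) (0, u) (0, v)
          = fderiv ℝ (mapRep ι x q) u v := by
      intro u hu v
      rw [(eventually_localRep_chartVariation hι.1 hV hu (hY u hu)).fderiv_eq,
        fderiv_shiftRep_zero hι.1 hV hu]
    have hrep : ∀ u, localRep (m := m) (n := n) F x q (0, u) = mapRep ι x q u := by
      intro u
      rw [localRep, mapRep, hF0]
    have hz' : ((0 : ℝ), u) ∈ localDomain (m := m) (n := n) ε F x q :=
      ⟨h0, huD.1, by rw [hF0]; exact huD.2⟩
    have h1 := hFs.deriv_weightDensity g hFi h0 hf hz' (by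
      filter_upwards [(isOpen_repTarget hι.1).mem_nhds huD] with u' hu' v
      rw [hdT u' hu', hdD u' hu', hrep, hVdef]
      simp only [map_smul, smul_apply]
      rw [metric_normalField g hι hu', smul_zero])
    rw [hyu, hdT u huD, hF0] at h1
    rw [hh]
    simp only
    rw [h1, hVdef]
    simp only
    rw [firstVariationForm_smul, hyu]
  have hnn : 0 ≤ h := by
    intro y
    by_cases hy : y ∈ K
    · rw [hon y hy]
      have h1 := (hχ hy).2
      have h2 := χ.nonneg (x := y)
      have h3 := Real.exp_pos (-f (ι y))
      have h4 : χ y * z (extChartAt (𝓡 n) x y) ≤ 0 := mul_nonpos_of_nonneg_of_nonpos h2 h1.le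
      have h5 := mul_nonpos_of_nonneg_of_nonpos h3.le h4
      simpa using h5
    · rw [hoff y hy]
      rfl
  have hxK : x ∈ K := subset_tsupport χ (by
    rw [Function.mem_support, χ.eq_one]
    exact one_ne_zero)
  -- The bump equals 1 at its centre, so the derivative of the density is strictly positive there.
  have hne : h x ≠ 0 := by
    rw [hon x hxK, χ.eq_one, one_mul]
    exact neg_ne_zero.2 (mul_ne_zero (Real.exp_pos _).ne' hz0.ne)
  have hpos := hcont.integral_pos_of_hasCompactSupport_nonneg_nonzero
    (μ := riemannianVolume (inducedMetric (n := n) g (F 0)))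
    (HasCompactSupport.intro hK fun y hy => hoff y hy) hnn hne
  have hexp : Continuous fun y => Real.exp (-f (F 0 y)) := by
    have : Continuous (F 0) := (hFs.contMDiff h0).continuous
    exact Real.continuous_exp.comp (hf.continuous.comp this).neg
  have hd := hvar.weightedArea_deriv g hf hK.measurableSet
    (hexp.continuousOn.integrableOn_compact hK) h0
  -- Minimality says that the derivative of the area over `K` is 0, while the computed derivative is
  -- the integral of `h` over `K`, equal to that over `S` since `h` vanishes off `K`.
  have h6 := hd.unique (hmin ε F K hvar)
  rw [setIntegral_eq_integral_of_forall_compl_eq_zero (fun y hy => hoff y hy)] at h6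
  exact hpos.ne' h6

/-- An `f`-minimal immersion is pointwise critical. -/
theorem IsFMinimal.isCriticalAt (hι : IsSmoothImmersion (m := m) (n := n) ι)
    (hf : ContMDiff (𝓡 m) 𝓘(ℝ, ℝ) ∞ f) (hmin : IsFMinimal (n := n) g f ι) (x : S) :
    IsCriticalAt (n := n) g f ι x := by
  intro w hw
  have h1 := hmin.firstVariationForm_nonneg g hι hf w hw
  -- The normal space is symmetric and the form linear, so the inequality for -w is the reverse
  -- inequality for w.
  have h2 := hmin.firstVariationForm_nonneg g hι hf ((-1 : ℝ) • w) (fun v => by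
    rw [map_smul, smul_apply, hw, smul_zero])
  rw [firstVariationForm_smul] at h2
  linarith

end Criticality

end WeightedMinimal

end

/-! ### Assembly of the theorem -/

theorem proposition1 {m n : ℕ}
    {M : Type*} [TopologicalSpace M] [T2Space M] [SecondCountableTopology M]
    [ChartedSpace (EuclideanSpace ℝ (Fin m)) M] [IsManifold (𝓡 m) ∞ M]
    {S : Type*} [TopologicalSpace S] [T2Space S] [SecondCountableTopology S]
    [ChartedSpace (EuclideanSpace ℝ (Fin n)) S] [IsManifold (𝓡 n) ∞ S]
    [MeasurableSpace S] [BorelSpace S]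
    (g : Bundle.ContMDiffRiemannianMetric (𝓡 m) ∞ (EuclideanSpace ℝ (Fin m))
      (fun x : M => TangentSpace (𝓡 m) x))
    (f : M → ℝ) (hf : ContMDiff (𝓡 m) 𝓘(ℝ, ℝ) ∞ f)
    (ι : S → M) (hι : WeightedMinimal.IsSmoothImmersion (m := m) (n := n) ι)
    (hmin : WeightedMinimal.IsFMinimal (n := n) g f ι) :
    (∀ (U : Set S) (e : Fin n → (x : S) → TangentSpace (𝓡 n) x), IsOpen U →
      WeightedMinimal.IsOrthonormalFrameOn g ι U e → ∀ x ∈ U,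
        WeightedMinimal.meanCurvature g ι e x =
          WeightedMinimal.normalPart (n := n) g ι x
            (WeightedMinimal.gradient (WeightedMinimal.metricFn g) f (ι x))) ∧
    (∀ (ε : ℝ) (F : ℝ → S → M) (K : Set S), WeightedMinimal.IsVariation (m := m) (n := n) ι ε F K →
      (∀ t ∈ Set.Ioo (-ε) ε, ∀ x : S,
        WeightedMinimal.IsNormalVec (n := n) g (F t) x (WeightedMinimal.velocity F t x)) →
      ∃ Q : S → ℝ,
        (∀ (U : Set S) (e : Fin n → (x : S) → TangentSpace (𝓡 n) x), IsOpen U →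
          WeightedMinimal.IsOrthonormalFrameOn g (F 0) U e → ∀ x ∈ U,
            Q x = WeightedMinimal.secondVariationExpr g f (F 0)
              (WeightedMinimal.velocity F 0) e x) ∧
        MeasureTheory.Integrable (fun x => Real.exp (-f (F 0 x)) * Q x)
          (WeightedMinimal.riemannianVolume (WeightedMinimal.inducedMetric (n := n) g (F 0))) ∧
        ∀ T : Set S, MeasurableSet T → K ⊆ T →
          MeasureTheory.IntegrableOn (fun x => Real.exp (-f (F 0 x))) T
            (WeightedMinimal.riemannianVolume (WeightedMinimal.inducedMetric (n := n) g (F 0))) →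
          (∀ t ∈ Set.Ioo (-ε) ε,
            DifferentiableAt ℝ (fun s => WeightedMinimal.weightedArea (n := n) g f (F s) T) t) ∧
          HasDerivAt (deriv fun s => WeightedMinimal.weightedArea (n := n) g f (F s) T)
            (∫ x, Real.exp (-f (F 0 x)) * Q x
              ∂(WeightedMinimal.riemannianVolume (WeightedMinimal.inducedMetric (n := n) g (F 0)))) 0) := by
  have hcrit : ∀ x, WeightedMinimal.IsCriticalAt (n := n) g f ι x := hmin.isCriticalAt g hι hf
  refine ⟨fun U e hU he x hx => (hcrit x).meanCurvature_eq g hι hU hx he,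
    fun ε F K hV hn => ?_⟩
  have hF := hV.isSmoothFamily
  have hI := hV.isImmersedFamily
  have h0 := hV.zero_mem
  have hQ : ∀ x, Real.exp (-f (F 0 x)) * (Real.exp (f (F 0 x)) *
      deriv (deriv fun s => WeightedMinimal.weightDensity (n := n) g f F s x) 0)
      = deriv (deriv fun s => WeightedMinimal.weightDensity (n := n) g f F s x) 0 := fun x => by
    rw [← mul_assoc, ← Real.exp_add, neg_add_cancel, Real.exp_zero, one_mul]
  -- Q is the second time derivative of the density divided by the weight. It is defined without a
  -- frame, so the formula in every frame and the independence of the frame are proved together.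
  refine ⟨fun x => Real.exp (f (F 0 x)) *
    deriv (deriv fun s => WeightedMinimal.weightDensity (n := n) g f F s x) 0, ?_, ?_, ?_⟩
  · intro U e hU he x hx
    have hc : WeightedMinimal.IsCriticalAt (n := n) g f (F 0) x := by
      rw [hV.start]
      exact hcrit x
    beta_reduce
    rw [(hF.hasDerivAt_deriv_weightDensity g hI h0 hf hn hc hU hx he).deriv, ← mul_assoc,
      ← Real.exp_add, add_neg_cancel, Real.exp_zero, one_mul]
  · simp only [hQ]
    exact (hV.weightedArea_deriv_deriv g hf).1
  · intro T hT hKT hint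
    refine ⟨fun t ht => (hV.weightedArea_deriv g hf hT hint ht).differentiableAt, ?_⟩
    simp only [hQ]
    exact (hV.weightedArea_deriv_deriv g hf).2 T hT hKT hint
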